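/- Let $B=\mathbb R^2$ or $B=\mathbb T^2=\mathbb R^2/\mathbb Z^2$ with its flat metric, let $E=B\times\mathbb R$ with the product metric, let $e_z$ be the unit vertical vector, and let $\pi:E\to B$ be the projection. A smooth billiard table $D\subseteq B$ is the closure of an open set of $B$ such that $\partial D$ is a smooth one-dimensional submanifold of $B$ without boundary. The billiard flow $\Psi_t$, $t\in\mathbb R$, moves a point of $D$ along a straight line at unit speed in $\mathrm{Int}\,D$; at a point of $\partial D$ with unit normal $n$, an incoming velocity $v$ that is not tangent to $\partial D$ is replaced by $v-2\langle v,n\rangle n$. Let $\Sigma$ be a compact smooth surface (without boundary) smoothly immersed in $E$, such that $\pi(\Sigma)=D$ is a smooth billiard table. For $\epsilon>0$ let $f_\epsilon(x,y,z)=(x,y,\epsilon z)$ and let $g_\epsilon$ be the Riemannian metric on $\Sigma$ obtained by pulling back the flat metric of $E$ by the immersion followed by $f_\epsilon$. Let $T^1\Sigma$ be the unit tangent bundle for $g_1$. For $(q,p)\in T^1\Sigma$ let $\Phi^\epsilon_t(q,p)$ be the position and velocity at time $t$ of the unit speed geodesic of $(\Sigma,g_\epsilon)$ that starts at $q$ in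 the direction of $p$ (that is, with velocity $p/\|p\|_{g_\epsilon}$). For a nonzero tangent vector $p$ of $\Sigma$ at a point $q$ with $\pi(q)\in\mathrm{Int}\,D$, put $\pi_*(q,p)=\left(\pi(q),\,D_q\pi(p)/\|D_q\pi(p)\|\right)$. Assume that 1. for all $q\in\Sigma$ with $\pi(q)\in\mathrm{Int}\,D$, $e_z\notin T_q\Sigma$ (so that $\pi_*$ is well defined); 2. for all $q\in\Sigma$ with $\pi(q)\in\partial D$, the curve in which $\Sigma$ (near $q$) meets the affine plane $q+\mathrm{Vect}(e_z,(T_q\Sigma)^\perp)$ has nonzero curvature at $q$. Let $A$ be the set of all $(t,q,p)\in\mathbb R\times T^1\Sigma$ such that $\pi_*(q,p)$ and $\Psi_t(\pi_*(q,p))$ lie over $\mathrm{Int}\,D$ and such that the billiard trajectory between them has finitely many collisions with $\partial D$, none of them tangential ($t$ may be negative). Then, for every compact $K\subseteq A$: for all sufficiently small $\epsilon>0$ and all $(t,q,p)\in K$, the point $\Phi^\epsilon_t(q,p)$ lies over $\mathrm{Int}\,D$, and the maps $(t,q,p)\mapsto\pi_*(\Phi^\epsilon_t(q,p))\in T^1(\mathrm{Int}\,D)$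 converge uniformly on $K$, as $\epsilon\to0^+$, to $(t,q,p)\mapsto\Psi_t(\pi_*(q,p))$. -/

import Mathlib

open Set Filter Topology
open scoped Manifold ContDiff InnerProductSpace

noncomputable section

namespace FlatBilliard

/-! ### The base `B` and the ambient space `E = B × ℝ` -/

/-- The Euclidean plane `ℝ²`. -/
abbrev Plane := EuclideanSpace ℝ (Fin 2)

/-- Euclidean space `ℝ³ = ℝ² × ℝ`, with its Euclidean (L²) norm: `x.fst` is the horizontal part
and `x.snd` is the `z`-coordinate. -/
abbrev Space := WithLp 2 (Plane × ℝ)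

/-- The integer lattice `ℤ² ⊆ ℝ²`. -/
def integerLattice : AddSubgroup Plane where
  carrier := {x | ∀ j, ∃ n : ℤ, x j = n}
  zero_mem' := fun _ => ⟨0, by simp⟩
  add_mem' := fun {a b} ha hb j => by
    obtain ⟨m, hm⟩ := ha j
    obtain ⟨n, hn⟩ := hb j
    exact ⟨m + n, by simp [hm, hn]⟩
  neg_mem' := fun {a} ha j => by
    obtain ⟨m, hm⟩ := ha j
    exact ⟨-m, by simp [hm]⟩

/-- The base `B = ℝ² / Λ`, with its quotient topology, uniform structure and flat metric.
For `Λ = 0` it is the plane `ℝ²`, for `Λ = ℤ²` it is the flat torus `𝕋²`.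
All its tangent spaces are canonically `ℝ²`. -/
abbrev Base (Λ : AddSubgroup Plane) := Plane ⧸ Λ

/-- The projection `ℝ² → B`. -/
abbrev toBase (Λ : AddSubgroup Plane) (x : Plane) : Base Λ := QuotientAddGroup.mk x

/-- The universal covering map `ℝ³ → E = B × ℝ`, a local isometry. -/
def cover (Λ : AddSubgroup Plane) (x : Space) : Base Λ × ℝ := (toBase Λ x.fst, x.snd)

/-- The vertical vector `e_z`. -/
def ez : Space := WithLp.toLp 2 (0, 1)

/-- The flattening map `f_ε (x, y, z) = (x, y, ε z)` on `ℝ³` (it is linear). -/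
def flatten (ε : ℝ) (x : Space) : Space := WithLp.toLp 2 (x.fst, ε * x.snd)

/-! ### Immersed surfaces -/

section Surface

variable {M : Type*} [TopologicalSpace M] [ChartedSpace Plane M]

/-- `F` is a smooth lift to `ℝ³` of the map `f : M → B × ℝ` on some neighbourhood of `q`. -/
def IsLocalLift (Λ : AddSubgroup Plane) (f : M → Base Λ × ℝ) (q : M) (F : M → Space) : Prop :=
  ∃ U : Set M, IsOpen U ∧ q ∈ U ∧ ContMDiffOn (𝓡 2) 𝓘(ℝ, Space) ∞ F U ∧
    ∀ q' ∈ U, cover Λ (F q') = f q'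

/-- Two local lifts differ by a constant near the point, so that differentials and accelerations
do not depend on the choice of the lift. -/
theorem IsLocalLift.eventually_sub_eq {Λ : AddSubgroup Plane} [DiscreteTopology Λ]
    {f : M → Base Λ × ℝ} {q : M} {F G : M → Space}
    (hF : IsLocalLift Λ f q F) (hG : IsLocalLift Λ f q G) :
    ∀ᶠ q' in 𝓝 q, F q' - G q' = F q - G q := by
  obtain ⟨U, hU, hqU, hFs, hFc⟩ := hF
  obtain ⟨V, hV, hqV, hGs, hGc⟩ := hG
  have hFq : ContinuousAt F q := (hFs.continuousOn).continuousAt (hU.mem_nhds hqU)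
  have hGq : ContinuousAt G q := (hGs.continuousOn).continuousAt (hV.mem_nhds hqV)
  have hcont : ContinuousAt (fun q' => ((F q').fst - (G q').fst) - ((F q).fst - (G q).fst)) q := by
    have h1 : Continuous (fun x : Space => x.fst) :=
      continuous_fst.comp (WithLp.prod_continuous_ofLp 2 Plane ℝ)
    exact ((h1.continuousAt.comp hFq).sub (h1.continuousAt.comp hGq)).sub continuousAt_const
  obtain ⟨W, hW, hW0⟩ : ∃ W ∈ 𝓝 (0 : Plane), ∀ x ∈ W, x ∈ Λ → x = 0 := by
    have : {(0 : Λ)} ∈ 𝓝 (0 : Λ) := by simp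
    rw [nhds_subtype_eq_comap, Filter.mem_comap] at this
    obtain ⟨W, hW, h⟩ := this
    refine ⟨W, by simpa using hW, fun x hx hxΛ => ?_⟩
    have h' := h (show (⟨x, hxΛ⟩ : Λ) ∈ Subtype.val ⁻¹' W from hx)
    exact congrArg Subtype.val h'
  have hmem : ∀ q' ∈ U, q' ∈ V → (F q').fst - (G q').fst ∈ Λ ∧ (F q').snd = (G q').snd := by
    intro q' h1 h2
    have h := (hFc q' h1).trans (hGc q' h2).symm
    simp only [cover, Prod.mk.injEq, toBase] at h
    refine ⟨?_, h.2⟩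
    have h3 := (QuotientAddGroup.eq.mp h.1.symm)
    rwa [neg_add_eq_sub] at h3
  have hev : ∀ᶠ q' in 𝓝 q, ((F q').fst - (G q').fst) - ((F q).fst - (G q).fst) ∈ W :=
    hcont (by simpa using hW)
  filter_upwards [hev, hU.mem_nhds hqU, hV.mem_nhds hqV] with q' h1 h2 h3
  have h0 := hmem q hqU hqV
  have h4 := hmem q' h2 h3
  have h5 := sub_eq_zero.mp (hW0 _ h1 (Λ.sub_mem h4.1 h0.1))
  apply (WithLp.equiv 2 (Plane × ℝ)).injective
  refine Prod.ext h5 ?_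
  change (F q').snd - (G q').snd = (F q).snd - (G q).snd
  rw [h4.2, h0.2, sub_self, sub_self]

variable (M) in
/-- A smooth immersion of the surface `M` in `B × ℝ`. Since `ℝ³ → B × ℝ` is a covering and a
local diffeomorphism, a map is smooth if and only if it has smooth lifts to `ℝ³` near every point,
and its differential is the differential of these lifts. -/
structure ImmersedSurface (Λ : AddSubgroup Plane) where
  toFun : M → Base Λ × ℝ
  exists_lift : ∀ q, ∃ F, IsLocalLift Λ toFun q F
  immersion : ∀ q F, IsLocalLift Λ toFun q F →
    Function.Injective (mfderiv (𝓡 2) 𝓘(ℝ, Space) F q)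

namespace ImmersedSurface

variable {Λ : AddSubgroup Plane} (S : ImmersedSurface M Λ)

/-- The projection of the surface to the base, `π : Σ → B`. -/
def proj (q : M) : Base Λ := (S.toFun q).1

/-- The projection `π(Σ) ⊆ B` of the surface. -/
def shadow : Set (Base Λ) := range S.proj

/-- A smooth lift of the immersion to `ℝ³` near `q`. -/
def lift (q : M) : M → Space := (S.exists_lift q).choose

/-- The differential of the immersion at `q`, with values in `T E = ℝ³`. -/
def diff (q : M) : TangentSpace (𝓡 2) q →L[ℝ] Space :=
  mfderiv (𝓡 2) 𝓘(ℝ, Space) (S.lift q) q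

/-- The tangent plane `T_q Σ` as a linear subspace of `ℝ³`. -/
def tangentPlane (q : M) : Submodule ℝ Space := LinearMap.range (S.diff q).toLinearMap

/-- The norm of a tangent vector in the flattened metric `g_ε`: the pull-back under `f_ε` of the
Euclidean metric. For `ε = 1` it is the norm of the metric induced by `E`. -/
def gnorm (ε : ℝ) (u : TangentBundle (𝓡 2) M) : ℝ := ‖flatten ε (S.diff u.proj u.snd)‖

/-- The unit tangent bundle `T¹Σ`, for the metric `g₁` induced by `E`. -/
def unitTangent : Set (TangentBundle (𝓡 2) M) := {u | S.gnorm 1 u = 1}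

/-- The vector `u` rescaled to have norm one in the metric `g_ε`. -/
def normalize (ε : ℝ) (u : TangentBundle (𝓡 2) M) : TangentBundle (𝓡 2) M :=
  ⟨u.proj, (S.gnorm ε u)⁻¹ • u.snd⟩

/-- `π_*(q, p) = (π(q), Dπ(p) / ‖Dπ(p)‖)`. -/
def projUnit (u : TangentBundle (𝓡 2) M) : Base Λ × Plane :=
  (S.proj u.proj, ‖(S.diff u.proj u.snd).fst‖⁻¹ • (S.diff u.proj u.snd).fst)

/-- The position and velocity of a curve in `M`. -/
def velocity (γ : ℝ → M) (t : ℝ) : TangentBundle (𝓡 2) M :=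
  ⟨γ t, mfderiv 𝓘(ℝ, ℝ) (𝓡 2) γ t (1 : ℝ)⟩

/-- `γ` is a geodesic of `(Σ, g_ε)`: as `f_ε` is an isometry from `(Σ, g_ε)` to the flattened
surface `Σ_ε` with the metric induced by the flat metric, whose covariant derivative is the
orthogonal projection of the flat one to the tangent planes, this means that the acceleration of
the flattened curve is everywhere normal to `Σ_ε`. -/
def IsGeodesic (ε : ℝ) (γ : ℝ → M) : Prop :=
  ContMDiff 𝓘(ℝ, ℝ) (𝓡 2) 2 γ ∧
    ∀ (t : ℝ) (w : TangentSpace (𝓡 2) (γ t)),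
      ⟪iteratedDeriv 2 (fun s => flatten ε (S.lift (γ t) (γ s))) t,
        flatten ε (S.diff (γ t) w)⟫_ℝ = 0

open Classical in
/-- The geodesic flow `Φ^ε_t` of `(Σ, g_ε)`. A vector is first rescaled to unit length for `g_ε`
and then moved along the geodesic that it starts. (For `ε > 0`, `M` compact and a non-zero
vector, this geodesic exists and is unique, so that the second alternative does not occur.) -/
def geodesicFlow (ε t : ℝ) (u : TangentBundle (𝓡 2) M) : TangentBundle (𝓡 2) M :=
  if h : ∃ γ : ℝ → M, S.IsGeodesic ε γ ∧ velocity γ 0 = S.normalize ε u then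
    velocity h.choose t
  else u

end ImmersedSurface

end Surface

/-! ### Smooth billiard tables -/

section Billiard

variable {Λ : AddSubgroup Plane}

/-- Near `b`, in the flat coordinates `y ↦ b + y`, the boundary of `D` is the zero set of the
smooth function `h`, which has a non-zero differential at the origin. -/
def IsBoundaryFunction (D : Set (Base Λ)) (b : Base Λ) (h : Plane → ℝ) : Prop :=
  ContDiff ℝ ∞ h ∧ fderiv ℝ h 0 ≠ 0 ∧
    ∀ᶠ y in 𝓝 (0 : Plane), (b + toBase Λ y ∈ frontier D ↔ h y = 0)

/-- A smooth billiard table: the closure of an open set, whose boundary is a smooth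
one-dimensional submanifold of `B`, without boundary. (When `D` is compact, the components of
the boundary are then smoothly embedded circles, finite in number.) -/
def IsSmoothTable (D : Set (Base Λ)) : Prop :=
  (∃ U : Set (Base Λ), IsOpen U ∧ D = closure U) ∧
    ∀ b ∈ frontier D, ∃ h, IsBoundaryFunction D b h

/-- `n` is a unit normal vector to the boundary of `D` at `b`. -/
def IsUnitNormal (D : Set (Base Λ)) (b : Base Λ) (n : Plane) : Prop :=
  ‖n‖ = 1 ∧ ∃ h, IsBoundaryFunction D b h ∧ ∃ a : ℝ, ∀ w : Plane, fderiv ℝ h 0 w = a * ⟪n, w⟫_ℝ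

/-- The curve `c`, with velocity `v`, is on the interval `I` a unit speed billiard trajectory in
`D` without tangential collisions. In the interior of `D` it is straight with constant velocity;
when it is on the boundary it comes in with a velocity `v₁` that is not tangent to the wall, and
goes out with the velocity obtained by reflecting `v₁` in the wall. (The value of `v` at the
collision times plays no role.) -/
structure IsBilliardPath (D : Set (Base Λ)) (I : Set ℝ) (c : ℝ → Base Λ) (v : ℝ → Plane) :
    Prop where
  mem : ∀ s ∈ I, c s ∈ D
  free : ∀ s ∈ I, c s ∈ interior D → ‖v s‖ = 1 ∧
    ∃ δ > 0, ∀ s' ∈ I, |s' - s| < δ → v s' = v s ∧ c s' = c s + toBase Λ ((s' - s) • v s)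
  reflect : ∀ s ∈ I, c s ∈ frontier D → ∃ n v₁ v₂ : Plane, IsUnitNormal D (c s) n ∧
    ⟪v₁, n⟫_ℝ ≠ 0 ∧ v₂ = v₁ - (2 * ⟪v₁, n⟫_ℝ) • n ∧
    ∃ δ > 0, ∀ s' ∈ I,
      (s - δ < s' → s' < s → v s' = v₁ ∧ c s' = c s + toBase Λ ((s' - s) • v₁)) ∧
      (s < s' → s' < s + δ → v s' = v₂ ∧ c s' = c s + toBase Λ ((s' - s) • v₂))

/-- The billiard trajectory that starts at time `0` in the state `x` reaches at time `t`
(which may be negative) the state `y`, without tangential collisions in between. -/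
def BilliardReaches (D : Set (Base Λ)) (t : ℝ) (x y : Base Λ × Plane) : Prop :=
  ∃ c v, IsBilliardPath D (uIcc 0 t) c v ∧ (c 0, v 0) = x ∧ (c t, v t) = y

open Classical in
/-- The billiard flow `Ψ_t`, for trajectories without tangential collisions (the state that is
reached is unique if it lies over the interior of `D`; on other states the value is irrelevant). -/
def billiardFlow (D : Set (Base Λ)) (t : ℝ) (x : Base Λ × Plane) : Base Λ × Plane :=
  if h : ∃ y, BilliardReaches D t x y then h.choose else x

end Billiard

/-! ### The hypotheses and the domain of convergence -/

section Hypotheses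

variable {M : Type*} [TopologicalSpace M] [ChartedSpace Plane M]

/-- The curvature at time `s` of a regular curve in a Euclidean space:
`‖c' ∧ c''‖ / ‖c'‖³`. -/
def curvature (c : ℝ → Space) (s : ℝ) : ℝ :=
  √(‖deriv c s‖ ^ 2 * ‖iteratedDeriv 2 c s‖ ^ 2 - ⟪deriv c s, iteratedDeriv 2 c s⟫_ℝ ^ 2) /
    ‖deriv c s‖ ^ 3

namespace ImmersedSurface

variable {Λ : AddSubgroup Plane} (S : ImmersedSurface M Λ)

/-- The section of `Σ` near `q` by the affine plane `q + Vect (e_z, (T_q Σ)^⊥)` is a curve whose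
curvature at `q` is non-zero: here `c` is a regular parametrization of the section. -/
def HasCurvedVerticalSection (q : M) : Prop :=
  ∃ c : ℝ → M, ContMDiff 𝓘(ℝ, ℝ) (𝓡 2) ∞ c ∧ c 0 = q ∧
    (∀ᶠ s in 𝓝 (0 : ℝ),
      S.lift q (c s) - S.lift q q ∈ Submodule.span ℝ {ez} ⊔ (S.tangentPlane q)ᗮ) ∧
    deriv (fun s => S.lift q (c s)) 0 ≠ 0 ∧
    curvature (fun s => S.lift q (c s)) 0 ≠ 0

/-- The set `A` of all `(t, q, p) ∈ ℝ × T¹Σ` such that `π_*(q, p)` and `Ψ_t(π_*(q, p))` lie over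
the interior of `D` and the billiard trajectory between them has no tangential collision. -/
def nonTangentialSet (D : Set (Base Λ)) : Set (ℝ × TangentBundle (𝓡 2) M) :=
  {a | a.2 ∈ S.unitTangent ∧ (S.projUnit a.2).1 ∈ interior D ∧
    ∃ y, BilliardReaches D a.1 (S.projUnit a.2) y ∧ y.1 ∈ interior D}

end ImmersedSurface

end Hypotheses

end FlatBilliard

end

noncomputable section

namespace FlatBilliard

set_option linter.unusedSectionVars false

section

-- Near each of its points the surface lifts to a level set G = 0 in ℝ³. Let P = (p, z) be the
-- velocity of a unit speed geodesic of g_ε and (a, b) the gradient of G, split into horizontal and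
-- vertical parts. Then |p|² + ε² z² = 1, p' = m a and z' = m b / ε², with m = -Hess G(P, P) / (|a|²
-- + b² / ε²). The horizontal speed is at most 1, but the vertical speed may be of order 1/ε.
--
-- Where b ≠ 0, tangency bounds z, hence m = O(ε²), and in the limit the horizontal motion is
-- straight with unit speed (`exists_regular_bound`, `exists_regular_limit`).
--
-- Over the boundary of D the tangent plane is vertical and the curvature hypothesis makes the
-- second z-derivative of G nonzero. With the right sign of G the surface is a fold: if N is the
-- horizontal gradient there and (y, w) the displacement, then ⟪y, N⟫ ≥ κ w² - o(|y|). A large z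
-- makes the numerator of m positive, so m is bounded below: the wall can push strongly only
-- inwards. Since ⟪p, N⟫ is bounded and its derivative m⟪a, N⟫ controls |m| up to constants, the
-- integral of |m| over a short time is bounded uniformly in ε (`IsFold.exists_bound`,
-- `FoldGeodesicAt.sub_ge_of_deriv`). As a is almost parallel to N, the velocity component along the
-- wall survives in the limit (`IsFold.tangential_limit`). A virial identity shows that a limit
-- which arrives transversally cannot linger at the wall (`FoldGeodesicAt.virial`, `IsFold.escape`).
-- Once it has left, it runs over regular points, hence straight; unit speed and the conserved
-- tangential component leave only the reflected velocity (`IsFold.collision`).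
--
-- Unbounded z gives no direct equicontinuity on the surface. It comes from topology: regular points
-- and folds are isolated in the fibres of π, and projected geodesics are 1-Lipschitz, so a geodesic
-- near a point needs a definite time to leave a neighbourhood (`exists_trap`). All limits are taken
-- along ultrafilters, and the convergence is propagated along the billiard trajectory by induction
-- on real time (`tendsto_of_isBilliardPath`). As ε and the data (t, q, p) vary together, this is
-- continuous convergence, which is uniform on compact sets.

scoped instance instContinuousSMulSpace : ContinuousSMul ℝ Space := IsBoundedSMul.continuousSMul

/-! ### Linear algebra of `ℝ³ = ℝ² × ℝ` -/

theorem Space.ext {x y : Space} (h₁ : x.fst = y.fst) (h₂ : x.snd = y.snd) : x = y :=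
  (WithLp.equiv 2 (Plane × ℝ)).injective (Prod.ext h₁ h₂)

theorem Space.norm_sq (x : Space) : ‖x‖ ^ 2 = ‖x.fst‖ ^ 2 + x.snd ^ 2 := by
  rw [WithLp.prod_norm_sq_eq_of_L2, Real.norm_eq_abs, sq_abs]

theorem Space.inner_eq (x y : Space) : ⟪x, y⟫_ℝ = ⟪x.fst, y.fst⟫_ℝ + x.snd * y.snd := by
  rw [WithLp.prod_inner_apply]
  simp [mul_comm]

theorem Space.norm_fst_le (x : Space) : ‖x.fst‖ ≤ ‖x‖ := by
  apply le_of_sq_le_sq _ (norm_nonneg x)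
  rw [Space.norm_sq]
  nlinarith [sq_nonneg x.snd]

theorem Space.abs_snd_le (x : Space) : |x.snd| ≤ ‖x‖ := by
  apply abs_le_of_sq_le_sq _ (norm_nonneg x)
  rw [Space.norm_sq]
  nlinarith [sq_nonneg ‖x.fst‖]

theorem Space.norm_le (x : Space) : ‖x‖ ≤ ‖x.fst‖ + |x.snd| := by
  apply le_of_sq_le_sq _ (by positivity)
  rw [Space.norm_sq, ← sq_abs x.snd]
  nlinarith [norm_nonneg x.fst, abs_nonneg x.snd, mul_nonneg (norm_nonneg x.fst) (abs_nonneg x.snd)]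

/-- The horizontal projection `ℝ³ → ℝ²`. -/
abbrev fstL : Space →L[ℝ] Plane := WithLp.fstL 2 ℝ Plane ℝ

/-- The height `ℝ³ → ℝ`. -/
abbrev sndL : Space →L[ℝ] ℝ := WithLp.sndL 2 ℝ Plane ℝ

theorem fstL_apply (x : Space) : fstL x = x.fst := rfl

theorem norm_ez : ‖ez‖ = 1 := by
  have h := Space.norm_sq ez
  simp [ez] at h
  have := norm_nonneg ez
  simp [ez]

theorem Space.eq_add_smul_ez (x : Space) :
    x = WithLp.toLp 2 (x.fst, (0 : ℝ)) + x.snd • ez := by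
  apply Space.ext <;> simp [ez]

/-- The gradient of a function on `(ℝ³, f_ε^* g)` whose Euclidean gradient is `a`. -/
def raise (ε : ℝ) (a : Space) : Space := WithLp.toLp 2 (a.fst, a.snd / ε ^ 2)

@[simp] theorem raise_fst (ε : ℝ) (a : Space) : (raise ε a).fst = a.fst := rfl
@[simp] theorem raise_snd (ε : ℝ) (a : Space) : (raise ε a).snd = a.snd / ε ^ 2 := rfl
@[simp] theorem flatten_fst (ε : ℝ) (a : Space) : (flatten ε a).fst = a.fst := rfl
@[simp] theorem flatten_snd (ε : ℝ) (a : Space) : (flatten ε a).snd = ε * a.snd := rfl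

/-! ### Gradients -/

variable {G : Space → ℝ}

theorem contDiff_gradient (hG : ContDiff ℝ ∞ G) : ContDiff ℝ ∞ (gradient G) := by
  have : gradient G = (InnerProductSpace.toDual ℝ Space).symm ∘ fderiv ℝ G := rfl
  rw [this]
  exact (LinearIsometryEquiv.contDiff _).comp (hG.fderiv_right (by simp))

theorem fderiv_eq_inner_gradient (G : Space → ℝ) (X w : Space) :
    fderiv ℝ G X w = ⟪gradient G X, w⟫_ℝ := by
  rw [← toDual_gradient, InnerProductSpace.toDual_apply_apply]

/-- The Hessian of `G`, as the derivative of its gradient. -/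
abbrev hess (G : Space → ℝ) (X : Space) : Space →L[ℝ] Space := fderiv ℝ (gradient G) X

theorem continuous_hess (hG : ContDiff ℝ ∞ G) : Continuous (hess G) :=
  (contDiff_gradient hG).continuous_fderiv (by simp)

theorem hasFDerivAt_gradient (hG : ContDiff ℝ ∞ G) (X : Space) :
    HasFDerivAt (gradient G) (hess G X) X :=
  ((contDiff_gradient hG).differentiable (by simp) X).hasFDerivAt

/-- `X` is, at the time `t`, a unit speed geodesic with velocity `P` of the surface `G = 0`,
for the pull-back under `f_ε` of the Euclidean metric. -/
structure FlatGeodesicAt (G : Space → ℝ) (ε : ℝ) (X P : ℝ → Space) (t : ℝ) : Prop where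
  pos : HasDerivAt X (P t) t
  zero : G (X t) = 0
  tangent : ⟪gradient G (X t), P t⟫_ℝ = 0
  energy : ‖(P t).fst‖ ^ 2 + ε ^ 2 * (P t).snd ^ 2 = 1
  acc : ∃ m : ℝ, HasDerivAt P (m • raise ε (gradient G (X t))) t ∧
    m * (‖(gradient G (X t)).fst‖ ^ 2 + (gradient G (X t)).snd ^ 2 / ε ^ 2) =
      -⟪hess G (X t) (P t), P t⟫_ℝ

theorem FlatGeodesicAt.norm_fst_le {ε t : ℝ} {X P : ℝ → Space} (h : FlatGeodesicAt G ε X P t) :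
    ‖(P t).fst‖ ≤ 1 := by
  have := h.energy
  have h2 := mul_nonneg (sq_nonneg ε) (sq_nonneg (P t).snd)
  nlinarith [norm_nonneg (P t).fst]

theorem HasDerivAt.fst' {X : ℝ → Space} {X' : Space} {t : ℝ} (h : HasDerivAt X X' t) :
    HasDerivAt (fun s => (X s).fst) X'.fst t := fstL.hasFDerivAt.comp_hasDerivAt t h

theorem HasDerivAt.snd' {X : ℝ → Space} {X' : Space} {t : ℝ} (h : HasDerivAt X X' t) :
    HasDerivAt (fun s => (X s).snd) X'.snd t := sndL.hasFDerivAt.comp_hasDerivAt t h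

/-- Near a point where the surface is not vertical, the geodesics of the flattened surfaces are
almost straight. -/
theorem exists_regular_bound (hG : ContDiff ℝ ∞ G) {X₀ : Space} (h₀ : (gradient G X₀).snd ≠ 0) :
    ∃ ρ > 0, ∃ C, 0 ≤ C ∧ ∀ ε : ℝ, 0 < ε → ∀ X P t, FlatGeodesicAt G ε X P t →
      ‖X t - X₀‖ < ρ → |(P t).snd| ≤ C ∧
        ∃ p', HasDerivAt (fun s => (P s).fst) p' t ∧ ‖p'‖ ≤ C * ε ^ 2 := by
  set c := |(gradient G X₀).snd| / 2 with hc
  have hc0 : 0 < c := by positivity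
  set M := ‖gradient G X₀‖ + ‖hess G X₀‖ + 1 with hM
  have hM0 : 0 < M := by positivity
  have hgc : Continuous (gradient G) := (contDiff_gradient hG).continuous
  have e1 : ∀ᶠ X in 𝓝 X₀, c < |(gradient G X).snd| :=
    ((sndL.continuous.comp hgc).abs.continuousAt (x := X₀)).eventually_const_lt
      (by change c < |(gradient G X₀).snd|; have : 0 < |(gradient G X₀).snd| := by positivity
          linarith)
  have e2 : ∀ᶠ X in 𝓝 X₀, ‖gradient G X‖ < M :=
    (hgc.norm.continuousAt (x := X₀)).eventually_lt_const
      (by change ‖gradient G X₀‖ < M; have := norm_nonneg (hess G X₀); linarith)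
  have e3 : ∀ᶠ X in 𝓝 X₀, ‖hess G X‖ < M :=
    ((continuous_hess hG).norm.continuousAt (x := X₀)).eventually_lt_const
      (by change ‖hess G X₀‖ < M; have := norm_nonneg (gradient G X₀); linarith)
  obtain ⟨ρ, hρ, H⟩ := Metric.eventually_nhds_iff.mp (e1.and (e2.and e3))
  set C₁ := M / c with hC₁
  have hC₁0 : 0 < C₁ := by positivity
  set C₂ := M * (1 + C₁ ^ 2) / c ^ 2 with hC₂
  have hC₂0 : 0 < C₂ := by positivity
  refine ⟨ρ, hρ, C₁ + C₂ * M, by positivity, fun ε hε X P t hX hXt => ?_⟩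
  obtain ⟨h1, h2, h3⟩ := H (show dist (X t) X₀ < ρ by rwa [dist_eq_norm])
  set a := gradient G (X t) with ha
  -- Tangency says that the vertical part of the gradient times the vertical velocity is minus the
  -- inner product of the horizontal parts, which is at most M; the vertical part of the gradient
  -- exceeds c.
  have hz : |(P t).snd| ≤ C₁ := by
    have h := hX.tangent
    rw [Space.inner_eq] at h
    have h4 : |a.snd| * |(P t).snd| ≤ M := by
      rw [← abs_mul, show a.snd * (P t).snd = -⟪a.fst, (P t).fst⟫_ℝ by linarith, abs_neg]
      calc _ ≤ ‖a.fst‖ * ‖(P t).fst‖ := abs_real_inner_le_norm _ _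
        _ ≤ M * 1 := by
          gcongr
          · exact (Space.norm_fst_le a).trans h2.le
          · exact hX.norm_fst_le
        _ = M := mul_one M
    rw [hC₁, le_div_iff₀ hc0]
    nlinarith [abs_nonneg (P t).snd]
  refine ⟨hz.trans (by have := mul_pos hC₂0 hM0; linarith), ?_⟩
  obtain ⟨m, hm, hm2⟩ := hX.acc
  refine ⟨_, HasDerivAt.fst' hm, ?_⟩
  have hP : ‖P t‖ ^ 2 ≤ 1 + C₁ ^ 2 := by
    rw [Space.norm_sq]
    have := hX.norm_fst_le
    have h5 : (P t).snd ^ 2 ≤ C₁ ^ 2 := by rw [← sq_abs]; gcongr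
    nlinarith [norm_nonneg (P t).fst]
  -- The numerator of m is bounded, while its denominator contains a.snd² / ε² ≥ c² / ε².
  have hm3 : |m| ≤ C₂ * ε ^ 2 := by
    have h6 : |m| * (a.snd ^ 2 / ε ^ 2) ≤ M * (1 + C₁ ^ 2) := by
      calc |m| * (a.snd ^ 2 / ε ^ 2) ≤ |m| * (‖a.fst‖ ^ 2 + a.snd ^ 2 / ε ^ 2) := by
            gcongr; nlinarith [sq_nonneg ‖a.fst‖]
        _ = |m * (‖a.fst‖ ^ 2 + a.snd ^ 2 / ε ^ 2)| := by
            rw [abs_mul, abs_of_nonneg (a := ‖a.fst‖ ^ 2 + a.snd ^ 2 / ε ^ 2) (by positivity)]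
        _ = |⟪hess G (X t) (P t), P t⟫_ℝ| := by rw [hm2, abs_neg]
        _ ≤ ‖hess G (X t) (P t)‖ * ‖P t‖ := abs_real_inner_le_norm _ _
        _ ≤ (‖hess G (X t)‖ * ‖P t‖) * ‖P t‖ := by gcongr; exact ContinuousLinearMap.le_opNorm _ _
        _ = ‖hess G (X t)‖ * ‖P t‖ ^ 2 := by ring
        _ ≤ M * (1 + C₁ ^ 2) := by gcongr
    have h7 : c ^ 2 ≤ a.snd ^ 2 := by rw [← sq_abs a.snd]; gcongr
    have h8 : |m| * (c ^ 2 / ε ^ 2) ≤ M * (1 + C₁ ^ 2) := le_trans (by gcongr) h6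
    rw [hC₂, div_mul_eq_mul_div, le_div_iff₀ (by positivity)]
    rw [← mul_div_assoc, div_le_iff₀ (by positivity)] at h8
    exact h8
  have h9 : (m • raise ε a).fst = m • a.fst := rfl
  rw [h9, norm_smul, Real.norm_eq_abs]
  calc |m| * ‖a.fst‖ ≤ (C₂ * ε ^ 2) * M := by
        gcongr
        exact (Space.norm_fst_le a).trans h2.le
    _ ≤ (C₁ + C₂ * M) * ε ^ 2 := by nlinarith [mul_pos hC₁0 (pow_pos hε 2)]

end

section

/-! ### Folds -/

variable {G : Space → ℝ}

/-- The projection of the surface `G = 0` to the plane has a fold at `X₀`, and the surface projects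
to the side of the fold to which the gradient of `G` points. -/
structure IsFold (G : Space → ℝ) (X₀ : Space) : Prop where
  zero : G X₀ = 0
  vert : (gradient G X₀).snd = 0
  hor : (gradient G X₀).fst ≠ 0
  curved : ⟪hess G X₀ ez, ez⟫_ℝ < 0

set_option maxHeartbeats 1000000 in
/-- Near a fold, the horizontal acceleration of the geodesics points to the inside, up to a bounded
term. -/
theorem IsFold.exists_bound (hG : ContDiff ℝ ∞ G) {X₀ : Space} (h₀ : IsFold G X₀) :
    ∃ ρ > 0, ∃ C > 0, ∀ ε : ℝ, 0 < ε → ∀ X P t, FlatGeodesicAt G ε X P t →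
      ‖X t - X₀‖ < ρ → ‖gradient G (X t)‖ ≤ C ∧
        ∃ m : ℝ, HasDerivAt P (m • raise ε (gradient G (X t))) t ∧
          |m| ≤ C * (m * ⟪(gradient G (X t)).fst, (gradient G X₀).fst⟫_ℝ + C) := by
  set N := (gradient G X₀).fst with hN
  have hN0 : 0 < ‖N‖ := norm_pos_iff.mpr h₀.hor
  set κ := -⟪hess G X₀ ez, ez⟫_ℝ / 2 with hκ
  have hκ0 : 0 < κ := by have := h₀.curved; rw [hκ]; linarith
  set M := ‖gradient G X₀‖ + ‖hess G X₀‖ + 1 with hM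
  have hM0 : 0 < M := by positivity
  have hgc : Continuous (gradient G) := (contDiff_gradient hG).continuous
  have e1 : ∀ᶠ X in 𝓝 X₀, ‖N‖ ^ 2 / 2 < ⟪(gradient G X).fst, N⟫_ℝ := by
    have hc : Continuous fun X => ⟪(gradient G X).fst, N⟫_ℝ :=
      (fstL.continuous.comp hgc).inner continuous_const
    refine hc.continuousAt.eventually_const_lt ?_
    change _ < ⟪N, N⟫_ℝ
    rw [real_inner_self_eq_norm_sq]
    have : 0 < ‖N‖ ^ 2 := by positivity
    linarith
  have e2 : ∀ᶠ X in 𝓝 X₀, ‖gradient G X‖ < M :=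
    (hgc.norm.continuousAt (x := X₀)).eventually_lt_const
      (by change ‖gradient G X₀‖ < M; have := norm_nonneg (hess G X₀); linarith)
  have e3 : ∀ᶠ X in 𝓝 X₀, ‖hess G X‖ < M :=
    ((continuous_hess hG).norm.continuousAt (x := X₀)).eventually_lt_const
      (by change ‖hess G X₀‖ < M; have := norm_nonneg (gradient G X₀); linarith)
  have e4 : ∀ᶠ X in 𝓝 X₀, ⟪hess G X ez, ez⟫_ℝ < -κ := by
    have hc : Continuous fun X => ⟪hess G X ez, ez⟫_ℝ :=
      ((continuous_hess hG).clm_apply continuous_const).inner continuous_const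
    refine hc.continuousAt.eventually_lt_const ?_
    have := h₀.curved; rw [hκ]; linarith
  obtain ⟨ρ, hρ, H⟩ := Metric.eventually_nhds_iff.mp (e1.and (e2.and (e3.and e4)))
  set C' := M + M ^ 2 / κ with hC'
  have hC'0 : 0 < C' := by positivity
  set C₁ := C' / (‖N‖ / 2) ^ 2 with hC₁
  have hC₁0 : 0 < C₁ := by positivity
  -- The summands serve, in turn, to compare a positive m with m⟪a, N⟫, to keep m⟪a, N⟫ + C at least
  -- 1 when m is negative, to bound -m, and to bound the gradient.
  set C := 2 / ‖N‖ ^ 2 + (C₁ * (M * ‖N‖) + 1) + C₁ + M with hC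
  have hC0 : 0 < C := by positivity
  refine ⟨ρ, hρ, C, hC0, fun ε hε X P t hX hXt => ?_⟩
  obtain ⟨h1, h2, h3, h4⟩ := H (show dist (X t) X₀ < ρ by rwa [dist_eq_norm])
  set a := gradient G (X t) with ha
  have hMC : M ≤ C := by
    have : 0 < 2 / ‖N‖ ^ 2 + (C₁ * (M * ‖N‖) + 1) + C₁ := by positivity
    linarith
  refine ⟨h2.le.trans hMC, ?_⟩
  obtain ⟨m, hm, hm2⟩ := hX.acc
  refine ⟨m, hm, ?_⟩
  set B := hess G (X t) with hB
  set z := (P t).snd with hz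
  set p : Space := WithLp.toLp 2 ((P t).fst, (0 : ℝ)) with hp
  have hp1 : ‖p‖ ≤ 1 := by
    refine (Space.norm_le p).trans ?_
    simpa [hp] using hX.norm_fst_le
  have hBb : ∀ u v : Space, ‖u‖ ≤ 1 → ‖v‖ ≤ 1 → |⟪B u, v⟫_ℝ| ≤ M := fun u v hu hv => by
    calc |⟪B u, v⟫_ℝ| ≤ ‖B u‖ * ‖v‖ := abs_real_inner_le_norm _ _
      _ ≤ (‖B‖ * ‖u‖) * ‖v‖ := by gcongr; exact B.le_opNorm u
      _ ≤ (M * 1) * 1 := by gcongr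
      _ = M := by ring
  -- Only an upper bound can hold, as z is unbounded. The term in z² has a coefficient below -κ and
  -- absorbs the linear one: 2M|z| - κz² ≤ M²/κ.
  have hquad : ⟪B (P t), P t⟫_ℝ ≤ C' := by
    have hP : P t = p + z • ez := Space.eq_add_smul_ez (P t)
    have he : ⟪B (P t), P t⟫_ℝ =
        ⟪B p, p⟫_ℝ + z * (⟪B p, ez⟫_ℝ + ⟪B ez, p⟫_ℝ) + z ^ 2 * ⟪B ez, ez⟫_ℝ := by
      rw [hP]
      simp only [map_add, map_smul, inner_add_left, inner_add_right, real_inner_smul_left,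
        real_inner_smul_right]
      ring
    have b1 := abs_le.mp (hBb p p hp1 hp1)
    have b2 := abs_le.mp (hBb p ez hp1 norm_ez.le)
    have b3 := abs_le.mp (hBb ez p norm_ez.le hp1)
    have b4 : z * (⟪B p, ez⟫_ℝ + ⟪B ez, p⟫_ℝ) ≤ |z| * (2 * M) := by
      refine (le_abs_self _).trans ?_
      rw [abs_mul]
      gcongr
      rw [abs_le]; constructor <;> linarith
    have b5 : z ^ 2 * ⟪B ez, ez⟫_ℝ ≤ |z| ^ 2 * (-κ) := by
      rw [sq_abs]; exact mul_le_mul_of_nonneg_left h4.le (sq_nonneg z)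
    have b6 : |z| * (2 * M) + |z| ^ 2 * (-κ) ≤ M ^ 2 / κ := by
      rw [le_div_iff₀ hκ0]
      nlinarith only [sq_nonneg (κ * |z| - M)]
    rw [he, hC']
    linarith [b1.2]
  have hafst : ‖N‖ / 2 ≤ ‖a.fst‖ := by
    have := real_inner_le_norm a.fst N
    by_contra hcon
    push Not at hcon
    nlinarith only [hcon, h1, this, hN0]
  -- By `hquad` the product of m and its denominator is at least -C', and the denominator is at
  -- least (‖N‖ / 2)² whatever ε is.
  have hmlow : -C₁ ≤ m := by
    by_contra hcon
    push Not at hcon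
    have hD : (‖N‖ / 2) ^ 2 ≤ ‖a.fst‖ ^ 2 + a.snd ^ 2 / ε ^ 2 := by
      have : (‖N‖ / 2) ^ 2 ≤ ‖a.fst‖ ^ 2 := by gcongr
      have : 0 ≤ a.snd ^ 2 / ε ^ 2 := by positivity
      linarith
    have hD0 : 0 < (‖N‖ / 2) ^ 2 := by positivity
    have hCC : C₁ * (‖N‖ / 2) ^ 2 = C' := div_mul_cancel₀ _ hD0.ne'
    have hm3 := mul_le_mul_of_nonpos_left hD (show m ≤ 0 by linarith)
    have hm4 := mul_lt_mul_of_pos_right hcon hD0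
    rw [neg_mul, hCC] at hm4
    rw [hm2] at hm3
    linarith
  have hfN : |⟪a.fst, N⟫_ℝ| ≤ M * ‖N‖ := by
    refine (abs_real_inner_le_norm _ _).trans ?_
    gcongr
    exact (Space.norm_fst_le a).trans h2.le
  have q1 : 0 < 2 / ‖N‖ ^ 2 := by positivity
  have q2 : 0 < C₁ * (M * ‖N‖) := by positivity
  -- A positive m can be huge but is then comparable with m⟪a, N⟫, since ⟪a, N⟫ > ‖N‖² / 2; a
  -- negative m is bounded.
  rcases le_total 0 m with h | h
  · rw [abs_of_nonneg h]
    have t1 : m ≤ 2 / ‖N‖ ^ 2 * (m * ⟪a.fst, N⟫_ℝ) := by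
      have : m * (‖N‖ ^ 2 / 2) ≤ m * ⟪a.fst, N⟫_ℝ := by gcongr
      calc m = 2 / ‖N‖ ^ 2 * (m * (‖N‖ ^ 2 / 2)) := by field_simp
        _ ≤ _ := by gcongr
    have t2 : 0 ≤ m * ⟪a.fst, N⟫_ℝ := by
      refine mul_nonneg h (le_trans ?_ h1.le); positivity
    have t3 : 2 / ‖N‖ ^ 2 * (m * ⟪a.fst, N⟫_ℝ) ≤ C * (m * ⟪a.fst, N⟫_ℝ) := by
      gcongr; rw [hC]; linarith
    nlinarith only [t1, t3, hC0]
  · rw [abs_of_nonpos h]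
    have t1 : -(C₁ * (M * ‖N‖)) ≤ m * ⟪a.fst, N⟫_ℝ := by
      have := (abs_le.mp hfN).2
      have h5 := mul_le_mul_of_nonpos_left this h
      have h6 := mul_le_mul_of_nonneg_right hmlow (show 0 ≤ M * ‖N‖ by positivity)
      linarith
    have t2 : 1 ≤ m * ⟪a.fst, N⟫_ℝ + C := by rw [hC]; linarith
    have t3 : -m ≤ C := by rw [hC]; linarith
    nlinarith only [t2, t3, hC0]

/-- Taylor's inequality for a strongly concave function: f' + ks and f + ks²/2 - f'(0)s are
nonincreasing. It is applied to G along vertical segments near a fold. -/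
theorem le_of_second_deriv_le {f f' f'' : ℝ → ℝ} {k : ℝ}
    (h : ∀ s ∈ Icc (0 : ℝ) 1, HasDerivAt f (f' s) s)
    (h' : ∀ s ∈ Icc (0 : ℝ) 1, HasDerivAt f' (f'' s) s) (hk : ∀ s ∈ Icc (0 : ℝ) 1, f'' s ≤ -k) :
    f 1 ≤ f 0 + f' 0 - k / 2 ∧ f' 1 ≤ f' 0 - k := by
  have anti : ∀ {g g' : ℝ → ℝ}, (∀ s ∈ Icc (0 : ℝ) 1, HasDerivAt g (g' s) s) →
      (∀ s ∈ Icc (0 : ℝ) 1, g' s ≤ 0) → AntitoneOn g (Icc 0 1) := fun {g g'} hg hg' => by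
    refine antitoneOn_of_deriv_nonpos (convex_Icc 0 1)
      (fun s hs => (hg s hs).continuousAt.continuousWithinAt) (fun s hs => ?_) fun s hs => ?_
    · exact (hg s (interior_subset hs)).differentiableAt.differentiableWithinAt
    · rw [(hg s (interior_subset hs)).deriv]; exact hg' s (interior_subset hs)
  have a1 : AntitoneOn (fun s => f' s + k * s) (Icc 0 1) :=
    anti (g' := fun s => f'' s + k * 1) (fun s hs => (h' s hs).add ((hasDerivAt_id s).const_mul k))
      fun s hs => by have := hk s hs; linarith
  have a2 : AntitoneOn (fun s => f s + (k / 2 * s ^ 2 - f' 0 * s)) (Icc 0 1) := by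
    refine anti (g' := fun s => f' s + (k / 2 * (2 * s) - f' 0 * 1)) (fun s hs => ?_) fun s hs => ?_
    · refine (h s hs).add (((?_ : HasDerivAt (fun s : ℝ => s ^ 2) (2 * s) s).const_mul _).sub
        ((hasDerivAt_id s).const_mul _))
      simpa using hasDerivAt_pow 2 s
    · have := a1 ⟨le_rfl, zero_le_one⟩ hs hs.1
      simp only [mul_zero, add_zero] at this
      linarith
  have c1 := a1 ⟨le_rfl, zero_le_one⟩ ⟨zero_le_one, le_rfl⟩ zero_le_one
  have c2 := a2 ⟨le_rfl, zero_le_one⟩ ⟨zero_le_one, le_rfl⟩ zero_le_one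
  norm_num at c1 c2
  constructor <;> linarith

set_option maxHeartbeats 1000000 in
/-- The shape of the surface near a fold. -/
theorem IsFold.exists_shape (hG : ContDiff ℝ ∞ G) {X₀ : Space} (h₀ : IsFold G X₀) :
    ∃ κ > 0, ∀ η > 0, ∃ ρ > 0, ∀ X, ‖X - X₀‖ < ρ → G X = 0 →
      κ * (X.snd - X₀.snd) ^ 2 ≤ ⟪X.fst - X₀.fst, (gradient G X₀).fst⟫_ℝ +
        η * ‖X.fst - X₀.fst‖ ∧
      ((gradient G X).snd = 0 →
        |⟪X.fst - X₀.fst, (gradient G X₀).fst⟫_ℝ| ≤ η * ‖X.fst - X₀.fst‖) := by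
  set N := (gradient G X₀).fst with hN
  set κ := -⟪hess G X₀ ez, ez⟫_ℝ / 2 with hκ
  have hκ0 : 0 < κ := by have := h₀.curved; rw [hκ]; linarith
  set L := ‖hess G X₀‖ + 1 with hL
  have hL0 : 0 < L := by positivity
  refine ⟨κ / 4, by positivity, fun η hη => ?_⟩
  -- The first bound is for the inequality on the surface, the second for the points with vertical
  -- tangent plane, where ‖X - X₀‖ ≤ (1 + L / κ)‖y‖.
  set η' := min (η / 2) (η / (1 + L / κ)) with hη'
  have hη'0 : 0 < η' := by positivity
  have e1 : ∀ᶠ X in 𝓝 X₀, ⟪hess G X ez, ez⟫_ℝ < -κ := by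
    have hc : Continuous fun X => ⟪hess G X ez, ez⟫_ℝ :=
      ((continuous_hess hG).clm_apply continuous_const).inner continuous_const
    refine hc.continuousAt.eventually_lt_const ?_
    have := h₀.curved; rw [hκ]; linarith
  have e2 : ∀ᶠ X in 𝓝 X₀, |G X - ⟪gradient G X₀, X - X₀⟫_ℝ| ≤ η' * ‖X - X₀‖ := by
    have := ((hG.differentiable (by simp) X₀).hasFDerivAt.isLittleO).def hη'0
    filter_upwards [this] with X hX
    rwa [h₀.zero, sub_zero, fderiv_eq_inner_gradient, Real.norm_eq_abs] at hX
  have e3 : ∀ᶠ X in 𝓝 X₀, ‖gradient G X - gradient G X₀‖ ≤ L * ‖X - X₀‖ := by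
    have := ((hasFDerivAt_gradient hG X₀).isLittleO).def (zero_lt_one)
    filter_upwards [this] with X hX
    have h1 := (hess G X₀).le_opNorm (X - X₀)
    have h2 := norm_sub_norm_le (gradient G X - gradient G X₀) (hess G X₀ (X - X₀))
    rw [hL]
    linarith
  obtain ⟨ρ, hρ, H⟩ := Metric.eventually_nhds_iff.mp (e1.and (e2.and e3))
  -- The second radius makes the error L²‖y‖²/κ, left by completing the square, at most (η / 2)‖y‖.
  refine ⟨min ρ (η * κ / (2 * L ^ 2)), by positivity, fun X hX hGX => ?_⟩
  set y := X.fst - X₀.fst with hy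
  set w := X.snd - X₀.snd with hw
  have hX1 : ‖X - X₀‖ < ρ := hX.trans_le (min_le_left _ _)
  have hX2 : ‖X - X₀‖ < η * κ / (2 * L ^ 2) := hX.trans_le (min_le_right _ _)
  have hyX : ‖y‖ ≤ ‖X - X₀‖ := Space.norm_fst_le (X - X₀)
  -- The vertical segment that ends at X and starts at the height of X₀. Along it G has second
  -- derivative at most -κw², and at its start G is close to ⟪y, N⟫ and the vertical derivative is
  -- O(‖y‖).
  set Q : ℝ → Space := fun s => WithLp.toLp 2 (X.fst, X₀.snd) + s • (w • ez) with hQ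
  have hQ0 : Q 0 = WithLp.toLp 2 (X.fst, X₀.snd) := by simp [hQ]
  have hQ1 : Q 1 = X := by apply Space.ext <;> simp [hQ, ez, hw]
  have hQd : ∀ s, HasDerivAt Q (w • ez) s := fun s => by
    have := ((hasDerivAt_id s).smul_const (w • ez)).const_add (WithLp.toLp 2 (X.fst, X₀.snd))
    rwa [one_smul] at this
  have hQn : ∀ s ∈ Icc (0 : ℝ) 1, dist (Q s) X₀ < ρ := fun s hs => by
    refine lt_of_le_of_lt ?_ hX1
    rw [dist_eq_norm]
    apply le_of_sq_le_sq _ (norm_nonneg _)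
    rw [Space.norm_sq, Space.norm_sq]
    have h1 : (Q s - X₀).fst = y := by simp [hQ, ez, hy]
    have h2 : (Q s - X₀).snd = s * w := by simp [hQ, ez]
    have h3 : (X - X₀).fst = y := rfl
    have h4 : (X - X₀).snd = w := rfl
    rw [h1, h2, h3, h4, mul_pow]
    have : s ^ 2 ≤ 1 := by nlinarith only [hs.1, hs.2]
    nlinarith only [sq_nonneg w, this]
  have hd1 : ∀ s, HasDerivAt (fun s => G (Q s)) (w * (gradient G (Q s)).snd) s := fun s => by
    refine ((hG.differentiable (by simp) (Q s)).hasFDerivAt.comp_hasDerivAt s (hQd s)).congr_deriv ?_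
    rw [fderiv_eq_inner_gradient, Space.inner_eq]
    simp [ez, mul_comm]
  have hd2 : ∀ s, HasDerivAt (fun s => w * (gradient G (Q s)).snd)
      (w * (w * ⟪hess G (Q s) ez, ez⟫_ℝ)) s := fun s => by
    have := (HasDerivAt.snd' ((hasFDerivAt_gradient hG (Q s)).comp_hasDerivAt s (hQd s))).const_mul w
    rw [map_smul] at this
    have h2 : (w • hess G (Q s) ez).snd = w * ⟪hess G (Q s) ez, ez⟫_ℝ := by
      rw [Space.inner_eq]; simp [ez]
    rwa [h2] at this
  obtain ⟨T1, T2⟩ := le_of_second_deriv_le (k := κ * w ^ 2) (fun s _ => hd1 s) (fun s _ => hd2 s)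
    fun s hs => by
      have := (H (hQn s hs)).1
      nlinarith only [sq_nonneg w, this]
  simp only [hQ1] at T1 T2
  obtain ⟨-, H2, H3⟩ := H (hQn 0 ⟨le_rfl, zero_le_one⟩)
  have hQX : ‖Q 0 - X₀‖ ≤ ‖y‖ := by
    refine (Space.norm_le _).trans ?_
    simp [hQ0, hy]
  have hGQ : G (Q 0) ≤ ⟪y, N⟫_ℝ + η' * ‖y‖ := by
    have h1 : ⟪gradient G X₀, Q 0 - X₀⟫_ℝ = ⟪y, N⟫_ℝ := by
      rw [Space.inner_eq, real_inner_comm]; simp [hQ0, hy, h₀.vert, hN]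
    rw [h1] at H2
    have := (abs_le.mp H2).2
    have : η' * ‖Q 0 - X₀‖ ≤ η' * ‖y‖ := by gcongr
    linarith
  have hAQ : |(gradient G (Q 0)).snd| ≤ L * ‖y‖ := by
    calc |(gradient G (Q 0)).snd| = |(gradient G (Q 0) - gradient G X₀).snd| := by
          simp [h₀.vert]
      _ ≤ ‖gradient G (Q 0) - gradient G X₀‖ := Space.abs_snd_le _
      _ ≤ L * ‖Q 0 - X₀‖ := H3
      _ ≤ L * ‖y‖ := by gcongr
  have hwA : w * (gradient G (Q 0)).snd ≤ |w| * (L * ‖y‖) := by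
    refine (le_abs_self _).trans ?_
    rw [abs_mul]; gcongr
  constructor
  · rw [hGX] at T1
    have h1 : η' ≤ η / 2 := min_le_left _ _
    have h2 : η' * ‖y‖ ≤ η / 2 * ‖y‖ := by gcongr
    have h3 : |w| * (L * ‖y‖) ≤ κ / 4 * w ^ 2 + L ^ 2 * ‖y‖ ^ 2 / κ := by
      rw [← sub_nonneg, ← sq_abs w]
      have : κ / 4 * |w| ^ 2 + L ^ 2 * ‖y‖ ^ 2 / κ - |w| * (L * ‖y‖) =
        (κ * |w| / 2 - L * ‖y‖) ^ 2 / κ := by field_simp; ring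
      rw [this]; positivity
    have h4 : L ^ 2 * ‖y‖ ^ 2 / κ ≤ η / 2 * ‖y‖ := by
      have h5 : ‖y‖ ≤ η * κ / (2 * L ^ 2) := hyX.trans hX2.le
      rw [le_div_iff₀ (by positivity)] at h5
      rw [div_le_iff₀ hκ0]
      nlinarith only [norm_nonneg y, h5]
    linarith
  -- If the vertical derivative vanishes at X, its decrease along the segment forces κ|w| ≤ L‖y‖.
  -- Then X - X₀ = O(‖y‖), and the linearization of G at X₀ gives ⟪y, N⟫ = o(‖y‖): the projected
  -- fold is tangent to N^⊥.
  · intro hv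
    rw [hv, mul_zero] at T2
    have h1 : κ * |w| ≤ L * ‖y‖ := by
      rcases eq_or_ne w 0 with h | h
      · rw [h]; simp; positivity
      · have hw0 : 0 < |w| := abs_pos.mpr h
        have : κ * |w| ^ 2 ≤ |w| * (L * ‖y‖) := by rw [sq_abs]; linarith
        nlinarith only [this, hw0]
    have h2 := (H (show dist X X₀ < ρ by rwa [dist_eq_norm])).2.1
    have h3 : ⟪gradient G X₀, X - X₀⟫_ℝ = ⟪y, N⟫_ℝ := by
      rw [Space.inner_eq, real_inner_comm]; simp [hy, h₀.vert, hN]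
    rw [hGX, h3, zero_sub, abs_neg] at h2
    refine h2.trans ?_
    have h4 : ‖X - X₀‖ ≤ (1 + L / κ) * ‖y‖ := by
      refine (Space.norm_le (X - X₀)).trans ?_
      have h5 : |w| ≤ L * ‖y‖ / κ := by rw [le_div_iff₀ hκ0]; linarith
      change ‖y‖ + |w| ≤ _
      rw [add_mul, one_mul, div_mul_eq_mul_div]; linarith
    calc η' * ‖X - X₀‖ ≤ (η / (1 + L / κ)) * ((1 + L / κ) * ‖y‖) := by
          gcongr; exact min_le_right _ _
      _ = η * ‖y‖ := by field_simp

end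

section

/-! ### Limits of geodesics near a regular point -/

variable {G : Space → ℝ}

theorem le_of_hasDerivAt_nonneg {f f' : ℝ → ℝ} {a b : ℝ} (hab : a ≤ b)
    (h : ∀ t ∈ Icc a b, HasDerivAt f (f' t) t) (h' : ∀ t ∈ Icc a b, 0 ≤ f' t) : f a ≤ f b := by
  refine monotoneOn_of_deriv_nonneg (convex_Icc a b)
    (fun s hs => (h s hs).continuousAt.continuousWithinAt) (fun s hs => ?_) (fun s hs => ?_)
    (left_mem_Icc.mpr hab) (right_mem_Icc.mpr hab) hab
  · exact (h s (interior_subset hs)).differentiableAt.differentiableWithinAt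
  · rw [(h s (interior_subset hs)).deriv]; exact h' s (interior_subset hs)

/-- Along an ultrafilter every family in a compact set converges, so positions and velocities have
limits at all times at once, without extraction of subsequences. -/
theorem Ultrafilter.exists_tendsto_of_isCompact {ι α : Type*} [TopologicalSpace α]
    (U : Ultrafilter ι) {K : Set α} (hK : IsCompact K) {g : ι → α} (h : ∀ᶠ i in U, g i ∈ K) :
    ∃ x ∈ K, Tendsto g U (𝓝 x) :=
  hK.ultrafilter_le_nhds' (U.map g) h

/-- Rotating N by a right angle and normalizing gives the direction of the wall; the formula for
‖p‖² splits the kinetic energy into its transversal and tangential parts. -/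
theorem exists_unit_normal_vector {N : Plane} (hN : N ≠ 0) :
    ∃ τ : Plane, ‖τ‖ = 1 ∧ ⟪N, τ⟫_ℝ = 0 ∧
      ∀ p : Plane, ‖p‖ ^ 2 = ⟪p, N⟫_ℝ ^ 2 / ‖N‖ ^ 2 + ⟪p, τ⟫_ℝ ^ 2 := by
  have hN0 : ‖N‖ ≠ 0 := norm_ne_zero_iff.mpr hN
  have hNs : ‖N‖ ^ 2 = N 0 ^ 2 + N 1 ^ 2 := by
    rw [EuclideanSpace.norm_sq_eq]; simp
  have key : ∀ p : Plane, ‖p‖ ^ 2 =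
      ⟪p, N⟫_ℝ ^ 2 / ‖N‖ ^ 2 + ⟪p, ‖N‖⁻¹ • (!₂[-N 1, N 0] : Plane)⟫_ℝ ^ 2 := fun p => by
    have h1 : ⟪p, N⟫_ℝ = p 0 * N 0 + p 1 * N 1 := by
      simp [PiLp.inner_apply, Fin.sum_univ_two, mul_comm]
    have h2 : ⟪p, (!₂[-N 1, N 0] : Plane)⟫_ℝ = -(p 0 * N 1) + p 1 * N 0 := by
      simp [PiLp.inner_apply, Fin.sum_univ_two, mul_comm]
    have h3 : ‖p‖ ^ 2 = p 0 ^ 2 + p 1 ^ 2 := by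
      rw [EuclideanSpace.norm_sq_eq]; simp
    rw [real_inner_smul_right, h1, h2, h3, mul_pow, inv_pow]
    field_simp
    rw [hNs]; ring
  refine ⟨‖N‖⁻¹ • (!₂[-N 1, N 0] : Plane), ?_, ?_, key⟩
  · have h : ‖(!₂[-N 1, N 0] : Plane)‖ ^ 2 = ‖N‖ ^ 2 := by
      rw [EuclideanSpace.norm_sq_eq, hNs]; simp [add_comm]
    rw [norm_smul, (pow_left_inj₀ (norm_nonneg _) (norm_nonneg _) two_ne_zero).mp h, norm_inv,
      norm_norm, inv_mul_cancel₀ hN0]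
  · simp [PiLp.inner_apply, Fin.sum_univ_two]; ring

variable {ι : Type*} {U : Ultrafilter ι} {ε : ι → ℝ} {X P : ι → ℝ → Space}

/-- The energy bounds the horizontal speed by 1 uniformly in the flattening; there is no such bound
for the height. -/
theorem norm_fst_sub_le_of_flatGeodesicAt {e : ℝ} {Y Q : ℝ → Space} {s : Set ℝ} (hs : Convex ℝ s)
    (h : ∀ t ∈ s, FlatGeodesicAt G e Y Q t) {a b : ℝ} (ha : a ∈ s) (hb : b ∈ s) :
    ‖(Y b).fst - (Y a).fst‖ ≤ |b - a| := by
  have := hs.norm_image_sub_le_of_norm_hasDerivWithin_le (C := 1)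
    (fun t ht => (HasDerivAt.fst' (h t ht).pos).hasDerivWithinAt)
    (fun t ht => (h t ht).norm_fst_le) ha hb
  rwa [one_mul, Real.norm_eq_abs] at this

theorem convex_abs_sub_lt (t δ : ℝ) : Convex ℝ {s : ℝ | |s - t| < δ} := by
  have : {s : ℝ | |s - t| < δ} = Metric.ball t δ := by ext; simp [Real.dist_eq]
  rw [this]; exact convex_ball t δ

/-- Near a regular point the geodesics converge to straight lines. -/
theorem exists_regular_limit (hG : ContDiff ℝ ∞ G) (hε0 : ∀ᶠ i in U, 0 < ε i)
    (hε : Tendsto ε U (𝓝 0)) {t δ₀ : ℝ} (hδ₀ : 0 < δ₀)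
    (hgeo : ∀ᶠ i in U, ∀ s, |s - t| < δ₀ → FlatGeodesicAt G (ε i) (X i) (P i) s)
    (hcont : ∀ ρ > 0, ∃ δ > 0, ∀ᶠ i in U, ∀ s, |s - t| < δ → ‖X i s - X i t‖ < ρ)
    {X₀ : Space} (hX₀ : Tendsto (fun i => X i t) U (𝓝 X₀)) (h₀ : (gradient G X₀).snd ≠ 0) :
    ∃ δ > 0, ∃ V : Plane, ‖V‖ = 1 ∧
      (∃ C, ∀ᶠ i in U, ∀ s, |s - t| < δ → ‖(P i s).fst - (P i t).fst‖ ≤ C * ε i ^ 2) ∧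
      ∀ s, |s - t| < δ → Tendsto (fun i => (P i s).fst) U (𝓝 V) ∧
        Tendsto (fun i => (X i s).fst) U (𝓝 (X₀.fst + (s - t) • V)) := by
  obtain ⟨ρ, hρ, C, hC, hb⟩ := exists_regular_bound hG h₀
  obtain ⟨δ₁, hδ₁, hc⟩ := hcont (ρ / 2) (by positivity)
  have hX₀' : ∀ᶠ i in U, ‖X i t - X₀‖ < ρ / 2 := by
    have := (Metric.tendsto_nhds.mp hX₀) (ρ / 2) (by positivity)
    simpa [dist_eq_norm] using this
  set δ := min 1 (min δ₀ δ₁) with hδ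
  have hδ0 : 0 < δ := by positivity
  have hev : ∀ᶠ i in U, ∀ s, |s - t| < δ → FlatGeodesicAt G (ε i) (X i) (P i) s ∧
      |(P i s).snd| ≤ C ∧ ∃ p', HasDerivAt (fun s => (P i s).fst) p' s ∧ ‖p'‖ ≤ C * ε i ^ 2 := by
    filter_upwards [hε0, hgeo, hc, hX₀'] with i h1 h2 h3 h4 s hs
    have h5 := h2 s (hs.trans_le ((min_le_right _ _).trans (min_le_left _ _)))
    refine ⟨h5, hb (ε i) h1 (X i) (P i) s h5 ?_⟩
    calc ‖X i s - X₀‖ = ‖(X i s - X i t) + (X i t - X₀)‖ := by rw [sub_add_sub_cancel]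
      _ ≤ ‖X i s - X i t‖ + ‖X i t - X₀‖ := norm_add_le _ _
      _ < ρ := by
        have := h3 s (hs.trans_le ((min_le_right _ _).trans (min_le_right _ _)))
        linarith
  have ht0 : |t - t| < δ := by simpa using hδ0
  have hosc : ∀ᶠ i in U, ∀ s, |s - t| < δ → ‖(P i s).fst - (P i t).fst‖ ≤ C * ε i ^ 2 := by
    filter_upwards [hev] with i hi s hs
    choose! p' hp' using fun s hs => (hi s hs).2.2
    have := (convex_abs_sub_lt t δ).norm_image_sub_le_of_norm_hasDerivWithin_le
      (fun s hs => (hp' s hs).1.hasDerivWithinAt) (fun s hs => (hp' s hs).2) ht0 hs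
    refine this.trans ?_
    have h1 : ‖s - t‖ ≤ 1 := hs.le.trans (min_le_left _ _)
    calc C * ε i ^ 2 * ‖s - t‖ ≤ C * ε i ^ 2 * 1 := by gcongr
      _ = _ := mul_one _
  obtain ⟨V, -, hV⟩ := Ultrafilter.exists_tendsto_of_isCompact U
    (isCompact_closedBall (0 : Plane) 1) (g := fun i => (P i t).fst) (by
      filter_upwards [hev] with i hi
      simpa using (hi t ht0).1.norm_fst_le)
  have hε2 : Tendsto (fun i => C * ε i ^ 2) U (𝓝 0) := by
    simpa using (hε.pow 2).const_mul C
  -- The vertical velocity is bounded, so its share ε² z² of the energy disappears in the limit.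
  have hV1 : ‖V‖ = 1 := by
    have h1 : Tendsto (fun i => ‖(P i t).fst‖ ^ 2) U (𝓝 (‖V‖ ^ 2)) := hV.norm.pow 2
    have h2 : Tendsto (fun i => ‖(P i t).fst‖ ^ 2) U (𝓝 1) := by
      have h3 : Tendsto (fun i => 1 - ε i ^ 2 * C ^ 2) U (𝓝 1) := by
        simpa using ((hε.pow 2).mul_const (C ^ 2)).const_sub 1
      refine tendsto_of_tendsto_of_tendsto_of_le_of_le' h3 tendsto_const_nhds ?_ ?_
      · filter_upwards [hev] with i hi
        obtain ⟨h4, h5, -⟩ := hi t ht0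
        have h6 : (P i t).snd ^ 2 ≤ C ^ 2 := by rw [← sq_abs]; gcongr
        have := h4.energy
        have h7 := mul_le_mul_of_nonneg_left h6 (sq_nonneg (ε i))
        linarith
      · filter_upwards [hev] with i hi
        exact pow_le_one₀ (norm_nonneg _) (hi t ht0).1.norm_fst_le
    have h3 := tendsto_nhds_unique h1 h2
    rwa [pow_eq_one_iff_of_nonneg (norm_nonneg V) two_ne_zero] at h3
  refine ⟨δ, hδ0, V, hV1, ⟨C, hosc⟩, fun s hs => ⟨?_, ?_⟩⟩
  · have h1 : Tendsto (fun i => (P i s).fst - (P i t).fst) U (𝓝 0) :=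
      squeeze_zero_norm' (hosc.mono fun i hi => hi s hs) hε2
    simpa using h1.add hV
  · have h1 : Tendsto (fun i => (X i s).fst - (X i t).fst - (s - t) • (P i t).fst) U (𝓝 0) := by
      refine squeeze_zero_norm' ?_ (by simpa using hε2.mul_const |s - t|)
      filter_upwards [hev, hosc] with i hi ho
      have h2 := (convex_abs_sub_lt t δ).norm_image_sub_le_of_norm_hasDerivWithin_le
        (f := fun s => (X i s).fst - (s - t) • (P i t).fst)
        (f' := fun s => (P i s).fst - (1 : ℝ) • (P i t).fst) (C := C * ε i ^ 2)
        (fun s hs => ((HasDerivAt.fst' (hi s hs).1.pos).sub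
          (((hasDerivAt_id s).sub_const t).smul_const _)).hasDerivWithinAt)
        (fun s hs => by rw [one_smul]; exact ho s hs) ht0 hs
      rw [Real.norm_eq_abs] at h2
      rw [sub_self t, zero_smul, sub_zero, sub_right_comm] at h2
      exact h2
    have h2 := (h1.add ((tendsto_const_nhds (x := s - t)).smul hV)).add
      ((fstL.continuous.tendsto X₀).comp hX₀)
    have h3 : (0 : Plane) + (s - t) • V + fstL X₀ = X₀.fst + (s - t) • V := by
      rw [zero_add, add_comm]; rfl
    rw [h3] at h2
    refine h2.congr fun i => ?_
    change (X i s).fst - (X i t).fst - (s - t) • (P i t).fst + (s - t) • (P i t).fst +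
      (X i t).fst = (X i s).fst
    abel

end

section

/-! ### Geodesics near a fold -/

variable {G : Space → ℝ}

/-- A geodesic near a fold at which the gradient of `G` has the horizontal part `N`, with the
bounds of `IsFold.exists_bound`; `m` is the multiplier in the geodesic equation. -/
structure FoldGeodesicAt (G : Space → ℝ) (N : Plane) (C ε : ℝ) (X P : ℝ → Space) (m : ℝ → ℝ)
    (t : ℝ) : Prop where
  geo : FlatGeodesicAt G ε X P t
  grad_le : ‖gradient G (X t)‖ ≤ C
  acc : HasDerivAt P (m t • raise ε (gradient G (X t))) t
  mult_le : |m t| ≤ C * (m t * ⟪(gradient G (X t)).fst, N⟫_ℝ + C)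

namespace FoldGeodesicAt

variable {N : Plane} {C ε : ℝ} {X P : ℝ → Space} {m : ℝ → ℝ}

theorem hasDerivAt_inner_fst {t : ℝ} (h : FoldGeodesicAt G N C ε X P m t) (w : Plane) :
    HasDerivAt (fun s => ⟪(P s).fst, w⟫_ℝ) (m t * ⟪(gradient G (X t)).fst, w⟫_ℝ) t := by
  have h1 := (HasDerivAt.fst' h.acc).inner ℝ (hasDerivAt_const t w)
  rw [inner_zero_right, zero_add] at h1
  refine h1.congr_deriv ?_
  change ⟪m t • (gradient G (X t)).fst, w⟫_ℝ = _
  rw [real_inner_smul_left]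

theorem hasDerivAt_inner_pos {t : ℝ} (h : FoldGeodesicAt G N C ε X P m t) (w : Plane) :
    HasDerivAt (fun s => ⟪(X s).fst, w⟫_ℝ) ⟪(P t).fst, w⟫_ℝ t := by
  have h1 := (HasDerivAt.fst' h.geo.pos).inner ℝ (hasDerivAt_const t w)
  rwa [inner_zero_right, zero_add] at h1

theorem hasDerivAt_snd {t : ℝ} (h : FoldGeodesicAt G N C ε X P m t) :
    HasDerivAt (fun s => (P s).snd) (m t * ((gradient G (X t)).snd / ε ^ 2)) t :=
  HasDerivAt.snd' h.acc

/-- The bound `mult_le` contains m⟪a, N⟫ ≥ -C, since its left side is nonnegative: the wall cannot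
pull outwards by more than a bounded force. -/
theorem inner_normal_mono (hC : 0 < C) {a b : ℝ} (hab : a ≤ b)
    (h : ∀ t ∈ Icc a b, FoldGeodesicAt G N C ε X P m t) :
    ⟪(P a).fst, N⟫_ℝ + C * a ≤ ⟪(P b).fst, N⟫_ℝ + C * b := by
  refine le_of_hasDerivAt_nonneg hab (f := fun t => ⟪(P t).fst, N⟫_ℝ + C * t)
    (fun t ht => ((h t ht).hasDerivAt_inner_fst N).add ((hasDerivAt_id t).const_mul C))
    fun t ht => ?_
  have h1 := (abs_nonneg _).trans (h t ht).mult_le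
  rw [mul_one]
  exact nonneg_of_mul_nonneg_right h1 hC

/-- A quantity whose derivative is controlled from below by the multiplier. -/
theorem sub_ge_of_deriv {f f' : ℝ → ℝ} {a b σ K : ℝ} (hab : a ≤ b) (hC : 0 < C) (hK : 0 ≤ K)
    (h : ∀ t ∈ Icc a b, FoldGeodesicAt G N C ε X P m t)
    (hf : ∀ t ∈ Icc a b, HasDerivAt f (f' t) t) (hf' : ∀ t ∈ Icc a b, σ - K * |m t| ≤ f' t) :
    σ * (b - a) - K * (C * (2 * ‖N‖ + C * (b - a))) ≤ f b - f a := by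
  -- The added term K C (⟪p, N⟫ + C t) has derivative at least K|m|, by `mult_le`, which makes up
  -- for the loss. It varies by at most K C (2‖N‖ + C(b - a)), because |⟪p, N⟫| ≤ ‖N‖; this is the
  -- bound for the integral of |m|.
  have h1 := le_of_hasDerivAt_nonneg hab
    (f := fun t => f t + (K * (C * (⟪(P t).fst, N⟫_ℝ + C * t)) - σ * t))
    (fun t ht => (hf t ht).add (((((h t ht).hasDerivAt_inner_fst N).add
      ((hasDerivAt_id t).const_mul C)).const_mul C |>.const_mul K).sub
      ((hasDerivAt_id t).const_mul σ))) fun t ht => ?_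
  · have h2 : ∀ t ∈ Icc a b, |⟪(P t).fst, N⟫_ℝ| ≤ ‖N‖ := fun t ht => by
      refine (abs_real_inner_le_norm _ _).trans ?_
      exact mul_le_of_le_one_left (norm_nonneg _) (h t ht).geo.norm_fst_le
    have ha := (abs_le.mp (h2 a (left_mem_Icc.mpr hab))).1
    have hb := (abs_le.mp (h2 b (right_mem_Icc.mpr hab))).2
    have h3 : K * (C * (⟪(P b).fst, N⟫_ℝ - ⟪(P a).fst, N⟫_ℝ)) ≤ K * (C * (2 * ‖N‖)) := by
      gcongr; linarith
    linarith
  · have h3 := mul_le_mul_of_nonneg_left (h t ht).mult_le hK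
    have h4 := hf' t ht
    rw [mul_one, mul_one]
    linarith

/-- The velocity in the direction w changes at the rate m⟪a, w⟫, at most η|m|, and the integral of
|m| is bounded. For w along the wall η is small near the fold. -/
theorem abs_inner_sub_le {a b η : ℝ} {w : Plane} (hab : a ≤ b) (hC : 0 < C)
    (hη : 0 ≤ η) (h : ∀ t ∈ Icc a b, FoldGeodesicAt G N C ε X P m t)
    (hw : ∀ t ∈ Icc a b, |⟪(gradient G (X t)).fst, w⟫_ℝ| ≤ η) :
    |⟪(P b).fst, w⟫_ℝ - ⟪(P a).fst, w⟫_ℝ| ≤ η * (C * (2 * ‖N‖ + C * (b - a))) := by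
  have hm : ∀ t ∈ Icc a b, |m t * ⟪(gradient G (X t)).fst, w⟫_ℝ| ≤ η * |m t| := fun t ht => by
    rw [abs_mul, mul_comm]; gcongr; exact hw t ht
  have h1 := sub_ge_of_deriv (σ := 0) hab hC hη h (fun t ht => (h t ht).hasDerivAt_inner_fst w)
    fun t ht => by have := (abs_le.mp (hm t ht)).1; linarith
  have h2 := sub_ge_of_deriv (σ := 0) hab hC hη h
    (fun t ht => ((h t ht).hasDerivAt_inner_fst w).neg)
    fun t ht => by have := (abs_le.mp (hm t ht)).2; linarith
  simp only [Pi.neg_apply] at h2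
  rw [abs_le]; constructor <;> linarith

/-- The normal velocity is almost nondecreasing, so between a and b it is bounded below by its value
at a and above by its value at b, up to C(b - a). -/
theorem inner_pos_bounds (hC : 0 < C) {a b : ℝ} (hab : a ≤ b)
    (h : ∀ t ∈ Icc a b, FoldGeodesicAt G N C ε X P m t) :
    (b - a) * (⟪(P a).fst, N⟫_ℝ - C * (b - a)) ≤ ⟪(X b).fst, N⟫_ℝ - ⟪(X a).fst, N⟫_ℝ ∧
      ⟪(X b).fst, N⟫_ℝ - ⟪(X a).fst, N⟫_ℝ ≤ (b - a) * (⟪(P b).fst, N⟫_ℝ + C * (b - a)) := by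
  constructor
  · have := le_of_hasDerivAt_nonneg hab
      (f := fun t => ⟪(X t).fst, N⟫_ℝ - (⟪(P a).fst, N⟫_ℝ - C * (b - a)) * t)
      (fun t ht => ((h t ht).hasDerivAt_inner_pos N).sub ((hasDerivAt_id t).const_mul _))
      fun t ht => by
        have := inner_normal_mono hC ht.1 fun s hs => h s ⟨hs.1, hs.2.trans ht.2⟩
        have := mul_le_mul_of_nonneg_left ht.2 hC.le
        linarith
    linarith
  · have := le_of_hasDerivAt_nonneg hab
      (f := fun t => (⟪(P b).fst, N⟫_ℝ + C * (b - a)) * t - ⟪(X t).fst, N⟫_ℝ)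
      (fun t ht => ((hasDerivAt_id t).const_mul _).sub ((h t ht).hasDerivAt_inner_pos N))
      fun t ht => by
        have := inner_normal_mono hC ht.2 fun s hs => h s ⟨ht.1.trans hs.1, hs.2⟩
        have := mul_le_mul_of_nonneg_left ht.1 hC.le
        linarith
    linarith

/-- Between two times the distance to the wall is not much larger than at these times. -/
theorem inner_pos_le_max (hC : 0 < C) {a b s : ℝ} (hs : s ∈ Icc a b)
    (h : ∀ t ∈ Icc a b, FoldGeodesicAt G N C ε X P m t) :
    ⟪(X s).fst, N⟫_ℝ ≤ max ⟪(X a).fst, N⟫_ℝ ⟪(X b).fst, N⟫_ℝ + C * (b - a) ^ 2 := by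
  have h1 := (inner_pos_bounds hC hs.1 fun t ht => h t ⟨ht.1, ht.2.trans hs.2⟩).2
  have h2 := (inner_pos_bounds hC hs.2 fun t ht => h t ⟨hs.1.trans ht.1, ht.2⟩).1
  have hs1 : 0 ≤ s - a := sub_nonneg.mpr hs.1
  have hs2 : 0 ≤ b - s := sub_nonneg.mpr hs.2
  have h3 : C * (s - a) ^ 2 ≤ C * (b - a) ^ 2 := by gcongr; exact hs.2
  have h4 : C * (b - s) ^ 2 ≤ C * (b - a) ^ 2 := by gcongr; exact hs.1
  -- The distance is almost convex in time: if it is not growing at s, compare with the earlier end,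
  -- otherwise with the later one.
  rcases le_total ⟪(P s).fst, N⟫_ℝ 0 with h0 | h0
  · have := mul_nonpos_of_nonneg_of_nonpos hs1 h0
    have := le_max_left ⟪(X a).fst, N⟫_ℝ ⟪(X b).fst, N⟫_ℝ
    linarith
  · have := mul_nonneg hs2 h0
    have := le_max_right ⟪(X a).fst, N⟫_ℝ ⟪(X b).fst, N⟫_ℝ
    linarith

/-- A geodesic cannot stay close to the fold if its velocity has a transversal component: virial
identity for the squared distance to the fold. -/
theorem virial {X₀ : Space} {a b σ θ : ℝ} (hN : N ≠ 0) (hab : a ≤ b) (hb1 : b - a ≤ 1) (hε : 0 < ε)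
    (hC : 0 < C) (hθ : 0 ≤ θ) (h : ∀ t ∈ Icc a b, FoldGeodesicAt G N C ε X P m t)
    (h1 : ∀ t ∈ Icc a b, |⟪(X t).fst - X₀.fst, N⟫_ℝ| ≤ θ)
    (h2 : ∀ t ∈ Icc a b, |((X t).snd - X₀.snd) * (gradient G (X t)).snd| ≤ θ)
    (h3 : ∀ t ∈ Icc a b, σ ≤ ⟪(P t).fst, N⟫_ℝ ^ 2 / ‖N‖ ^ 2 + ε ^ 2 * (P t).snd ^ 2)
    (h4 : ∀ t ∈ Icc a b, |(X t).snd - X₀.snd| ≤ 1) :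
    σ * (b - a) ≤ ((C / ‖N‖ + 1) * (C * (2 * ‖N‖ + C)) + 2 / ‖N‖) * θ + 2 * ε := by
  have hN0 : 0 < ‖N‖ := norm_pos_iff.mpr hN
  -- Half the time derivative of ⟪y, N⟫²/‖N‖² + ε²w², and small near the fold. The velocities
  -- contribute the transversal kinetic energy, at least σ, to Q'. In the acceleration terms the
  -- factor ε² cancels the ε⁻² of `raise`, and what remains is at most θ(C/‖N‖ + 1)|m|.
  set Q : ℝ → ℝ := fun t => ‖N‖⁻¹ ^ 2 * (⟪(X t).fst - X₀.fst, N⟫_ℝ * ⟪(P t).fst, N⟫_ℝ) +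
    ε ^ 2 * (((X t).snd - X₀.snd) * (P t).snd) with hQ
  have hQd : ∀ t ∈ Icc a b, HasDerivAt Q (‖N‖⁻¹ ^ 2 * (⟪(P t).fst, N⟫_ℝ * ⟪(P t).fst, N⟫_ℝ +
      ⟪(X t).fst - X₀.fst, N⟫_ℝ * (m t * ⟪(gradient G (X t)).fst, N⟫_ℝ)) +
      ε ^ 2 * ((P t).snd * (P t).snd +
        ((X t).snd - X₀.snd) * (m t * ((gradient G (X t)).snd / ε ^ 2)))) t := fun t ht => by
    have e1 : HasDerivAt (fun s => ⟪(X s).fst - X₀.fst, N⟫_ℝ) ⟪(P t).fst, N⟫_ℝ t := by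
      simpa only [inner_sub_left] using ((h t ht).hasDerivAt_inner_pos N).sub_const _
    have e2 : HasDerivAt (fun s => (X s).snd - X₀.snd) (P t).snd t :=
      (HasDerivAt.snd' (h t ht).geo.pos).sub_const _
    exact ((e1.mul ((h t ht).hasDerivAt_inner_fst N)).const_mul _).add
      ((e2.mul (h t ht).hasDerivAt_snd).const_mul _)
  have hK : 0 ≤ θ * (C / ‖N‖ + 1) := by positivity
  have key := sub_ge_of_deriv (σ := σ) hab hC hK h hQd fun t ht => by
    set r := ⟪(X t).fst - X₀.fst, N⟫_ℝ with hr
    set α := ⟪(gradient G (X t)).fst, N⟫_ℝ with hα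
    set β := ((X t).snd - X₀.snd) * (gradient G (X t)).snd with hβ
    have e1 : ‖N‖⁻¹ ^ 2 * (⟪(P t).fst, N⟫_ℝ * ⟪(P t).fst, N⟫_ℝ + r * (m t * α)) +
        ε ^ 2 * ((P t).snd * (P t).snd +
        ((X t).snd - X₀.snd) * (m t * ((gradient G (X t)).snd / ε ^ 2))) =
        (⟪(P t).fst, N⟫_ℝ ^ 2 / ‖N‖ ^ 2 + ε ^ 2 * (P t).snd ^ 2) +
          m t * (‖N‖⁻¹ ^ 2 * (r * α) + β) := by
      rw [hβ]; field_simp; ring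
    have e2 : |r * α| ≤ θ * (C * ‖N‖) := by
      rw [abs_mul]
      gcongr
      · exact h1 t ht
      · refine (abs_real_inner_le_norm _ _).trans ?_
        gcongr
        exact (Space.norm_fst_le _).trans (h t ht).grad_le
    have e3 : |‖N‖⁻¹ ^ 2 * (r * α) + β| ≤ θ * (C / ‖N‖ + 1) := by
      refine (abs_add_le _ _).trans ?_
      rw [abs_mul, abs_of_nonneg (a := ‖N‖⁻¹ ^ 2) (by positivity)]
      calc ‖N‖⁻¹ ^ 2 * |r * α| + |β| ≤ ‖N‖⁻¹ ^ 2 * (θ * (C * ‖N‖)) + θ := by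
            gcongr; exact h2 t ht
        _ = _ := by field_simp
    have e4 : -(θ * (C / ‖N‖ + 1) * |m t|) ≤ m t * (‖N‖⁻¹ ^ 2 * (r * α) + β) := by
      refine (abs_le.mp ?_).1
      rw [abs_mul, mul_comm]; gcongr
    rw [e1]
    have := h3 t ht
    linarith
  have hQb : ∀ t ∈ Icc a b, |Q t| ≤ θ / ‖N‖ + ε := fun t ht => by
    refine (abs_add_le _ _).trans ?_
    have hp := (h t ht).geo.norm_fst_le
    have e1 : |⟪(P t).fst, N⟫_ℝ| ≤ ‖N‖ :=
      (abs_real_inner_le_norm _ _).trans (mul_le_of_le_one_left (norm_nonneg _) hp)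
    have e2 : ε * |(P t).snd| ≤ 1 := by
      have := (h t ht).geo.energy
      have e3 : (ε * |(P t).snd|) ^ 2 ≤ 1 := by
        rw [mul_pow, sq_abs]; nlinarith only [this, sq_nonneg ‖(P t).fst‖]
      exact (abs_le_one_iff_mul_self_le_one.mpr (by rwa [← sq])) |> (le_abs_self _).trans
    rw [abs_mul, abs_mul, abs_mul, abs_mul, abs_of_nonneg (a := ‖N‖⁻¹ ^ 2) (by positivity),
      abs_of_nonneg (a := ε ^ 2) (by positivity)]
    calc ‖N‖⁻¹ ^ 2 * (|⟪(X t).fst - X₀.fst, N⟫_ℝ| * |⟪(P t).fst, N⟫_ℝ|) +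
          ε ^ 2 * (|(X t).snd - X₀.snd| * |(P t).snd|)
        = ‖N‖⁻¹ ^ 2 * (|⟪(X t).fst - X₀.fst, N⟫_ℝ| * |⟪(P t).fst, N⟫_ℝ|) +
          ε * (|(X t).snd - X₀.snd| * (ε * |(P t).snd|)) := by ring
      _ ≤ ‖N‖⁻¹ ^ 2 * (θ * ‖N‖) + ε * (1 * 1) := by
          gcongr
          · exact h1 t ht
          · exact h4 t ht
      _ = _ := by field_simp
  have ha := (abs_le.mp (hQb a (left_mem_Icc.mpr hab))).1
  have hb := (abs_le.mp (hQb b (right_mem_Icc.mpr hab))).2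
  have hKC : θ * (C / ‖N‖ + 1) * (C * (2 * ‖N‖ + C * (b - a))) ≤
      θ * (C / ‖N‖ + 1) * (C * (2 * ‖N‖ + C * 1)) := by gcongr
  have e : ((C / ‖N‖ + 1) * (C * (2 * ‖N‖ + C)) + 2 / ‖N‖) * θ + 2 * ε =
      θ * (C / ‖N‖ + 1) * (C * (2 * ‖N‖ + C * 1)) + 2 * (θ / ‖N‖ + ε) := by ring
  linarith

end FoldGeodesicAt

end

section

/-! ### Limits of geodesics at a fold -/

variable {G : Space → ℝ} {ι : Type*} {U : Ultrafilter ι} {ε : ι → ℝ} {X P : ι → ℝ → Space}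
  {m : ι → ℝ → ℝ} {X₀ : Space} {t₀ δ₀ C : ℝ} {v : Plane}

/-- The component of the velocity along the wall is preserved in the limit. -/
theorem IsFold.tangential_limit (hG : ContDiff ℝ ∞ G) (hC : 0 < C) (hδ₀ : 0 < δ₀)
    (hfold : ∀ᶠ i in U, ∀ s, |s - t₀| < δ₀ →
      FoldGeodesicAt G (gradient G X₀).fst C (ε i) (X i) (P i) (m i) s)
    (hnear : ∀ ρ > 0, ∃ δ > 0, ∀ᶠ i in U, ∀ s, |s - t₀| < δ → ‖X i s - X₀‖ < ρ)
    (hin : ∀ t, t₀ - δ₀ < t → t < t₀ → Tendsto (fun i => (P i t).fst) U (𝓝 v))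
    {τ : Plane} (hτ : ⟪(gradient G X₀).fst, τ⟫_ℝ = 0) {e : ℝ} (he : 0 < e) :
    ∃ δ > 0, ∀ᶠ i in U, ∀ s, |s - t₀| < δ → |⟪(P i s).fst, τ⟫_ℝ - ⟪v, τ⟫_ℝ| ≤ e := by
  set N := (gradient G X₀).fst with hN
  -- If ⟪a, τ⟫ stays below η, the velocity along τ changes by at most e / 2 in a time at most 1. The
  -- other e / 2 is for the convergence at the reference time t₀ - δ/2, which precedes the whole
  -- final interval.
  set η := e / 2 / (C * (2 * ‖N‖ + C)) with hη
  have hη0 : 0 < η := by positivity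
  have hgc : Continuous fun Y => ⟪(gradient G Y).fst, τ⟫_ℝ :=
    (fstL.continuous.comp (contDiff_gradient hG).continuous).inner continuous_const
  have hev : ∀ᶠ Y in 𝓝 X₀, |⟪(gradient G Y).fst, τ⟫_ℝ| < η := by
    refine (hgc.abs.continuousAt (x := X₀)).eventually_lt_const ?_
    change |⟪N, τ⟫_ℝ| < η
    rw [hτ, abs_zero]; exact hη0
  obtain ⟨ρ, hρ, hρ'⟩ := Metric.eventually_nhds_iff.mp hev
  obtain ⟨δ₁, hδ₁, h1⟩ := hnear ρ hρ
  set δ := min (min δ₀ δ₁) 1 with hδ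
  have hδ0 : 0 < δ := by positivity
  have hd0 : δ ≤ δ₀ := (min_le_left _ _).trans (min_le_left _ _)
  have hd1 : δ ≤ δ₁ := (min_le_left _ _).trans (min_le_right _ _)
  have hd2 : δ ≤ 1 := min_le_right _ _
  have hlim := (hin (t₀ - δ / 2) (by linarith) (by linarith)).inner (𝕜 := ℝ)
    (tendsto_const_nhds (x := τ))
  have hbase : ∀ᶠ i in U, |⟪(P i (t₀ - δ / 2)).fst, τ⟫_ℝ - ⟪v, τ⟫_ℝ| < e / 2 := by
    have := (Metric.tendsto_nhds.mp hlim) (e / 2) (by positivity)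
    simpa [Real.dist_eq] using this
  refine ⟨δ / 2, by positivity, ?_⟩
  filter_upwards [hfold, h1, hbase] with i hi1 hi2 hi3 s hs
  have hs' := abs_lt.mp hs
  have hmem : ∀ t ∈ Icc (t₀ - δ / 2) s, |t - t₀| < δ := fun t ht => by
    rw [abs_lt]; constructor <;> linarith [ht.1, ht.2]
  have key := FoldGeodesicAt.abs_inner_sub_le (w := τ) (by linarith) hC hη0.le
    (fun t ht => hi1 t ((hmem t ht).trans_le hd0))
    (fun t ht => (hρ' (by rw [dist_eq_norm]; exact hi2 t ((hmem t ht).trans_le hd1))).le)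
  have h5 : η * (C * (2 * ‖N‖ + C * (s - (t₀ - δ / 2)))) ≤ e / 2 := by
    calc η * (C * (2 * ‖N‖ + C * (s - (t₀ - δ / 2)))) ≤ η * (C * (2 * ‖N‖ + C * 1)) := by
          gcongr; linarith
      _ = e / 2 := by rw [mul_one, hη]; exact div_mul_cancel₀ _ (by positivity)
  have h6 := abs_sub_le ⟪(P i s).fst, τ⟫_ℝ ⟪(P i (t₀ - δ / 2)).fst, τ⟫_ℝ ⟪v, τ⟫_ℝ
  linarith

/-- A limit of geodesics reaches a fold from the inside. -/
theorem IsFold.inner_nonpos (hG : ContDiff ℝ ∞ G) (h₀ : IsFold G X₀) (hC : 0 < C) (hδ₀ : 0 < δ₀)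
    (hfold : ∀ᶠ i in U, ∀ s, |s - t₀| < δ₀ →
      FoldGeodesicAt G (gradient G X₀).fst C (ε i) (X i) (P i) (m i) s)
    (hnear : ∀ ρ > 0, ∃ δ > 0, ∀ᶠ i in U, ∀ s, |s - t₀| < δ → ‖X i s - X₀‖ < ρ)
    (hX₀ : Tendsto (fun i => X i t₀) U (𝓝 X₀))
    (hin : ∀ t, t₀ - δ₀ < t → t < t₀ → Tendsto (fun i => (P i t).fst) U (𝓝 v)) :
    ⟪v, (gradient G X₀).fst⟫_ℝ ≤ 0 := by
  set N := (gradient G X₀).fst with hN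
  by_contra! hβ
  set β := ⟪v, N⟫_ℝ with hβd
  obtain ⟨κ, hκ, hshape⟩ := h₀.exists_shape hG
  obtain ⟨ρ, hρ, hshape⟩ := hshape (β / 4) (by positivity)
  obtain ⟨δ₁, hδ₁, h1⟩ := hnear ρ hρ
  -- With an outward-to-inward velocity β > 0, the curve would be at normal position at most about
  -- -ℓ(β - Cℓ) ≤ -3βℓ/4 at the time t₀ - ℓ, since it reaches the fold at t₀. The shape of the
  -- surface allows nothing below about -βℓ/4.
  set ℓ := min (min δ₀ δ₁) (β / C) / 4 with hℓ
  have hℓ0 : 0 < ℓ := by positivity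
  have hm1 : min (min δ₀ δ₁) (β / C) ≤ δ₀ := (min_le_left _ _).trans (min_le_left _ _)
  have hm2 : min (min δ₀ δ₁) (β / C) ≤ δ₁ := (min_le_left _ _).trans (min_le_right _ _)
  have hm3 : min (min δ₀ δ₁) (β / C) ≤ β / C := min_le_right _ _
  have hy : Tendsto (fun i => (X i t₀).fst - X₀.fst) U (𝓝 0) := by
    have := ((fstL.continuous.tendsto X₀).comp hX₀).sub_const X₀.fst
    rwa [fstL_apply, sub_self] at this
  have hp := (hin (t₀ - ℓ) (by linarith) (by linarith)).inner (𝕜 := ℝ)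
    (tendsto_const_nhds (x := N))
  have hlim : Tendsto (fun i => ⟪(X i t₀).fst - X₀.fst, N⟫_ℝ +
      β / 4 * (‖(X i t₀).fst - X₀.fst‖ + ℓ) - ℓ * (⟪(P i (t₀ - ℓ)).fst, N⟫_ℝ - C * ℓ)) U
      (𝓝 (⟪(0 : Plane), N⟫_ℝ + β / 4 * (‖(0 : Plane)‖ + ℓ) - ℓ * (β - C * ℓ))) :=
    ((hy.inner (𝕜 := ℝ) tendsto_const_nhds).add ((hy.norm.add_const ℓ).const_mul _)).sub
      ((hp.sub_const _).const_mul _)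
  have hpos : ∀ᶠ i in U, 0 ≤ ⟪(X i t₀).fst - X₀.fst, N⟫_ℝ +
      β / 4 * (‖(X i t₀).fst - X₀.fst‖ + ℓ) - ℓ * (⟪(P i (t₀ - ℓ)).fst, N⟫_ℝ - C * ℓ) := by
    filter_upwards [hfold, h1] with i hi1 hi2
    have hmem : ∀ t ∈ Icc (t₀ - ℓ) t₀, |t - t₀| < δ₀ ∧ |t - t₀| < δ₁ := fun t ht => by
      constructor <;> rw [abs_lt] <;> constructor <;> linarith [ht.1, ht.2]
    have hle : t₀ - ℓ ≤ t₀ := by linarith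
    have k1 := (FoldGeodesicAt.inner_pos_bounds hC hle fun t ht => hi1 t (hmem t ht).1).1
    have hleft := hmem _ (left_mem_Icc.mpr hle)
    have k2 := (hshape _ (hi2 _ hleft.2) (hi1 _ hleft.1).geo.zero).1
    have k3 := norm_fst_sub_le_of_flatGeodesicAt (convex_abs_sub_lt t₀ δ₀)
      (fun t ht => (hi1 t ht).geo) (a := t₀) (b := t₀ - ℓ)
      (by simpa using hδ₀) hleft.1
    have k4 : |t₀ - ℓ - t₀| = ℓ := by
      rw [show t₀ - ℓ - t₀ = -ℓ by ring, abs_neg, abs_of_pos hℓ0]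
    have k5 : ‖(X i (t₀ - ℓ)).fst - X₀.fst‖ ≤ ℓ + ‖(X i t₀).fst - X₀.fst‖ := by
      rw [k4] at k3
      have := norm_sub_le_norm_sub_add_norm_sub (X i (t₀ - ℓ)).fst (X i t₀).fst X₀.fst
      linarith
    have k6 : 0 ≤ κ * ((X i (t₀ - ℓ)).snd - X₀.snd) ^ 2 := by positivity
    have k7 := mul_le_mul_of_nonneg_left k5 (show 0 ≤ β / 4 by positivity)
    rw [inner_sub_left] at k2 ⊢
    rw [show t₀ - (t₀ - ℓ) = ℓ by ring] at k1
    linarith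
  have hfin := ge_of_tendsto hlim hpos
  rw [inner_zero_left, norm_zero] at hfin
  have h7 : C * ℓ ≤ β / 4 := by
    have : C * (β / C) = β := mul_div_cancel₀ _ hC.ne'
    have := mul_le_mul_of_nonneg_left hm3 hC.le
    rw [hℓ]; linarith
  have h8 := mul_le_mul_of_nonneg_left h7 hℓ0.le
  have h9 := mul_pos hβ hℓ0
  linarith

set_option maxHeartbeats 1000000 in
/-- A limit of geodesics that reaches a fold transversally leaves it at once. -/
theorem IsFold.escape (hG : ContDiff ℝ ∞ G) (h₀ : IsFold G X₀) (hC : 0 < C) (hδ₀ : 0 < δ₀)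
    (hε0 : ∀ᶠ i in U, 0 < ε i) (hε : Tendsto ε U (𝓝 0))
    (hfold : ∀ᶠ i in U, ∀ s, |s - t₀| < δ₀ →
      FoldGeodesicAt G (gradient G X₀).fst C (ε i) (X i) (P i) (m i) s)
    (hnear : ∀ ρ > 0, ∃ δ > 0, ∀ᶠ i in U, ∀ s, |s - t₀| < δ → ‖X i s - X₀‖ < ρ)
    (hX₀ : Tendsto (fun i => X i t₀) U (𝓝 X₀))
    (hin : ∀ t, t₀ - δ₀ < t → t < t₀ → Tendsto (fun i => (P i t).fst) U (𝓝 v))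
    (hv : ‖v‖ = 1) (hvN : ⟪v, (gradient G X₀).fst⟫_ℝ ≠ 0) :
    ∃ c > 0, ∃ δ > 0, ∀ t, t₀ < t → t < t₀ + δ → ∀ᶠ i in U,
      c * (t - t₀) ≤ ⟪(X i t).fst - X₀.fst, (gradient G X₀).fst⟫_ℝ := by
  set N := (gradient G X₀).fst with hN
  have hN0 : 0 < ‖N‖ := norm_pos_iff.mpr h₀.hor
  obtain ⟨τ, hτ1, hτN, hτ⟩ := exists_unit_normal_vector h₀.hor
  -- The transversal kinetic energy of the incoming velocity. A change of at most σ / 6 in the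
  -- tangential velocity leaves at least σ / 2 for the normal and vertical motions together.
  set σ := ⟪v, N⟫_ℝ ^ 2 / ‖N‖ ^ 2 with hσ
  have hσ0 : 0 < σ := by positivity
  have hvσ : σ + ⟪v, τ⟫_ℝ ^ 2 = 1 := by rw [← hτ v, hv]; norm_num
  have hσ1 : σ ≤ 1 := by nlinarith only [hvσ, sq_nonneg ⟪v, τ⟫_ℝ]
  obtain ⟨δ₁, hδ₁, htan⟩ := IsFold.tangential_limit hG hC hδ₀ hfold hnear hin hτN
    (e := σ / 6) (by positivity)
  set K := (C / ‖N‖ + 1) * (C * (2 * ‖N‖ + C)) + 2 / ‖N‖ with hK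
  have hK0 : 0 < K := by positivity
  -- With θ = cℓ the virial bound is Kθ + 2ε = σℓ/8 + 2ε, below σℓ/2 as soon as ε < σℓ/8.
  set c := σ / (8 * K) with hc
  have hc0 : 0 < c := by positivity
  set L := ‖hess G X₀‖ + 1 with hL
  have hL0 : 0 < L := by positivity
  obtain ⟨κ, hκ, hshape⟩ := h₀.exists_shape hG
  -- The bound by c keeps the normal distance below cℓ. The other one makes w² ≤ eℓ/κ small enough
  -- for the product of w and the vertical gradient, which is at most L(2w² + ‖y‖²).
  set e := min c (c * κ / (4 * L)) with he
  have he0 : 0 < e := by positivity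
  have he1 : e ≤ c := min_le_left _ _
  have he2 : L * (2 * e / κ) ≤ c / 2 := by
    calc L * (2 * e / κ) ≤ L * (2 * (c * κ / (4 * L)) / κ) := by
          gcongr; exact min_le_right _ _
      _ = c / 2 := by field_simp; norm_num
  obtain ⟨ρ, hρ, hshape⟩ := hshape (e / 8) (by positivity)
  have hlip : ∀ᶠ Y in 𝓝 X₀, ‖gradient G Y - gradient G X₀‖ ≤ L * ‖Y - X₀‖ := by
    have := ((hasFDerivAt_gradient hG X₀).isLittleO).def (zero_lt_one)
    filter_upwards [this] with Y hY
    have h1 := (hess G X₀).le_opNorm (Y - X₀)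
    have h2 := norm_sub_norm_le (gradient G Y - gradient G X₀) (hess G X₀ (Y - X₀))
    rw [hL]
    linarith
  obtain ⟨ρ₂, hρ₂, hlip⟩ := Metric.eventually_nhds_iff.mp hlip
  obtain ⟨δ₂, hδ₂, hnr⟩ := hnear (min 1 (min ρ ρ₂)) (by positivity)
  set δ := min (min (min δ₀ δ₁) (min δ₂ 1)) (min (e / (4 * C)) (c / (8 * L))) with hδ
  have hδ0 : 0 < δ := by positivity
  refine ⟨e / 4, by positivity, δ, hδ0, ?_⟩
  by_contra! hcon
  obtain ⟨t, ht0, htδ, hfreq⟩ := hcon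
  set ℓ := t - t₀ with hℓ
  have hℓ0 : 0 < ℓ := sub_pos.mpr ht0
  have hℓδ : ℓ < δ := by linarith
  have d0 : δ ≤ δ₀ := (min_le_left _ _).trans ((min_le_left _ _).trans (min_le_left _ _))
  have d1 : δ ≤ δ₁ := (min_le_left _ _).trans ((min_le_left _ _).trans (min_le_right _ _))
  have d2 : δ ≤ δ₂ := (min_le_left _ _).trans ((min_le_right _ _).trans (min_le_left _ _))
  have d3 : δ ≤ 1 := (min_le_left _ _).trans ((min_le_right _ _).trans (min_le_right _ _))
  have d4 : C * ℓ ≤ e / 4 := by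
    have : ℓ ≤ e / (4 * C) := hℓδ.le.trans ((min_le_right _ _).trans (min_le_left _ _))
    rw [le_div_iff₀ (by positivity)] at this; linarith
  have d5 : L * (4 * ℓ) ≤ c / 2 := by
    have : ℓ ≤ c / (8 * L) := hℓδ.le.trans ((min_le_right _ _).trans (min_le_right _ _))
    rw [le_div_iff₀ (by positivity)] at this; linarith
  have hy : Tendsto (fun i => (X i t₀).fst - X₀.fst) U (𝓝 0) := by
    have := ((fstL.continuous.tendsto X₀).comp hX₀).sub_const X₀.fst
    rwa [fstL_apply, sub_self] at this
  have hy1 : ∀ᶠ i in U, ‖(X i t₀).fst - X₀.fst‖ < ℓ := by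
    refine hy.norm.eventually_lt_const ?_
    rwa [norm_zero]
  have hy2 : ∀ᶠ i in U, ⟪(X i t₀).fst - X₀.fst, N⟫_ℝ < e / 4 * ℓ := by
    refine (hy.inner (𝕜 := ℝ) (tendsto_const_nhds (x := N))).eventually_lt_const ?_
    rw [inner_zero_left]; positivity
  have hεs : ∀ᶠ i in U, ε i < σ * ℓ / 8 := hε.eventually_lt_const (by positivity)
  -- One index is enough for the contradiction: a geodesic that has not left the wall at time t has
  -- stayed within cℓ of it during the whole interval, against the virial bound.
  obtain ⟨i, hfi, hni, hti, hyi, hyi2, hεi, hεi0, hri⟩ :=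
    (hfold.and (hnr.and (htan.and (hy1.and (hy2.and (hεs.and (hε0.and hfreq))))))).exists
  have hmem : ∀ s ∈ Icc t₀ t, |s - t₀| < δ := fun s hs => by
    rw [abs_lt]; constructor <;> linarith [hs.1, hs.2]
  have hF : ∀ s ∈ Icc t₀ t, FoldGeodesicAt G N C (ε i) (X i) (P i) (m i) s :=
    fun s hs => hfi s ((hmem s hs).trans_le d0)
  have hn : ∀ s ∈ Icc t₀ t, ‖X i s - X₀‖ < min 1 (min ρ ρ₂) :=
    fun s hs => hni s ((hmem s hs).trans_le d2)
  have hsh := fun s hs => (hshape (X i s) ((hn s hs).trans_le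
    ((min_le_right _ _).trans (min_le_left _ _))) (hF s hs).geo.zero).1
  have hyb : ∀ s ∈ Icc t₀ t, ‖(X i s).fst - X₀.fst‖ ≤ 2 * ℓ := fun s hs => by
    have k3 := norm_fst_sub_le_of_flatGeodesicAt (convex_Icc t₀ t)
      (fun t ht => (hF t ht).geo) (left_mem_Icc.mpr ht0.le) hs
    rw [abs_of_nonneg (sub_nonneg.mpr hs.1)] at k3
    have := norm_sub_le_norm_sub_add_norm_sub (X i s).fst (X i t₀).fst X₀.fst
    linarith [hs.2]
  have hup : ∀ s ∈ Icc t₀ t, ⟪(X i s).fst - X₀.fst, N⟫_ℝ ≤ e / 2 * ℓ := fun s hs => by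
    have h1 := FoldGeodesicAt.inner_pos_le_max hC hs hF
    rw [inner_sub_left] at hyi2 hri ⊢
    have h2 : max ⟪(X i t₀).fst, N⟫_ℝ ⟪(X i t).fst, N⟫_ℝ ≤ e / 4 * ℓ + ⟪X₀.fst, N⟫_ℝ := by
      apply max_le <;> linarith
    have h3 : C * (t - t₀) ^ 2 ≤ e / 4 * ℓ := by
      have := mul_le_mul_of_nonneg_right d4 hℓ0.le
      rw [← hℓ]; linarith
    linarith
  have hw : ∀ s ∈ Icc t₀ t, κ * ((X i s).snd - X₀.snd) ^ 2 ≤ e * ℓ := fun s hs => by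
    have h1 := hsh s hs
    have h2 := hup s hs
    have h3 := mul_le_mul_of_nonneg_left (hyb s hs) (show 0 ≤ e / 8 by positivity)
    have := mul_pos he0 hℓ0
    linarith
  have key := FoldGeodesicAt.virial (X₀ := X₀) (σ := σ / 2) (θ := c * ℓ) h₀.hor ht0.le
    (by linarith) hεi0 hC (by positivity) hF (fun s hs => ?_) (fun s hs => ?_) (fun s hs => ?_)
    (fun s hs => ?_)
  · have h1 : K * (c * ℓ) = σ * ℓ / 8 := by rw [hc]; field_simp
    have := mul_pos hσ0 hℓ0
    rw [← hK, h1] at key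
    linarith
  · have h1 := hsh s hs
    have h2 := hup s hs
    have h3 := mul_le_mul_of_nonneg_left (hyb s hs) (show 0 ≤ e / 8 by positivity)
    have h4 : 0 ≤ κ * ((X i s).snd - X₀.snd) ^ 2 := by positivity
    have h5 := mul_le_mul_of_nonneg_right he1 hℓ0.le
    have h6 := mul_pos he0 hℓ0
    rw [abs_le]; constructor <;> linarith
  · set w := (X i s).snd - X₀.snd with hwd
    set y := (X i s).fst - X₀.fst with hyd
    have h1 : |(gradient G (X i s)).snd| ≤ L * (‖y‖ + |w|) := by
      calc |(gradient G (X i s)).snd| = |(gradient G (X i s) - gradient G X₀).snd| := by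
            simp [h₀.vert]
        _ ≤ ‖gradient G (X i s) - gradient G X₀‖ := Space.abs_snd_le _
        _ ≤ L * ‖X i s - X₀‖ := hlip (by
            rw [dist_eq_norm]
            exact (hn s hs).trans_le ((min_le_right _ _).trans (min_le_right _ _)))
        _ ≤ L * (‖y‖ + |w|) := by gcongr; exact Space.norm_le (X i s - X₀)
    have h2 : |w| ^ 2 ≤ e * ℓ / κ := by
      rw [le_div_iff₀ hκ, sq_abs, mul_comm]; exact hw s hs
    have h3 : ‖y‖ ^ 2 ≤ 4 * ℓ * ℓ := by
      have := hyb s hs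
      nlinarith only [this, norm_nonneg y]
    rw [abs_mul]
    calc |w| * |(gradient G (X i s)).snd| ≤ |w| * (L * (‖y‖ + |w|)) := by gcongr
      _ ≤ L * (2 * |w| ^ 2 + ‖y‖ ^ 2) := by
        have : |w| * (‖y‖ + |w|) ≤ 2 * |w| ^ 2 + ‖y‖ ^ 2 := by
          nlinarith only [sq_nonneg (|w| - ‖y‖), sq_nonneg |w|, sq_nonneg ‖y‖]
        calc |w| * (L * (‖y‖ + |w|)) = L * (|w| * (‖y‖ + |w|)) := by ring
          _ ≤ _ := by gcongr
      _ ≤ L * (2 * (e * ℓ / κ) + 4 * ℓ * ℓ) := by gcongr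
      _ = L * (2 * e / κ) * ℓ + L * (4 * ℓ) * ℓ := by ring
      _ ≤ c / 2 * ℓ + c / 2 * ℓ := by gcongr
      _ = c * ℓ := by ring
  · have h1 := hτ (P i s).fst
    have h2 := (hF s hs).geo.energy
    have h3 := hti s ((hmem s hs).trans_le d1)
    have h4 : |⟪v, τ⟫_ℝ| ≤ 1 := by
      rw [← abs_one]; apply sq_le_sq.mp; linarith
    have h5 : |⟪(P i s).fst, τ⟫_ℝ| ≤ |⟪v, τ⟫_ℝ| + σ / 6 := by
      have := abs_sub_abs_le_abs_sub ⟪(P i s).fst, τ⟫_ℝ ⟪v, τ⟫_ℝ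
      linarith
    have h6 : ⟪(P i s).fst, τ⟫_ℝ ^ 2 ≤ ⟪v, τ⟫_ℝ ^ 2 + σ / 2 := by
      rw [← sq_abs, ← sq_abs ⟪v, τ⟫_ℝ]
      have h7 := pow_le_pow_left₀ (abs_nonneg ⟪(P i s).fst, τ⟫_ℝ) h5 2
      nlinarith only [h7, h4, hσ0, hσ1, abs_nonneg ⟪v, τ⟫_ℝ]
    linarith
  · exact (Space.abs_snd_le (X i s - X₀)).trans ((hn s hs).le.trans (min_le_left _ _))

end

/-! ### The reflection law at a fold -/

section

variable {G : Space → ℝ} {ι : Type*} {U : Ultrafilter ι} {ε : ι → ℝ} {X P : ι → ℝ → Space}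
  {X₀ : Space} {t₀ δ₀ : ℝ} {v : Plane}

theorem eq_of_locally_constant {a b : ℝ} {f : ℝ → Plane}
    (h : ∀ t ∈ Ioo a b, ∀ᶠ s in 𝓝 t, f s = f t) {s t : ℝ} (hs : s ∈ Ioo a b) (ht : t ∈ Ioo a b) :
    f s = f t := by
  have hd : ∀ t ∈ Ioo a b, HasDerivAt f 0 t := fun t ht =>
    (hasDerivAt_const t (f t)).congr_of_eventuallyEq (h t ht)
  exact isOpen_Ioo.is_const_of_deriv_eq_zero isPreconnected_Ioo
    (fun t ht => (hd t ht).differentiableAt.differentiableWithinAt) (fun t ht => (hd t ht).deriv)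
    hs ht

set_option maxHeartbeats 1000000 in
/-- A limit of geodesics that reaches a fold transversally is reflected. -/
theorem IsFold.collision (hG : ContDiff ℝ ∞ G) (h₀ : IsFold G X₀) (hδ₀ : 0 < δ₀)
    (hε0 : ∀ᶠ i in U, 0 < ε i) (hε : Tendsto ε U (𝓝 0))
    (hgeo : ∀ᶠ i in U, ∀ s, |s - t₀| < δ₀ → FlatGeodesicAt G (ε i) (X i) (P i) s)
    (hcont : ∀ t, |t - t₀| < δ₀ → ∀ ρ > 0, ∃ δ > 0, ∀ᶠ i in U, ∀ s, |s - t| < δ →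
      ‖X i s - X i t‖ < ρ)
    (hX₀ : Tendsto (fun i => X i t₀) U (𝓝 X₀))
    (hin : ∀ t, t₀ - δ₀ < t → t < t₀ → Tendsto (fun i => (P i t).fst) U (𝓝 v))
    (hv : ‖v‖ = 1) (hvN : ⟪v, (gradient G X₀).fst⟫_ℝ ≠ 0) :
    ∃ δ > 0, ∀ t, t₀ < t → t < t₀ + δ →
      Tendsto (fun i => (P i t).fst) U (𝓝 (v - (2 * ⟪v, (gradient G X₀).fst⟫_ℝ /
        ‖(gradient G X₀).fst‖ ^ 2) • (gradient G X₀).fst)) ∧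
      Tendsto (fun i => (X i t).fst) U (𝓝 (X₀.fst + (t - t₀) •
        (v - (2 * ⟪v, (gradient G X₀).fst⟫_ℝ / ‖(gradient G X₀).fst‖ ^ 2) •
          (gradient G X₀).fst))) := by
  classical
  set N := (gradient G X₀).fst with hN
  have hN0 : 0 < ‖N‖ := norm_pos_iff.mpr h₀.hor
  have hnear : ∀ ρ > 0, ∃ δ > 0, ∀ᶠ i in U, ∀ s, |s - t₀| < δ → ‖X i s - X₀‖ < ρ := by
    intro ρ hρ
    obtain ⟨δ, hδ, h1⟩ := hcont t₀ (by simpa using hδ₀) (ρ / 2) (by positivity)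
    refine ⟨δ, hδ, ?_⟩
    have h2 := (Metric.tendsto_nhds.mp hX₀) (ρ / 2) (by positivity)
    filter_upwards [h1, h2] with i hi1 hi2 s hs
    rw [dist_eq_norm] at hi2
    have := norm_sub_le_norm_sub_add_norm_sub (X i s) (X i t₀) X₀
    linarith [hi1 s hs]
  obtain ⟨ρ, hρ, C, hC, hbd⟩ := h₀.exists_bound hG
  obtain ⟨δ₁, hδ₁, hn1⟩ := hnear ρ hρ
  -- The multiplier is chosen as a function of all indices and times, with default value 0 where the
  -- bound of `exists_bound` is not available.
  have hm : ∀ i s, ∃ m : ℝ, (∃ m' : ℝ, HasDerivAt (P i) (m' • raise (ε i) (gradient G (X i s))) s ∧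
      |m'| ≤ C * (m' * ⟪(gradient G (X i s)).fst, N⟫_ℝ + C)) →
      HasDerivAt (P i) (m • raise (ε i) (gradient G (X i s))) s ∧
      |m| ≤ C * (m * ⟪(gradient G (X i s)).fst, N⟫_ℝ + C) := fun i s => by
    by_cases h : ∃ m' : ℝ, HasDerivAt (P i) (m' • raise (ε i) (gradient G (X i s))) s ∧
      |m'| ≤ C * (m' * ⟪(gradient G (X i s)).fst, N⟫_ℝ + C)
    · exact ⟨h.choose, fun _ => h.choose_spec⟩
    · exact ⟨0, fun h' => absurd h' h⟩
  choose m hm using hm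
  set δ₂ := min δ₀ δ₁ with hδ₂
  have hδ₂0 : 0 < δ₂ := by positivity
  have hfold : ∀ᶠ i in U, ∀ s, |s - t₀| < δ₂ →
      FoldGeodesicAt G N C (ε i) (X i) (P i) (m i) s := by
    filter_upwards [hgeo, hn1, hε0] with i hi1 hi2 hi3 s hs
    have h1 := hi1 s (hs.trans_le (min_le_left _ _))
    obtain ⟨h2, h3⟩ := hbd (ε i) hi3 _ _ s h1 (hi2 s (hs.trans_le (min_le_right _ _)))
    exact ⟨h1, h2, (hm i s h3).1, (hm i s h3).2⟩
  have hin' : ∀ t, t₀ - δ₂ < t → t < t₀ → Tendsto (fun i => (P i t).fst) U (𝓝 v) :=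
    fun t h1 h2 => hin t (by linarith [min_le_left δ₀ δ₁]) h2
  have hvneg : ⟪v, N⟫_ℝ < 0 :=
    lt_of_le_of_ne (IsFold.inner_nonpos hG h₀ hC hδ₂0 hfold hnear hX₀ hin') hvN
  obtain ⟨c, hc, δ₃, hδ₃, hesc⟩ :=
    IsFold.escape hG h₀ hC hδ₂0 hε0 hε hfold hnear hX₀ hin' hv hvN
  obtain ⟨κ, -, hshape⟩ := h₀.exists_shape hG
  obtain ⟨ρ₂, hρ₂, hshape⟩ := hshape (c / 2) (by positivity)
  obtain ⟨δ₄, hδ₄, hn4⟩ := hnear (ρ₂ / 2) (by positivity)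
  set δ := min (min δ₂ δ₃) δ₄ with hδ
  have hδ0 : 0 < δ := by positivity
  have hdd2 : δ ≤ δ₂ := (min_le_left _ _).trans (min_le_left _ _)
  have hd0 : δ ≤ δ₀ := hdd2.trans (min_le_left _ _)
  have hd3 : δ ≤ δ₃ := (min_le_left _ _).trans (min_le_right _ _)
  have hd4 : δ ≤ δ₄ := min_le_right _ _
  -- the limit of the geodesics at each time
  have hlim : ∀ t ∈ Ioo t₀ (t₀ + δ), ∃ Y : Space, Tendsto (fun i => X i t) U (𝓝 Y) ∧
      (gradient G Y).snd ≠ 0 ∧ ‖Y.fst - X₀.fst‖ ≤ t - t₀ ∧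
      c * (t - t₀) ≤ ⟪Y.fst - X₀.fst, N⟫_ℝ := by
    intro t ht
    have habs : |t - t₀| = t - t₀ := abs_of_pos (sub_pos.mpr ht.1)
    have habs' : |t - t₀| < δ := by rw [habs]; linarith [ht.2]
    obtain ⟨Y, hY, hYl⟩ := Ultrafilter.exists_tendsto_of_isCompact U
      (isCompact_closedBall X₀ (ρ₂ / 2)) (g := fun i => X i t) (by
        filter_upwards [hn4] with i hi
        rw [Metric.mem_closedBall, dist_eq_norm]
        exact (hi t (habs'.trans_le hd4)).le)
    have hYf : Tendsto (fun i => (X i t).fst) U (𝓝 Y.fst) := (fstL.continuous.tendsto Y).comp hYl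
    have hXf : Tendsto (fun i => (X i t₀).fst) U (𝓝 X₀.fst) :=
      (fstL.continuous.tendsto X₀).comp hX₀
    have h1 : ‖Y.fst - X₀.fst‖ ≤ t - t₀ := by
      refine le_of_tendsto (hYf.sub hXf).norm ?_
      filter_upwards [hgeo] with i hi
      have := norm_fst_sub_le_of_flatGeodesicAt (convex_abs_sub_lt t₀ δ₀) hi (a := t₀) (b := t)
        (by simpa using hδ₀) (habs'.trans_le hd0)
      rwa [habs] at this
    have h2 : c * (t - t₀) ≤ ⟪Y.fst - X₀.fst, N⟫_ℝ :=
      ge_of_tendsto ((hYf.sub_const _).inner (𝕜 := ℝ) tendsto_const_nhds)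
        (hesc t ht.1 (by linarith [ht.2]))
    -- Y is regular: at a point with a vertical tangent plane the normal displacement would be at
    -- most (c / 2)‖y‖ ≤ (c / 2)(t - t₀), but by the escape estimate it is at least c(t - t₀).
    refine ⟨Y, hYl, fun h => ?_, h1, h2⟩
    have h3 : G Y = 0 := by
      refine tendsto_nhds_unique ((hG.continuous.tendsto Y).comp hYl) ?_
      refine tendsto_const_nhds.congr' ?_
      filter_upwards [hgeo] with i hi
      exact (hi t (habs'.trans_le hd0)).zero.symm
    have h4 := (hshape Y (by
      rw [Metric.mem_closedBall, dist_eq_norm] at hY; linarith) h3).2 h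
    have h5 := le_abs_self ⟪Y.fst - X₀.fst, N⟫_ℝ
    have h6 := mul_le_mul_of_nonneg_left h1 (show 0 ≤ c / 2 by positivity)
    have h7 := mul_pos hc (sub_pos.mpr ht.1)
    linarith
  choose! Y hY using hlim
  have hreg : ∀ t ∈ Ioo t₀ (t₀ + δ), ∃ V : Plane, ‖V‖ = 1 ∧ ∀ᶠ s in 𝓝 t,
      Tendsto (fun i => (P i s).fst) U (𝓝 V) ∧
        Tendsto (fun i => (X i s).fst) U (𝓝 ((Y t).fst + (s - t) • V)) := by
    intro t ht
    have habs : |t - t₀| < δ := by rw [abs_of_pos (sub_pos.mpr ht.1)]; linarith [ht.2]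
    obtain ⟨δ', hδ', V, hV1, -, hV⟩ := exists_regular_limit (t := t) (δ₀ := δ - |t - t₀|) hG hε0 hε
      (sub_pos.mpr habs) (by
        filter_upwards [hgeo] with i hi s hs
        refine hi s ?_
        have := abs_sub_le s t t₀
        linarith)
      (hcont t (habs.trans_le hd0)) (hY t ht).1 (hY t ht).2.1
    refine ⟨V, hV1, ?_⟩
    filter_upwards [Metric.ball_mem_nhds t hδ'] with s hs
    exact hV s (by rwa [Metric.mem_ball, Real.dist_eq] at hs)
  choose! V hV using hreg
  have hPV : ∀ t ∈ Ioo t₀ (t₀ + δ), Tendsto (fun i => (P i t).fst) U (𝓝 (V t)) :=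
    fun t ht => ((hV t ht).2.self_of_nhds).1
  have hXY : ∀ t ∈ Ioo t₀ (t₀ + δ), Tendsto (fun i => (X i t).fst) U (𝓝 (Y t).fst) :=
    fun t ht => (fstL.continuous.tendsto (Y t)).comp (hY t ht).1
  have hVloc : ∀ t ∈ Ioo t₀ (t₀ + δ), ∀ᶠ s in 𝓝 t, V s = V t ∧
      (Y s).fst = (Y t).fst + (s - t) • V t := by
    intro t ht
    filter_upwards [(hV t ht).2, isOpen_Ioo.mem_nhds ht] with s hs hs'
    exact ⟨tendsto_nhds_unique (hPV s hs') hs.1, tendsto_nhds_unique (hXY s hs') hs.2⟩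
  have hmid : t₀ + δ / 2 ∈ Ioo t₀ (t₀ + δ) := by constructor <;> linarith
  set W := V (t₀ + δ / 2) with hW
  have hVW : ∀ t ∈ Ioo t₀ (t₀ + δ), V t = W := fun t ht =>
    eq_of_locally_constant (fun t ht => (hVloc t ht).mono fun s hs => hs.1) ht hmid
  have hYW : ∀ t ∈ Ioo t₀ (t₀ + δ), (Y t).fst = X₀.fst + (t - t₀) • W := by
    set f : ℝ → Plane := fun t => (Y t).fst - X₀.fst - (t - t₀) • W with hf
    have hloc : ∀ t ∈ Ioo t₀ (t₀ + δ), ∀ᶠ s in 𝓝 t, f s = f t := fun t ht => by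
      filter_upwards [hVloc t ht] with s hs
      simp only [hf]
      rw [hs.2, hVW t ht, show s - t₀ = (s - t) + (t - t₀) by ring, add_smul]
      abel
    have hW1 : ‖W‖ = 1 := (hV _ hmid).1
    -- The function f is locally constant on the open interval; this bound makes it tend to 0 at t₀,
    -- so it vanishes.
    have hbound : ∀ t ∈ Ioo t₀ (t₀ + δ), ‖f t‖ ≤ 2 * (t - t₀) := fun t ht => by
      have h1 := norm_sub_le ((Y t).fst - X₀.fst) ((t - t₀) • W)
      rw [norm_smul, hW1, mul_one, Real.norm_of_nonneg (sub_pos.mpr ht.1).le] at h1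
      have h2 := (hY t ht).2.2.1
      simp only [hf]
      linarith
    intro t ht
    have hft : f t = 0 := by
      by_contra hne
      have hpos : 0 < ‖f t‖ := norm_pos_iff.mpr hne
      set s := t₀ + min (δ / 2) (‖f t‖ / 4) with hs
      have hmin : 0 < min (δ / 2) (‖f t‖ / 4) := by positivity
      have hsm : s ∈ Ioo t₀ (t₀ + δ) := by
        constructor <;> linarith [min_le_left (δ / 2) (‖f t‖ / 4)]
      have h1 := hbound s hsm
      rw [eq_of_locally_constant hloc hsm ht] at h1
      linarith [min_le_right (δ / 2) (‖f t‖ / 4)]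
    rw [← sub_eq_zero, ← hft]
    simp only [hf]
    abel
  have hWN : 0 < ⟪W, N⟫_ℝ := by
    have h1 := (hY _ hmid).2.2.2
    rw [hYW _ hmid, add_sub_cancel_left, add_sub_cancel_left, real_inner_smul_left] at h1
    have h2 : 0 < δ / 2 := by positivity
    have h3 := mul_pos hc h2
    exact pos_of_mul_pos_right (h3.trans_le h1) h2.le
  obtain ⟨τ, -, hτN, hτ⟩ := exists_unit_normal_vector h₀.hor
  have hWτ : ⟪W, τ⟫_ℝ = ⟪v, τ⟫_ℝ := by
    refine eq_of_forall_dist_le fun e he => ?_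
    rw [Real.dist_eq]
    obtain ⟨δ₅, hδ₅, h5⟩ := IsFold.tangential_limit hG hC hδ₂0 hfold hnear hin' hτN he
    set s := t₀ + min δ δ₅ / 2 with hs
    have hmin : 0 < min δ δ₅ := by positivity
    have hsm : s ∈ Ioo t₀ (t₀ + δ) := by constructor <;> linarith [min_le_left δ δ₅]
    have h6 := hPV s hsm
    rw [hVW s hsm] at h6
    refine le_of_tendsto ((h6.inner (𝕜 := ℝ) (tendsto_const_nhds (x := τ))).sub_const _).abs ?_
    filter_upwards [h5] with i hi
    refine hi s ?_
    rw [abs_lt]; constructor <;> linarith [min_le_right δ δ₅]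
  -- Both velocities have norm 1 and the same component along the wall. The sign is settled by ⟪v,
  -- N⟫ < 0 < ⟪W, N⟫.
  have hsq : ⟪W, N⟫_ℝ ^ 2 = ⟪v, N⟫_ℝ ^ 2 := by
    have h1 := hτ W
    have h2 := hτ v
    rw [(hV _ hmid).1, hWτ] at h1
    rw [hv] at h2
    have h3 : ⟪W, N⟫_ℝ ^ 2 / ‖N‖ ^ 2 = ⟪v, N⟫_ℝ ^ 2 / ‖N‖ ^ 2 := by linarith
    have h4 : ‖N‖ ^ 2 ≠ 0 := by positivity
    field_simp at h3
    exact h3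
  have hWv : ⟪W, N⟫_ℝ = -⟪v, N⟫_ℝ := by
    rcases sq_eq_sq_iff_eq_or_eq_neg.mp hsq with h | h
    · linarith
    · exact h
  have hWeq : W = v - (2 * ⟪v, N⟫_ℝ / ‖N‖ ^ 2) • N := by
    rw [← sub_eq_zero, ← norm_eq_zero, ← sq_eq_zero_iff, hτ]
    have h1 : ⟪W - (v - (2 * ⟪v, N⟫_ℝ / ‖N‖ ^ 2) • N), N⟫_ℝ = 0 := by
      rw [inner_sub_left, inner_sub_left, real_inner_smul_left, real_inner_self_eq_norm_sq, hWv,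
        div_mul_cancel₀ _ (by positivity)]
      ring
    have h2 : ⟪W - (v - (2 * ⟪v, N⟫_ℝ / ‖N‖ ^ 2) • N), τ⟫_ℝ = 0 := by
      rw [inner_sub_left, inner_sub_left, real_inner_smul_left, hWτ, hτN]
      ring
    rw [← hN, h1, h2]
    norm_num
  rw [← hWeq]
  refine ⟨δ, hδ0, fun t ht1 ht2 => ?_⟩
  have ht : t ∈ Ioo t₀ (t₀ + δ) := ⟨ht1, ht2⟩
  refine ⟨?_, ?_⟩
  · rw [← hVW t ht]; exact hPV t ht
  · rw [← hYW t ht]; exact hXY t ht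

end

section

/-! ### Local equations of an immersed surface -/

theorem finrank_space : Module.finrank ℝ Space = 3 := by
  rw [(WithLp.linearEquiv 2 ℝ (Plane × ℝ)).finrank_eq, Module.finrank_prod]
  simp

/-- A parametrized surface can be straightened locally. -/
theorem exists_straightening {f : Plane → Space} {E : Set Plane} (hE : IsOpen E)
    (hf : ContDiffOn ℝ ∞ f E) {u₀ : Plane} (hu₀ : u₀ ∈ E)
    (hinj : Function.Injective (fderiv ℝ f u₀)) :
    ∃ (n : Space) (Φ : OpenPartialHomeomorph (Plane × ℝ) Space), (u₀, (0 : ℝ)) ∈ Φ.source ∧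
      (∀ x ∈ Φ.source, x.1 ∈ E) ∧ (∀ x, Φ x = f x.1 + x.2 • n) ∧
      ContDiffOn ℝ ∞ Φ.symm Φ.target := by
  obtain ⟨n, hn⟩ : ∃ n : Space, n ∉ LinearMap.range (fderiv ℝ f u₀).toLinearMap := by
    by_contra! h
    have h1 : LinearMap.range (fderiv ℝ f u₀).toLinearMap = ⊤ := by
      rw [eq_top_iff]; exact fun x _ => h x
    have h2 := LinearMap.finrank_range_le (fderiv ℝ f u₀).toLinearMap
    rw [h1, finrank_top, finrank_space] at h2
    simp at h2
  set H : Plane × ℝ → Space := fun x => f x.1 + x.2 • n with hH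
  have hHs : ∀ x : Plane × ℝ, x.1 ∈ E → ContDiffAt ℝ ∞ H x := fun x hx => by
    have h1 : ContDiffAt ℝ ∞ f x.1 := hf.contDiffAt (hE.mem_nhds hx)
    exact (h1.comp x contDiffAt_fst).add (contDiffAt_snd.smul contDiffAt_const)
  have hHd : HasFDerivAt H ((fderiv ℝ f u₀).comp (ContinuousLinearMap.fst ℝ Plane ℝ) +
      (ContinuousLinearMap.snd ℝ Plane ℝ).smulRight n) (u₀, (0 : ℝ)) := by
    have h1 : HasFDerivAt f (fderiv ℝ f u₀) u₀ :=
      ((hf.contDiffAt (hE.mem_nhds hu₀)).differentiableAt (by simp)).hasFDerivAt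
    have h2 : HasFDerivAt (fun x : Plane × ℝ => f x.1)
        ((fderiv ℝ f u₀).comp (ContinuousLinearMap.fst ℝ Plane ℝ)) (u₀, (0 : ℝ)) :=
      HasFDerivAt.comp (u₀, (0 : ℝ)) h1 hasFDerivAt_fst
    have h3 : HasFDerivAt (fun x : Plane × ℝ => x.2 • n)
        ((ContinuousLinearMap.snd ℝ Plane ℝ).smulRight n) (u₀, (0 : ℝ)) :=
      ((ContinuousLinearMap.snd ℝ Plane ℝ).smulRight n).hasFDerivAt
    exact h2.add h3
  set L := (fderiv ℝ f u₀).comp (ContinuousLinearMap.fst ℝ Plane ℝ) +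
      (ContinuousLinearMap.snd ℝ Plane ℝ).smulRight n with hL
  have hLinj : Function.Injective L.toLinearMap := by
    rw [← LinearMap.ker_eq_bot, LinearMap.ker_eq_bot']
    rintro ⟨a, b⟩ hab
    have h1 : fderiv ℝ f u₀ a + b • n = 0 := hab
    have hb : b = 0 := by
      by_contra hb
      refine hn ⟨-b⁻¹ • a, ?_⟩
      have h2 : fderiv ℝ f u₀ a = -(b • n) := eq_neg_of_add_eq_zero_left h1
      change fderiv ℝ f u₀ (-b⁻¹ • a) = n
      rw [map_smul, h2, neg_smul, smul_neg, neg_neg, smul_smul, inv_mul_cancel₀ hb, one_smul]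
    rw [hb, zero_smul, add_zero] at h1
    have ha : a = 0 := hinj (by rw [h1, map_zero])
    rw [ha, hb]; rfl
  have hfr : Module.finrank ℝ (Plane × ℝ) = Module.finrank ℝ Space := by
    rw [finrank_space, Module.finrank_prod]; simp
  set e : (Plane × ℝ) ≃L[ℝ] Space :=
    (LinearEquiv.ofInjectiveOfFinrankEq L.toLinearMap hLinj hfr).toContinuousLinearEquiv with he
  have heL : (e : Plane × ℝ →L[ℝ] Space) = L := by
    ext x <;> rfl
  rw [← heL] at hHd
  set Φ := (hHs (u₀, 0) hu₀).toOpenPartialHomeomorph H hHd (by simp) with hΦ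
  have hΦc : (Φ : Plane × ℝ → Space) = H := rfl
  have hcont : ContinuousAt (fderiv ℝ H) (u₀, (0 : ℝ)) :=
    ((hHs (u₀, 0) hu₀).fderiv_right (m := 0) (by simp)).continuousAt
  have hinv : ∀ᶠ x in 𝓝 (u₀, (0 : ℝ)),
      fderiv ℝ H x ∈ range ((↑) : ((Plane × ℝ) ≃L[ℝ] Space) → _) := by
    refine hcont.eventually ?_
    rw [hHd.fderiv]
    exact ContinuousLinearEquiv.nhds e
  have hE' : ∀ᶠ x : Plane × ℝ in 𝓝 (u₀, (0 : ℝ)), x.1 ∈ E :=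
    continuousAt_fst.eventually (hE.mem_nhds hu₀)
  -- The inverse function theorem gives smoothness of the inverse only at the image of the base
  -- point. On B the derivative is invertible everywhere, so the inverse is smooth on the whole
  -- target.
  obtain ⟨B, hB, hBo, hBm⟩ := eventually_nhds_iff.mp (hinv.and hE')
  refine ⟨n, Φ.restrOpen B hBo, ?_, ?_, fun x => rfl, ?_⟩
  · exact ⟨ContDiffAt.mem_toOpenPartialHomeomorph_source _ _ _, hBm⟩
  · exact fun x hx => (hB x hx.2).2
  · intro y hy
    refine ContDiffAt.contDiffWithinAt ?_
    have hsrc := (Φ.restrOpen B hBo).map_target hy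
    obtain ⟨⟨e', he'⟩, hE''⟩ := hB _ hsrc.2
    refine (Φ.restrOpen B hBo).contDiffAt_symm hy (f₀' := e') ?_ (hHs _ hE'')
    rw [he']
    exact ((hHs _ hE'').differentiableAt (by simp)).hasFDerivAt

variable {M : Type*} [TopologicalSpace M] [ChartedSpace Plane M]
variable {Λ : AddSubgroup Plane}

/-- Near `q` the surface is, by a smooth lift to `ℝ³`, the regular level set `G = 0`, and `r` is a
smooth retraction of a neighbourhood onto the surface. -/
structure ImmersedSurface.Slice (S : ImmersedSurface M Λ) (q : M) (W : Set M) (O : Set Space)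
    (G : Space → ℝ) (r : Space → M) (n : Space) : Prop where
  isOpen_W : IsOpen W
  mem_W : q ∈ W
  isOpen_O : IsOpen O
  smooth_G : ContDiff ℝ ∞ G
  smooth_lift : ContMDiffOn (𝓡 2) 𝓘(ℝ, Space) ∞ (S.lift q) W
  cover_lift : ∀ q' ∈ W, cover Λ (S.lift q q') = S.toFun q'
  lift_mem : ∀ q' ∈ W, S.lift q q' ∈ O
  G_lift : ∀ q' ∈ W, G (S.lift q q') = 0
  r_lift : ∀ q' ∈ W, r (S.lift q q') = q'
  smooth_r : ContMDiffOn 𝓘(ℝ, Space) (𝓡 2) ∞ r O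
  r_mem : ∀ X ∈ O, G X = 0 → r X ∈ W
  lift_r : ∀ X ∈ O, S.lift q (r X) = X - G X • n

/-- Straightening the lift by a transversal vector n gives coordinates (u, s) of ℝ³ near the
surface: s is the equation and u, read in the chart, is the retraction. Geodesics can then be
studied in a fixed Euclidean space. -/
theorem ImmersedSurface.exists_slice [IsManifold (𝓡 2) ∞ M] (S : ImmersedSurface M Λ) (q : M) :
    ∃ W O G r n, S.Slice q W O G r n := by
  obtain ⟨U, hU, hqU, hFs, hFc⟩ := (S.exists_lift q).choose_spec
  change ContMDiffOn (𝓡 2) 𝓘(ℝ, Space) ∞ (S.lift q) U at hFs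
  change ∀ q' ∈ U, cover Λ (S.lift q q') = S.toFun q' at hFc
  set F := S.lift q with hF
  set φ := chartAt Plane q with hφ
  set f : Plane → Space := F ∘ φ.symm with hf
  set E := φ.target ∩ φ.symm ⁻¹' U with hE
  have hEo : IsOpen E := φ.symm.isOpen_inter_preimage hU
  have hsymm : ContMDiffOn (𝓡 2) (𝓡 2) ∞ φ.symm φ.target := contMDiffOn_chart_symm
  have hfs : ContDiffOn ℝ ∞ f E := by
    rw [← contMDiffOn_iff_contDiffOn]
    exact hFs.comp (hsymm.mono inter_subset_left) fun x hx => hx.2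
  have hqs : q ∈ φ.source := mem_chart_source Plane q
  have hu₀ : φ q ∈ E := ⟨φ.map_source hqs, by simpa [φ.left_inv hqs] using hqU⟩
  have hinj : Function.Injective (fderiv ℝ f (φ q)) := by
    have h1 := S.immersion q F (S.exists_lift q).choose_spec
    have h2 : MDifferentiableAt (𝓡 2) 𝓘(ℝ, Space) F q :=
      (hFs.contMDiffAt (hU.mem_nhds hqU)).mdifferentiableAt (by simp)
    have h3 : fderivWithin ℝ (writtenInExtChartAt (𝓡 2) 𝓘(ℝ, Space) q F) (range (𝓡 2))
        (extChartAt (𝓡 2) q q) = fderiv ℝ f (φ q) := by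
      simp only [mfld_simps, fderivWithin_univ]
      rfl
    have h4 := h2.mfderiv.trans h3
    rw [h4] at h1
    exact h1
  obtain ⟨n, Φ, hΦ0, hΦE, hΦ, hΦs⟩ := exists_straightening hEo hfs hu₀ hinj
  have hFq : Φ (φ q, 0) = F q := by
    rw [hΦ, zero_smul, add_zero]
    change F (φ.symm (φ q)) = F q
    rw [φ.left_inv hqs]
  have hFqt : F q ∈ Φ.target := hFq ▸ Φ.map_source hΦ0
  obtain ⟨ρ, hρ, hball⟩ := Metric.isOpen_iff.mp Φ.open_target _ hFqt
  -- The bump function extends the coordinate s to a smooth function on all of ℝ³ without changing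
  -- it on O.
  set b : ContDiffBump (F q) := ⟨ρ / 3, ρ / 2, by positivity, by linarith⟩ with hb
  set O := Metric.ball (F q) (ρ / 3) with hO
  have hOt : O ⊆ Φ.target := (Metric.ball_subset_ball (by linarith)).trans hball
  set G : Space → ℝ := fun X => b X * (Φ.symm X).2 with hG
  have hGO : ∀ X ∈ O, G X = (Φ.symm X).2 := fun X hX => by
    have : b X = 1 := b.one_of_mem_closedBall (Metric.ball_subset_closedBall hX)
    simp only [hG, this, one_mul]
  set r : Space → M := fun X => φ.symm (Φ.symm X).1 with hr
  set W := {q' ∈ U ∩ φ.source | F q' ∈ O ∧ (φ q', (0 : ℝ)) ∈ Φ.source} with hW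
  have hinv : ∀ q' ∈ W, Φ.symm (F q') = (φ q', 0) := fun q' hq' => by
    have : Φ (φ q', 0) = F q' := by
      rw [hΦ, zero_smul, add_zero]
      change F (φ.symm (φ q')) = F q'
      rw [φ.left_inv hq'.1.2]
    rw [← this, Φ.left_inv hq'.2.2]
  have hrE : ∀ X ∈ Φ.target, (Φ.symm X).1 ∈ E := fun X hX => hΦE _ (Φ.map_target hX)
  have hlr : ∀ X ∈ O, F (r X) = X - G X • n := fun X hX => by
    have h1 := Φ.right_inv (hOt hX)
    rw [hΦ] at h1
    rw [hGO X hX, eq_sub_iff_add_eq]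
    exact h1
  refine ⟨W, O, G, r, n, ?_, ?_, Metric.isOpen_ball, ?_, ?_, fun q' h => hFc q' h.1.1,
    fun q' h => h.2.1, fun q' h => ?_, fun q' h => ?_, ?_, fun X hX hGX => ?_, hlr⟩
  · have h1 : ContinuousOn F (U ∩ φ.source) := hFs.continuousOn.mono inter_subset_left
    have h2 : ContinuousOn (fun q' => (φ q', (0 : ℝ))) (U ∩ φ.source) :=
      (φ.continuousOn.mono inter_subset_right).prodMk continuousOn_const
    have h3 := (h1.prodMk h2).isOpen_inter_preimage (hU.inter φ.open_source)
      (Metric.isOpen_ball.prod Φ.open_source : IsOpen (O ×ˢ Φ.source))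
    exact h3
  · exact ⟨⟨hqU, hqs⟩, Metric.mem_ball_self (by positivity), hΦ0⟩
  · rw [contDiff_iff_contDiffAt]
    intro X
    by_cases hX : X ∈ Metric.ball (F q) ρ
    · have h1 : ContDiffAt ℝ ∞ Φ.symm X := hΦs.contDiffAt (Φ.open_target.mem_nhds (hball hX))
      exact b.contDiffAt.mul (contDiffAt_snd.comp X h1)
    · have h1 : X ∈ (Metric.closedBall (F q) (ρ / 2))ᶜ := fun h =>
        hX (Metric.closedBall_subset_ball (by linarith) h)
      refine contDiffAt_const (c := (0 : ℝ)) |>.congr_of_eventuallyEq ?_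
      filter_upwards [Metric.isClosed_closedBall.isOpen_compl.mem_nhds h1] with Y hY
      have : b Y = 0 := b.zero_of_le_dist (by
        simp only [mem_compl_iff, Metric.mem_closedBall, not_le] at hY; exact hY.le)
      simp only [hG, this, zero_mul]
  · exact hFs.mono fun q' h => h.1.1
  · change G (F q') = 0
    rw [hGO _ h.2.1, hinv q' h]
  · change φ.symm (Φ.symm (F q')).1 = q'
    rw [hinv q' h, φ.left_inv h.1.2]
  · have h1 : ContMDiffOn 𝓘(ℝ, Space) (𝓡 2) ∞ (fun X => (Φ.symm X).1) O := by
      have : ContDiffOn ℝ ∞ (fun X => (Φ.symm X).1) O := contDiff_fst.comp_contDiffOn (hΦs.mono hOt)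
      exact contMDiffOn_iff_contDiffOn.mpr this
    exact hsymm.comp h1 fun X hX => (hrE X (hOt hX)).1
  · have hXE := hrE X (hOt hX)
    have h1 : φ (r X) = (Φ.symm X).1 := φ.right_inv hXE.1
    refine ⟨⟨hXE.2, φ.map_target hXE.1⟩, ?_, ?_⟩
    · rw [hlr X hX, hGX, zero_smul, sub_zero]; exact hX
    · rw [h1]
      have h2 : (Φ.symm X).2 = 0 := by rw [← hGO X hX, hGX]
      rw [← h2]
      exact Φ.map_target (hOt hX)

end

section

/-! ### Geodesics in local coordinates -/

/-- The flattening as a continuous linear map. -/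
def flattenL (ε : ℝ) : Space →L[ℝ] Space :=
  LinearMap.toContinuousLinearMap
    { toFun := flatten ε
      map_add' := fun x y => by apply Space.ext <;> simp [mul_add]
      map_smul' := fun c x => by apply Space.ext <;> simp; ring }

@[simp] theorem flattenL_apply (ε : ℝ) (x : Space) : flattenL ε x = flatten ε x := rfl

theorem norm_flatten_sq (ε : ℝ) (x : Space) :
    ‖flatten ε x‖ ^ 2 = ‖x.fst‖ ^ 2 + ε ^ 2 * x.snd ^ 2 := by
  rw [Space.norm_sq, flatten_fst, flatten_snd, mul_pow]

theorem iteratedDeriv_two_eq {f f' : ℝ → Space} {a : Space} {t : ℝ}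
    (h : ∀ᶠ s in 𝓝 t, HasDerivAt f (f' s) s) (h' : HasDerivAt f' a t) :
    iteratedDeriv 2 f t = a := by
  rw [iteratedDeriv_succ, iteratedDeriv_one]
  have : deriv f =ᶠ[𝓝 t] f' := h.mono fun s hs => hs.deriv
  rw [this.deriv_eq, h'.deriv]

variable {M : Type*} [TopologicalSpace M] [ChartedSpace Plane M] [IsManifold (𝓡 2) ∞ M]
variable {Λ : AddSubgroup Plane}

namespace ImmersedSurface

variable (S : ImmersedSurface M Λ)

/-- The velocity of a curve on the surface, as a vector of `ℝ³`. -/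
def vel (γ : ℝ → M) (t : ℝ) : Space := S.diff (γ t) (velocity γ t).snd

/-- `γ` satisfies the geodesic equation at the time `t`. -/
def IsGeodesicAt (ε : ℝ) (γ : ℝ → M) (t : ℝ) : Prop :=
  ContMDiffAt 𝓘(ℝ, ℝ) (𝓡 2) 2 γ t ∧
    ∀ w : TangentSpace (𝓡 2) (γ t),
      ⟪iteratedDeriv 2 (fun s => flatten ε (S.lift (γ t) (γ s))) t,
        flatten ε (S.diff (γ t) w)⟫_ℝ = 0

theorem isGeodesic_iff (ε : ℝ) (γ : ℝ → M) :
    S.IsGeodesic ε γ ↔ ∀ t, S.IsGeodesicAt ε γ t :=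
  ⟨fun h t => ⟨h.1 t, h.2 t⟩, fun h => ⟨fun t => (h t).1, fun t => (h t).2⟩⟩

theorem IsGeodesicAt.congr {ε : ℝ} {γ γ' : ℝ → M} {t : ℝ} (h : S.IsGeodesicAt ε γ t)
    (hγ : γ' =ᶠ[𝓝 t] γ) : S.IsGeodesicAt ε γ' t := by
  have h0 : γ' t = γ t := hγ.self_of_nhds
  refine ⟨h.1.congr_of_eventuallyEq hγ, ?_⟩
  rw [h0]
  intro w
  rw [← h.2 w]
  congr 1
  exact Filter.EventuallyEq.iteratedDeriv_eq 2 (hγ.mono fun s hs => by simp only [hs])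

variable {S} {q : M} {W : Set M} {O : Set Space} {G : Space → ℝ} {r : Space → M} {n : Space}

namespace Slice

theorem isLocalLift (h : S.Slice q W O G r n) {q' : M} (hq' : q' ∈ W) :
    IsLocalLift Λ S.toFun q' (S.lift q) :=
  ⟨W, h.isOpen_W, hq', h.smooth_lift, h.cover_lift⟩

theorem mdifferentiableAt_lift (h : S.Slice q W O G r n) {q' : M} (hq' : q' ∈ W) :
    MDifferentiableAt (𝓡 2) 𝓘(ℝ, Space) (S.lift q) q' :=
  (h.smooth_lift.contMDiffAt (h.isOpen_W.mem_nhds hq')).mdifferentiableAt (by simp)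

/-- The differential and the geodesic equation use the lift chosen at each point; this constant
difference allows a single lift, that of q, to be used throughout W. -/
theorem eventually_lift_eq [DiscreteTopology Λ] (h : S.Slice q W O G r n) {q' : M} (hq' : q' ∈ W) :
    ∀ᶠ x in 𝓝 q', S.lift q' x = S.lift q x + (S.lift q' q' - S.lift q q') := by
  filter_upwards [(S.exists_lift q').choose_spec.eventually_sub_eq (h.isLocalLift hq')] with x hx
  change S.lift q' x - S.lift q x = S.lift q' q' - S.lift q q' at hx
  rw [← hx]; abel

theorem diff_eq [DiscreteTopology Λ] (h : S.Slice q W O G r n) {q' : M} (hq' : q' ∈ W) :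
    S.diff q' = mfderiv (𝓡 2) 𝓘(ℝ, Space) (S.lift q) q' := by
  have h1 := (h.mdifferentiableAt_lift hq').hasMFDerivAt
  have h2 : HasMFDerivAt 𝓘(ℝ, Space) 𝓘(ℝ, Space)
      (fun x : Space => x + (S.lift q' q' - S.lift q q')) (S.lift q q')
      (ContinuousLinearMap.id ℝ Space) :=
    ((hasFDerivAt_id (𝕜 := ℝ) (S.lift q q')).add_const _).hasMFDerivAt
  have h3 := (h2.comp q' h1).congr_of_eventuallyEq (f₁ := S.lift q')
    (h.eventually_lift_eq hq')
  exact h3.mfderiv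

theorem hasDerivAt_lift_comp [DiscreteTopology Λ] (h : S.Slice q W O G r n) {γ : ℝ → M} {t : ℝ}
    (ht : γ t ∈ W) (hγ : MDifferentiableAt 𝓘(ℝ, ℝ) (𝓡 2) γ t) :
    HasDerivAt (fun s => S.lift q (γ s)) (S.vel γ t) t := by
  have h1 := (h.mdifferentiableAt_lift ht).hasMFDerivAt.comp t hγ.hasMFDerivAt
  obtain ⟨L, hL, hL1⟩ : ∃ L : ℝ →L[ℝ] Space, HasFDerivAt (S.lift q ∘ γ) L t ∧ L 1 = S.vel γ t :=
    ⟨_, hasMFDerivAt_iff_hasFDerivAt.mp h1, by rw [vel, h.diff_eq ht]; rfl⟩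
  exact hL.hasDerivAt.congr_deriv hL1

/-- One inclusion differentiates G ∘ lift = 0. The other differentiates lift ∘ r = id - G n, which
shows that a vector in the kernel of dG is the image under the lift of its image under dr. -/
theorem mem_tangentPlane [DiscreteTopology Λ] (h : S.Slice q W O G r n) {q' : M} (hq' : q' ∈ W)
    (P : Space) : P ∈ S.tangentPlane q' ↔ ⟪gradient G (S.lift q q'), P⟫_ℝ = 0 := by
  have hF := (h.mdifferentiableAt_lift hq').hasMFDerivAt
  have hG : HasFDerivAt G (fderiv ℝ G (S.lift q q')) (S.lift q q') :=
    (h.smooth_G.differentiable (by simp) _).hasFDerivAt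
  rw [← fderiv_eq_inner_gradient]
  constructor
  · rintro ⟨w, rfl⟩
    have h1 := hG.hasMFDerivAt.comp q' hF
    have h2 : HasMFDerivAt (𝓡 2) 𝓘(ℝ, ℝ) (G ∘ S.lift q) q' 0 :=
      (hasMFDerivAt_const (0 : ℝ) q').congr_of_eventuallyEq (by
        filter_upwards [h.isOpen_W.mem_nhds hq'] with x hx using h.G_lift x hx)
    have h3 := hasMFDerivAt_unique h1 h2
    change fderiv ℝ G (S.lift q q') (S.diff q' w) = 0
    rw [h.diff_eq hq']
    exact congrArg (fun L : Plane →L[ℝ] ℝ => L w) h3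
  · intro hP
    have hO := h.lift_mem q' hq'
    have hr : MDifferentiableAt 𝓘(ℝ, Space) (𝓡 2) r (S.lift q q') :=
      (h.smooth_r.contMDiffAt (h.isOpen_O.mem_nhds hO)).mdifferentiableAt (by simp)
    have hF' : HasMFDerivAt (𝓡 2) 𝓘(ℝ, Space) (S.lift q) (r (S.lift q q'))
        (mfderiv (𝓡 2) 𝓘(ℝ, Space) (S.lift q) (r (S.lift q q'))) :=
      (h.mdifferentiableAt_lift (by rwa [h.r_lift q' hq'])).hasMFDerivAt
    have h1 := hF'.comp _ hr.hasMFDerivAt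
    have h2 : HasFDerivAt (fun X => X - G X • n) (ContinuousLinearMap.id ℝ Space -
        (fderiv ℝ G (S.lift q q')).smulRight n) (S.lift q q') :=
      (hasFDerivAt_id _).sub (hG.smul_const n)
    have h3 := h2.hasMFDerivAt.congr_of_eventuallyEq (f₁ := S.lift q ∘ r) (by
      filter_upwards [h.isOpen_O.mem_nhds hO] with X hX using h.lift_r X hX)
    have h4 := hasMFDerivAt_unique h1 h3
    have h5 := congrArg (fun L : Space →L[ℝ] Space => L P) h4
    have h6 : ∃ w : Plane, mfderiv (𝓡 2) 𝓘(ℝ, Space) (S.lift q) (r (S.lift q q')) w = P := by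
      refine ⟨mfderiv 𝓘(ℝ, Space) (𝓡 2) r (S.lift q q') P, h5.trans ?_⟩
      change P - fderiv ℝ G (S.lift q q') P • n = P
      rw [hP, zero_smul, sub_zero]
    rw [h.r_lift q' hq'] at h6
    obtain ⟨w, hw⟩ := h6
    refine ⟨w, ?_⟩
    change S.diff q' w = P
    rw [h.diff_eq hq']
    exact hw

theorem vel_mem_tangentPlane (γ : ℝ → M) (t : ℝ) : S.vel γ t ∈ S.tangentPlane (γ t) :=
  ⟨_, rfl⟩

theorem gradient_ne_zero [DiscreteTopology Λ] (h : S.Slice q W O G r n) {q' : M} (hq' : q' ∈ W) :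
    gradient G (S.lift q q') ≠ 0 := fun h0 => by
  have h1 : S.tangentPlane q' = ⊤ := by
    rw [eq_top_iff]
    intro P _
    rw [h.mem_tangentPlane hq', h0, inner_zero_left]
  have : Module.Finite ℝ (TangentSpace (𝓡 2) q') := inferInstanceAs (Module.Finite ℝ Plane)
  have h2 := LinearMap.finrank_range_le (S.diff q').toLinearMap
  have h3 : Module.finrank ℝ (TangentSpace (𝓡 2) q') = 2 := by
    change Module.finrank ℝ Plane = 2
    simp
  change Module.finrank ℝ (S.tangentPlane q') ≤ _ at h2
  rw [h1, finrank_top, finrank_space, h3] at h2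
  norm_num at h2

/-- The velocity of a `C²` curve on the surface is differentiable. -/
theorem exists_hasDerivAt_vel [DiscreteTopology Λ] (h : S.Slice q W O G r n) {γ : ℝ → M} {t : ℝ}
    (ht : γ t ∈ W) (hγ : ContMDiffAt 𝓘(ℝ, ℝ) (𝓡 2) 2 γ t) :
    (∀ᶠ s in 𝓝 t, γ s ∈ W ∧ HasDerivAt (fun s => S.lift q (γ s)) (S.vel γ s) s) ∧
      ∃ a, HasDerivAt (S.vel γ) a t := by
  have : IsManifold (𝓡 2) 2 M := IsManifold.of_le (n := ∞) (by norm_cast)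
  have hW : ∀ᶠ s in 𝓝 t, γ s ∈ W := hγ.continuousAt.eventually (h.isOpen_W.mem_nhds ht)
  have hd : ∀ᶠ s in 𝓝 t, HasDerivAt (fun s => S.lift q (γ s)) (S.vel γ s) s := by
    filter_upwards [hW, contMDiffAt_iff_contMDiffAt_nhds (by simp) |>.mp hγ] with s hs hs'
    exact h.hasDerivAt_lift_comp hs (hs'.mdifferentiableAt (by simp))
  refine ⟨hW.and hd, ?_⟩
  have h1 : ContMDiffAt 𝓘(ℝ, ℝ) 𝓘(ℝ, Space) 2 (fun s => S.lift q (γ s)) t :=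
    ((h.smooth_lift.contMDiffAt (h.isOpen_W.mem_nhds ht)).of_le (by norm_cast)).comp t hγ
  have h1' : ContDiffAt ℝ 2 (fun s => S.lift q (γ s)) t := contMDiffAt_iff_contDiffAt.mp h1
  have h2 : DifferentiableAt ℝ (deriv fun s => S.lift q (γ s)) t := by
    have h3 := ((h1'.fderiv_right (m := 1) (by norm_num)).clm_apply
      (contDiffAt_const (c := (1 : ℝ)))).differentiableAt (by simp)
    exact h3
  exact ⟨_, h2.hasDerivAt.congr_of_eventuallyEq (hd.mono fun s hs => hs.deriv.symm)⟩

/-- The acceleration of a geodesic is normal to the flattened surface. -/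
theorem exists_mult [DiscreteTopology Λ] (h : S.Slice q W O G r n) {γ : ℝ → M} {t ε : ℝ}
    (hε : ε ≠ 0) (ht : γ t ∈ W) (hγ : S.IsGeodesicAt ε γ t) :
    ∃ m : ℝ, HasDerivAt (S.vel γ) (m • raise ε (gradient G (S.lift q (γ t)))) t := by
  obtain ⟨hd, a, ha⟩ := h.exists_hasDerivAt_vel ht hγ.1
  set A := gradient G (S.lift q (γ t)) with hA
  have hA0 : A ≠ 0 := h.gradient_ne_zero ht
  have h1 : iteratedDeriv 2 (fun s => flatten ε (S.lift (γ t) (γ s))) t = flatten ε a := by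
    have e1 : (fun s => flatten ε (S.lift (γ t) (γ s))) =ᶠ[𝓝 t]
        fun s => flattenL ε (S.lift q (γ s) + (S.lift (γ t) (γ t) - S.lift q (γ t))) := by
      filter_upwards [hγ.1.continuousAt.eventually (h.eventually_lift_eq ht)] with s hs
      rw [flattenL_apply, hs]
    rw [Filter.EventuallyEq.iteratedDeriv_eq 2 e1]
    refine iteratedDeriv_two_eq (f' := fun s => flattenL ε (S.vel γ s)) ?_ ?_
    · filter_upwards [hd] with s hs
      exact (flattenL ε).hasFDerivAt.comp_hasDerivAt s (hs.2.add_const _)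
    · exact (flattenL ε).hasFDerivAt.comp_hasDerivAt t ha
  -- The flattening is symmetric, so moving it across the inner product turns the geodesic equation
  -- into Euclidean orthogonality of f_ε² a to the tangent plane. Hence f_ε² a is a multiple of the
  -- gradient, and `raise` undoes f_ε².
  have h2 : ∀ P : Space, ⟪A, P⟫_ℝ = 0 → ⟪flatten ε (flatten ε a), P⟫_ℝ = 0 := fun P hP => by
    obtain ⟨w, hw⟩ := (h.mem_tangentPlane ht P).mpr hP
    have h3 := hγ.2 w
    have hw' : S.diff (γ t) w = P := hw
    rw [h1, hw', Space.inner_eq] at h3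
    rw [Space.inner_eq]
    simp only [flatten_fst, flatten_snd] at h3 ⊢
    linarith
  set b := flatten ε (flatten ε a) with hb
  set m := ⟪b, A⟫_ℝ / ‖A‖ ^ 2 with hm
  have hAn : ‖A‖ ^ 2 ≠ 0 := by simpa using hA0
  have h3 : ⟪A, b - m • A⟫_ℝ = 0 := by
    rw [inner_sub_right, real_inner_smul_right, real_inner_self_eq_norm_sq, hm,
      div_mul_cancel₀ _ hAn, real_inner_comm, sub_self]
  have h4 : b = m • A := by
    rw [← sub_eq_zero, ← inner_self_eq_zero (𝕜 := ℝ), inner_sub_left, h2 _ h3,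
      real_inner_smul_left, h3, mul_zero, sub_zero]
  refine ⟨m, ?_⟩
  have h5 : a = m • raise ε A := by
    have e1 : b.fst = (m • A).fst := by rw [h4]
    have e2 : b.snd = (m • A).snd := by rw [h4]
    simp only [hb, flatten_fst, flatten_snd, WithLp.smul_fst, WithLp.smul_snd, smul_eq_mul] at e1 e2
    apply Space.ext
    · exact e1
    · simp only [WithLp.smul_snd, raise_snd, smul_eq_mul]
      rw [← mul_div_assoc, ← e2]
      field_simp
  rwa [← h5]

/-- A unit speed geodesic of the surface is a geodesic in local coordinates. -/
theorem flatGeodesicAt [DiscreteTopology Λ] (h : S.Slice q W O G r n) {γ : ℝ → M} {t ε : ℝ}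
    (hε : ε ≠ 0) (ht : γ t ∈ W) (hγ : S.IsGeodesicAt ε γ t)
    (hunit : ‖flatten ε (S.vel γ t)‖ = 1) :
    FlatGeodesicAt G ε (fun s => S.lift q (γ s)) (S.vel γ) t := by
  obtain ⟨hd, -⟩ := h.exists_hasDerivAt_vel ht hγ.1
  obtain ⟨m, hm⟩ := h.exists_mult hε ht hγ
  refine ⟨hd.self_of_nhds.2, h.G_lift _ ht,
    (h.mem_tangentPlane ht _).mp (vel_mem_tangentPlane γ t), ?_, m, hm, ?_⟩
  · rw [← norm_flatten_sq, hunit, one_pow]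
  -- Differentiating the tangency condition along the curve determines the multiplier.
  · have h1 : HasDerivAt (fun s => ⟪gradient G (S.lift q (γ s)), S.vel γ s⟫_ℝ) 0 t :=
      (hasDerivAt_const t (0 : ℝ)).congr_of_eventuallyEq (hd.mono fun s hs =>
        (h.mem_tangentPlane hs.1 _).mp (vel_mem_tangentPlane γ s))
    have h2 := ((hasFDerivAt_gradient h.smooth_G _).comp_hasDerivAt t hd.self_of_nhds.2).inner ℝ hm
    have h3 := h2.unique h1
    simp only [Function.comp] at h3
    rw [real_inner_smul_right, Space.inner_eq (gradient G _) (raise _ _), raise_fst, raise_snd,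
      real_inner_self_eq_norm_sq] at h3
    rw [← eq_neg_iff_add_eq_zero] at h3
    refine Eq.trans ?_ h3
    ring

/-- The kinetic energy of a geodesic is constant. -/
theorem hasDerivAt_energy [DiscreteTopology Λ] (h : S.Slice q W O G r n) {γ : ℝ → M} {t ε : ℝ}
    (hε : ε ≠ 0) (ht : γ t ∈ W) (hγ : S.IsGeodesicAt ε γ t) :
    HasDerivAt (fun s => ‖flatten ε (S.vel γ s)‖ ^ 2) 0 t := by
  obtain ⟨m, hm⟩ := h.exists_mult hε ht hγ
  have h1 := ((flattenL ε).hasFDerivAt.comp_hasDerivAt t hm).norm_sq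
  refine h1.congr_deriv ?_
  have h2 := (h.mem_tangentPlane ht _).mp (vel_mem_tangentPlane γ t)
  rw [Space.inner_eq] at h2
  rw [map_smul, real_inner_smul_right, Space.inner_eq]
  simp only [Function.comp, flattenL_apply, flatten_fst, flatten_snd, raise_fst, raise_snd]
  have h3 : ε * (S.vel γ t).snd * (ε * ((gradient G (S.lift q (γ t))).snd / ε ^ 2)) =
      (gradient G (S.lift q (γ t))).snd * (S.vel γ t).snd := by
    field_simp
  rw [h3, real_inner_comm, h2]
  ring

end Slice

end ImmersedSurface

end

/-! ### The geodesic equation as a first order equation -/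

/-- A `C¹` vector field has local solutions, for a uniform time and without leaving a given
neighbourhood. -/
theorem exists_local_flow {E : Type*} [NormedAddCommGroup E] [NormedSpace ℝ E] [CompleteSpace E]
    {f : E → E} {x₀ : E} (hf : ContDiffAt ℝ 1 f x₀) {N : Set E} (hN : N ∈ 𝓝 x₀) :
    ∃ r > 0, ∃ δ > 0, ∀ x ∈ Metric.closedBall x₀ r, ∃ α : ℝ → E, α 0 = x ∧
      ∀ t ∈ Ioo (-δ) δ, HasDerivAt α (f (α t)) t ∧ α t ∈ N := by
  obtain ⟨e, he, a, r, L, K, hr, hpl⟩ := IsPicardLindelof.of_contDiffAt_one hf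
  obtain ⟨α, hα, hαc⟩ :=
    (hpl 0).exists_forall_mem_closedBall_eq_hasDerivWithinAt_continuousOn
  have hx₀ : x₀ ∈ Metric.closedBall x₀ (r : ℝ) := Metric.mem_closedBall_self hr.le
  have hr' : (0 : ℝ) < r := hr
  have h1 : ContinuousAt α (x₀, 0) := hαc.continuousAt
    (prod_mem_nhds (Metric.closedBall_mem_nhds _ hr') (Icc_mem_nhds (by simpa) (by simpa)))
  have h2 : α ⁻¹' N ∈ 𝓝 (x₀, (0 : ℝ)) := h1 (by rw [(hα x₀ hx₀).1]; exact hN)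
  obtain ⟨u, hu, v, hv, huv⟩ := mem_nhds_prod_iff.mp h2
  obtain ⟨r₁, hr₁, hru⟩ := Metric.nhds_basis_closedBall.mem_iff.mp hu
  obtain ⟨δ₁, hδ₁, hδv⟩ := Metric.mem_nhds_iff.mp hv
  refine ⟨min r r₁, by positivity, min e δ₁, by positivity, fun x hx => ?_⟩
  have hxr : x ∈ Metric.closedBall x₀ (r : ℝ) := Metric.closedBall_subset_closedBall (min_le_left _ _) hx
  have hxr₁ : x ∈ Metric.closedBall x₀ r₁ := Metric.closedBall_subset_closedBall (min_le_right _ _) hx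
  refine ⟨fun t => α (x, t), (hα x hxr).1, fun t ht => ⟨?_, ?_⟩⟩
  · have h3 : t < e := ht.2.trans_le (min_le_left _ _)
    have h4 : -e < t := (neg_le_neg (min_le_left _ _)).trans_lt ht.1
    exact ((hα x hxr).2 t ⟨by linarith, by linarith⟩).hasDerivAt
      (Icc_mem_nhds (by linarith) (by linarith))
  · have h3 : t < δ₁ := ht.2.trans_le (min_le_right _ _)
    have h4 : -δ₁ < t := (neg_le_neg (min_le_right _ _)).trans_lt ht.1
    exact huv (mk_mem_prod (hru hxr₁) (hδv (by simp [abs_lt, h3, h4])))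

/-- `raise` as a continuous linear map. -/
def raiseL (ε : ℝ) : Space →L[ℝ] Space :=
  LinearMap.toContinuousLinearMap
    { toFun := raise ε
      map_add' := fun x y => by apply Space.ext <;> simp [add_div]
      map_smul' := fun c x => by apply Space.ext <;> simp [mul_div_assoc] }

theorem inner_raise_self (ε : ℝ) (a : Space) :
    ⟪a, raise ε a⟫_ℝ = ‖a.fst‖ ^ 2 + a.snd ^ 2 / ε ^ 2 := by
  rw [Space.inner_eq, raise_fst, raise_snd, real_inner_self_eq_norm_sq]
  ring

theorem inner_raise_self_pos {ε : ℝ} (hε : ε ≠ 0) {a : Space} (ha : a ≠ 0) :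
    0 < ‖a.fst‖ ^ 2 + a.snd ^ 2 / ε ^ 2 := by
  by_contra! h
  have h1 : a.fst = 0 := by
    have : ‖a.fst‖ ^ 2 ≤ 0 := by linarith [show 0 ≤ a.snd ^ 2 / ε ^ 2 by positivity]
    simpa using (pow_eq_zero_iff two_ne_zero).mp (le_antisymm this (by positivity))
  have h2 : a.snd = 0 := by
    have h3 : a.snd ^ 2 / ε ^ 2 ≤ 0 := by linarith [sq_nonneg ‖a.fst‖]
    have h4 := le_antisymm h3 (by positivity)
    rw [div_eq_zero_iff] at h4
    simpa [hε] using h4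
  exact ha (Space.ext h1 h2)

/-- The Lagrange multiplier in the geodesic equation. -/
def multiplier (G : Space → ℝ) (ε : ℝ) (X P : Space) : ℝ :=
  -⟪hess G X P, P⟫_ℝ / ⟪gradient G X, raise ε (gradient G X)⟫_ℝ

/-- The vector field on `ℝ³ × ℝ³` that generates the geodesic flow. -/
def geodesicField (G : Space → ℝ) (ε : ℝ) (Y : Space × Space) : Space × Space :=
  (Y.2, multiplier G ε Y.1 Y.2 • raise ε (gradient G Y.1))

theorem contDiffAt_geodesicField {G : Space → ℝ} (hG : ContDiff ℝ ∞ G) {ε : ℝ} (hε : ε ≠ 0)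
    {Y : Space × Space} (hY : gradient G Y.1 ≠ 0) : ContDiffAt ℝ 1 (geodesicField G ε) Y := by
  have h1 : ContDiff ℝ 1 (gradient G) := (contDiff_gradient hG).of_le (by norm_cast)
  have h2 : ContDiff ℝ 1 (hess G) := (contDiff_gradient hG).fderiv_right (by norm_cast)
  have h3 : ContDiff ℝ 1 fun Y : Space × Space => raise ε (gradient G Y.1) :=
    (raiseL ε).contDiff.comp (h1.comp contDiff_fst)
  have h4 : ContDiff ℝ 1 fun Y : Space × Space => -⟪hess G Y.1 Y.2, Y.2⟫_ℝ :=
    (((h2.comp contDiff_fst).clm_apply contDiff_snd).inner ℝ contDiff_snd).neg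
  have h5 : ContDiff ℝ 1 fun Y : Space × Space => ⟪gradient G Y.1, raise ε (gradient G Y.1)⟫_ℝ :=
    (h1.comp contDiff_fst).inner ℝ h3
  refine contDiffAt_snd.prodMk (ContDiffAt.smul (h4.contDiffAt.div h5.contDiffAt ?_) h3.contDiffAt)
  rw [inner_raise_self]
  exact (inner_raise_self_pos hε hY).ne'

theorem FlatGeodesicAt.hasDerivAt_geodesicField {G : Space → ℝ} {ε : ℝ} (hε : ε ≠ 0)
    {X P : ℝ → Space} {t : ℝ} (h : FlatGeodesicAt G ε X P t) (h0 : gradient G (X t) ≠ 0) :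
    HasDerivAt (fun s => (X s, P s)) (geodesicField G ε (X t, P t)) t := by
  obtain ⟨m, hm, hm'⟩ := h.acc
  refine h.pos.prodMk (hm.congr_deriv ?_)
  congr 1
  rw [multiplier, inner_raise_self, ← hm', mul_div_cancel_right₀ _ (inner_raise_self_pos hε h0).ne']

theorem eq_of_hasDerivAt_zero {f : ℝ → ℝ} {δ : ℝ} (h : ∀ t ∈ Ioo (-δ) δ, HasDerivAt f 0 t)
    {t : ℝ} (ht : t ∈ Ioo (-δ) δ) : f t = f 0 := by
  have h0 : (0 : ℝ) ∈ Ioo (-δ) δ := ⟨by linarith [ht.1, ht.2], by linarith [ht.1, ht.2]⟩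
  refine (convex_Ioo (-δ) δ).is_const_of_fderivWithin_eq_zero (𝕜 := ℝ)
    (fun s hs => (h s hs).differentiableAt.differentiableWithinAt) (fun s hs => ?_) ht h0
  have h1 := (h s hs).hasFDerivAt.hasFDerivWithinAt (s := Ioo (-δ) δ)
  rw [h1.fderivWithin (isOpen_Ioo.uniqueDiffOn s hs)]
  ext; simp

/-- The level set `G = 0` is invariant under the geodesic field. -/
theorem zero_of_geodesicField {G : Space → ℝ} (hG : ContDiff ℝ ∞ G) {ε δ : ℝ} (hε : ε ≠ 0)
    {Y : ℝ → Space × Space}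
    (hY : ∀ t ∈ Ioo (-δ) δ, HasDerivAt Y (geodesicField G ε (Y t)) t)
    (hY' : ∀ t ∈ Ioo (-δ) δ, gradient G (Y t).1 ≠ 0) (h0 : G (Y 0).1 = 0)
    (h1 : ⟪gradient G (Y 0).1, (Y 0).2⟫_ℝ = 0) {t : ℝ} (ht : t ∈ Ioo (-δ) δ) :
    G (Y t).1 = 0 ∧ ⟪gradient G (Y t).1, (Y t).2⟫_ℝ = 0 := by
  have hX : ∀ t ∈ Ioo (-δ) δ, HasDerivAt (fun s => (Y s).1) (Y t).2 t := fun t ht =>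
    (hY t ht).fst
  have hP : ∀ t ∈ Ioo (-δ) δ, HasDerivAt (fun s => (Y s).2)
      (multiplier G ε (Y t).1 (Y t).2 • raise ε (gradient G (Y t).1)) t := fun t ht =>
    (hY t ht).snd
  -- The multiplier is the one that keeps ⟪∇G, P⟫ constant along solutions in ℝ³ × ℝ³; G itself is
  -- then constant because ⟪∇G, P⟫ = 0.
  have h2 : ∀ t ∈ Ioo (-δ) δ, HasDerivAt (fun s => ⟪gradient G (Y s).1, (Y s).2⟫_ℝ) 0 t := by
    intro t ht
    refine (((hasFDerivAt_gradient hG _).comp_hasDerivAt t (hX t ht)).inner ℝ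
      (hP t ht)).congr_deriv ?_
    have h3 := (inner_raise_self_pos hε (hY' t ht)).ne'
    rw [← inner_raise_self] at h3
    simp only [Function.comp]
    rw [real_inner_smul_right, multiplier, div_mul_cancel₀ _ h3]
    ring
  have h3 : ∀ t ∈ Ioo (-δ) δ, ⟪gradient G (Y t).1, (Y t).2⟫_ℝ = 0 := fun t ht =>
    (eq_of_hasDerivAt_zero h2 ht).trans h1
  refine ⟨(eq_of_hasDerivAt_zero (f := fun s => G (Y s).1) (fun t ht => ?_) ht).trans h0, h3 t ht⟩
  have h4 : HasFDerivAt G (fderiv ℝ G (Y t).1) (Y t).1 :=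
    (hG.differentiable (by simp) _).hasFDerivAt
  refine (h4.comp_hasDerivAt t (hX t ht)).congr_deriv ?_
  rw [fderiv_eq_inner_gradient, h3 t ht]

/-- The positions of the solutions of the geodesic equation are twice differentiable. -/
theorem contDiffAt_of_geodesicField {G : Space → ℝ} (hG : ContDiff ℝ ∞ G) {ε t : ℝ} (hε : ε ≠ 0)
    {Y : ℝ → Space × Space}
    (hY : ∀ᶠ s in 𝓝 t, HasDerivAt Y (geodesicField G ε (Y s)) s ∧ gradient G (Y s).1 ≠ 0) :
    ContDiffAt ℝ 2 (fun s => (Y s).1) t := by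
  obtain ⟨s, hs, hso, hts⟩ := eventually_nhds_iff.mp hY
  have hYc : ContinuousOn Y s := fun x hx => (hs x hx).1.continuousAt.continuousWithinAt
  have hY1 : ContDiffOn ℝ 1 Y s := by
    rw [show (1 : WithTop ℕ∞) = 0 + 1 by norm_num, contDiffOn_succ_iff_deriv_of_isOpen hso]
    refine ⟨fun x hx => (hs x hx).1.differentiableAt.differentiableWithinAt, by simp, ?_⟩
    rw [contDiffOn_zero]
    have : ContinuousOn (fun x => geodesicField G ε (Y x)) s := fun x hx =>
      ((contDiffAt_geodesicField hG hε (hs x hx).2).continuousAt.comp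
        (hs x hx).1.continuousAt).continuousWithinAt
    exact this.congr fun x hx => (hs x hx).1.deriv
  have hX : ∀ x ∈ s, HasDerivAt (fun s => (Y s).1) (Y x).2 x := fun x hx => (hs x hx).1.fst
  have hX2 : ContDiffOn ℝ 2 (fun s => (Y s).1) s := by
    rw [show (2 : WithTop ℕ∞) = 1 + 1 by norm_num, contDiffOn_succ_iff_deriv_of_isOpen hso]
    refine ⟨fun x hx => (hX x hx).differentiableAt.differentiableWithinAt, by simp, ?_⟩
    exact (contDiff_snd.comp_contDiffOn hY1).congr fun x hx => (hX x hx).deriv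
  exact hX2.contDiffAt (hso.mem_nhds hts)

/-- Two geodesics with the same initial conditions agree locally. -/
theorem eventually_eq_of_flatGeodesicAt {G : Space → ℝ} (hG : ContDiff ℝ ∞ G) {ε t : ℝ}
    (hε : ε ≠ 0) {X P X' P' : ℝ → Space} (h : ∀ᶠ s in 𝓝 t, FlatGeodesicAt G ε X P s)
    (h' : ∀ᶠ s in 𝓝 t, FlatGeodesicAt G ε X' P' s) (hg : gradient G (X t) ≠ 0)
    (hX : X t = X' t) (hP : P t = P' t) : ∀ᶠ s in 𝓝 t, X s = X' s := by
  obtain ⟨K, s, hs, hl⟩ :=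
    (contDiffAt_geodesicField hG hε (Y := (X t, P t)) hg).exists_lipschitzOnWith
  have key : ∀ {X P : ℝ → Space}, (∀ᶠ s in 𝓝 t, FlatGeodesicAt G ε X P s) →
      gradient G (X t) ≠ 0 → s ∈ 𝓝 (X t, P t) → ∀ᶠ τ in 𝓝 t,
      HasDerivAt (fun s => (X s, P s)) (geodesicField G ε (X τ, P τ)) τ ∧ (X τ, P τ) ∈ s := by
    intro X P h hg hs
    have hc : ContinuousAt X t := h.self_of_nhds.pos.continuousAt
    have hc' : ContinuousAt (fun s => (X s, P s)) t := by
      obtain ⟨m, hm, -⟩ := h.self_of_nhds.acc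
      exact hc.prodMk hm.continuousAt
    have h1 : ∀ᶠ τ in 𝓝 t, gradient G (X τ) ≠ 0 :=
      ((contDiff_gradient hG).continuous.continuousAt.comp hc).eventually_ne hg
    filter_upwards [h, h1, hc' hs] with τ h2 h3 h4
    exact ⟨h2.hasDerivAt_geodesicField hε h3, h4⟩
  have h1 := ODE_solution_unique_of_eventually (v := fun _ => geodesicField G ε) (s := fun _ => s)
    (Eventually.of_forall fun _ => hl) (key h hg hs)
    (key h' (by rwa [← hX]) (by rwa [← hX, ← hP])) (by simp only [hX, hP])
  exact h1.mono fun τ hτ => congrArg Prod.fst hτ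

section

/-! ### Existence of geodesics -/

theorem inner_flatten_raise {ε : ℝ} (hε : ε ≠ 0) (a w : Space) :
    ⟪flatten ε (raise ε a), flatten ε w⟫_ℝ = ⟪a, w⟫_ℝ := by
  rw [Space.inner_eq, Space.inner_eq]
  simp only [flatten_fst, flatten_snd, raise_fst, raise_snd]
  congr 1
  field_simp

variable {M : Type*} [TopologicalSpace M] [ChartedSpace Plane M] [IsManifold (𝓡 2) ∞ M]
variable {Λ : AddSubgroup Plane} [DiscreteTopology Λ]

namespace ImmersedSurface

variable {S : ImmersedSurface M Λ} {q : M} {W : Set M} {O : Set Space} {G : Space → ℝ}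
  {r : Space → M} {n : Space}

namespace Slice

/-- The solutions of the first order equation give geodesics. -/
theorem isGeodesicAt_of_field (h : S.Slice q W O G r n) {ε t : ℝ} (hε : ε ≠ 0)
    {Y : ℝ → Space × Space}
    (hY : ∀ᶠ s in 𝓝 t, HasDerivAt Y (geodesicField G ε (Y s)) s ∧ gradient G (Y s).1 ≠ 0 ∧
      (Y s).1 ∈ O ∧ G (Y s).1 = 0 ∧ ⟪gradient G (Y s).1, (Y s).2⟫_ℝ = 0) :
    S.IsGeodesicAt ε (fun s => r (Y s).1) t ∧ S.vel (fun s => r (Y s).1) t = (Y t).2 := by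
  set γ : ℝ → M := fun s => r (Y s).1 with hγ
  obtain ⟨h1, h2, h3, h4, h5⟩ := hY.self_of_nhds
  have hlift : ∀ᶠ s in 𝓝 t, S.lift q (γ s) = (Y s).1 := hY.mono fun s hs => by
    rw [hγ, h.lift_r _ hs.2.2.1, hs.2.2.2.1, zero_smul, sub_zero]
  have hX : ∀ᶠ s in 𝓝 t, HasDerivAt (fun s => (Y s).1) (Y s).2 s := hY.mono fun s hs => hs.1.fst
  have hP : HasDerivAt (fun s => (Y s).2)
      (multiplier G ε (Y t).1 (Y t).2 • raise ε (gradient G (Y t).1)) t := h1.snd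
  have hW : γ t ∈ W := h.r_mem _ h3 h4
  have hC : ContMDiffAt 𝓘(ℝ, ℝ) (𝓡 2) 2 γ t := by
    have e1 : ContMDiffAt 𝓘(ℝ, Space) (𝓡 2) 2 r (Y t).1 :=
      (h.smooth_r.contMDiffAt (h.isOpen_O.mem_nhds h3)).of_le (by norm_cast)
    have e2 : ContMDiffAt 𝓘(ℝ, ℝ) 𝓘(ℝ, Space) 2 (fun s => (Y s).1) t :=
      contMDiffAt_iff_contDiffAt.mpr
        (contDiffAt_of_geodesicField h.smooth_G hε (hY.mono fun s hs => ⟨hs.1, hs.2.1⟩))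
    exact e1.comp t e2
  refine ⟨⟨hC, fun w => ?_⟩, ?_⟩
  · have e1 : (fun s => flatten ε (S.lift (γ t) (γ s))) =ᶠ[𝓝 t]
        fun s => flattenL ε ((Y s).1 + (S.lift (γ t) (γ t) - S.lift q (γ t))) := by
      filter_upwards [hC.continuousAt.eventually (h.eventually_lift_eq hW), hlift] with s hs hs'
      rw [flattenL_apply, hs, hs']
    have e3 := (e1.iteratedDeriv_eq 2).trans (iteratedDeriv_two_eq
      (f' := fun s => flattenL ε (Y s).2) (hX.mono fun s hs =>
        (flattenL ε).hasFDerivAt.comp_hasDerivAt s (hs.add_const _))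
      ((flattenL ε).hasFDerivAt.comp_hasDerivAt t hP))
    rw [e3, map_smul, real_inner_smul_left, flattenL_apply, inner_flatten_raise hε]
    have e2 := (h.mem_tangentPlane hW (S.diff (γ t) w)).mp ⟨w, rfl⟩
    rw [hlift.self_of_nhds] at e2
    rw [e2, mul_zero]
  · have e1 := h.hasDerivAt_lift_comp hW (hC.mdifferentiableAt (by simp))
    exact e1.unique (hX.self_of_nhds.congr_of_eventuallyEq hlift)

end Slice

variable (S)

/-- The vector field is solved in ℝ³ × ℝ³ and the solution is brought back by the retraction. The
time δ is common to all initial conditions near (q, P₀), which compactness will exploit. -/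
theorem exists_local_geodesic {ε : ℝ} (hε : ε ≠ 0) (q : M) (P₀ : Space) :
    ∃ 𝒩 ∈ 𝓝 (q, P₀), ∃ δ > 0, ∀ y ∈ 𝒩, y.2 ∈ S.tangentPlane y.1 → ∃ γ : ℝ → M, γ 0 = y.1 ∧
      S.vel γ 0 = y.2 ∧ ∀ t ∈ Ioo (-δ) δ, S.IsGeodesicAt ε γ t := by
  obtain ⟨W, O, G, r, n, h⟩ := S.exists_slice q
  have hg := h.gradient_ne_zero h.mem_W
  set N : Set (Space × Space) := {Y | Y.1 ∈ O ∧ gradient G Y.1 ≠ 0} with hN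
  have hN' : N ∈ 𝓝 (S.lift q q, P₀) := by
    refine inter_mem (continuousAt_fst.preimage_mem_nhds (h.isOpen_O.mem_nhds (h.lift_mem q h.mem_W)))
      ?_
    exact ((contDiff_gradient h.smooth_G).continuous.comp continuous_fst).continuousAt.eventually_ne
      hg
  obtain ⟨ρ, hρ, δ, hδ, H⟩ := exists_local_flow
    (contDiffAt_geodesicField h.smooth_G hε (Y := (S.lift q q, P₀)) hg) hN'
  have hc : ContinuousAt (fun y : M × Space => (S.lift q y.1, y.2)) (q, P₀) := by
    have e1 : ContinuousAt (S.lift q) q :=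
      h.smooth_lift.continuousOn.continuousAt (h.isOpen_W.mem_nhds h.mem_W)
    exact (ContinuousAt.comp (x := (q, P₀)) e1 continuousAt_fst).prodMk continuousAt_snd
  refine ⟨_, inter_mem (hc (Metric.closedBall_mem_nhds _ hρ))
    (continuousAt_fst (h.isOpen_W.mem_nhds h.mem_W)), δ, hδ, ?_⟩
  rintro ⟨q', P⟩ ⟨hy, hq' : q' ∈ W⟩ hP
  obtain ⟨Y, hY0, hY⟩ := H _ hy
  have hG : ∀ t ∈ Ioo (-δ) δ, G (Y t).1 = 0 ∧ ⟪gradient G (Y t).1, (Y t).2⟫_ℝ = 0 := fun t ht =>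
    zero_of_geodesicField h.smooth_G hε (fun t ht => (hY t ht).1) (fun t ht => (hY t ht).2.2)
      (by rw [hY0]; exact h.G_lift _ hq') (by rw [hY0]; exact (h.mem_tangentPlane hq' _).mp hP) ht
  have hgeo : ∀ t ∈ Ioo (-δ) δ, S.IsGeodesicAt ε (fun s => r (Y s).1) t ∧
      S.vel (fun s => r (Y s).1) t = (Y t).2 := fun t ht => by
    refine h.isGeodesicAt_of_field hε ?_
    filter_upwards [isOpen_Ioo.mem_nhds ht] with s hs
    exact ⟨(hY s hs).1, (hY s hs).2.2, (hY s hs).2.1, hG s hs⟩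
  refine ⟨fun s => r (Y s).1, ?_, ?_, fun t ht => (hgeo t ht).1⟩
  · simp only [hY0]
    exact h.r_lift q' hq'
  · rw [(hgeo 0 ⟨by linarith, hδ⟩).2, hY0]

variable {S}

theorem IsGeodesicAt.hasDerivAt_energy {γ : ℝ → M} {t ε : ℝ} (hε : ε ≠ 0)
    (hγ : S.IsGeodesicAt ε γ t) : HasDerivAt (fun s => ‖flatten ε (S.vel γ s)‖ ^ 2) 0 t := by
  obtain ⟨W, O, G, r, n, h⟩ := S.exists_slice (γ t)
  exact h.hasDerivAt_energy hε h.mem_W hγ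

theorem norm_vel_eq {γ : ℝ → M} {δ ε : ℝ} (hε : ε ≠ 0)
    (hγ : ∀ t ∈ Ioo (-δ) δ, S.IsGeodesicAt ε γ t) {t : ℝ} (ht : t ∈ Ioo (-δ) δ) :
    ‖flatten ε (S.vel γ t)‖ = ‖flatten ε (S.vel γ 0)‖ := by
  have h := eq_of_hasDerivAt_zero (f := fun s => ‖flatten ε (S.vel γ s)‖ ^ 2)
    (fun s hs => (hγ s hs).hasDerivAt_energy hε) ht
  exact (pow_left_inj₀ (norm_nonneg _) (norm_nonneg _) two_ne_zero).mp h

/-- A unit speed geodesic near a given time. -/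
def IsUnitGeodesicAt (S : ImmersedSurface M Λ) (ε : ℝ) (γ : ℝ → M) (t : ℝ) : Prop :=
  S.IsGeodesicAt ε γ t ∧ ‖flatten ε (S.vel γ t)‖ = 1

theorem vel_congr {γ γ' : ℝ → M} {t : ℝ} (hγ : γ' =ᶠ[𝓝 t] γ) : S.vel γ' t = S.vel γ t := by
  have h0 : γ' t = γ t := hγ.self_of_nhds
  have h1 : velocity γ' t = velocity γ t := by
    unfold velocity
    rw [hγ.mfderiv_eq, h0]
  have h2 : ∀ u v : TangentBundle (𝓡 2) M, u = v → S.diff u.proj u.snd = S.diff v.proj v.snd := by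
    rintro u _ rfl; rfl
  exact h2 _ _ h1

theorem IsUnitGeodesicAt.congr {ε : ℝ} {γ γ' : ℝ → M} {t : ℝ} (h : S.IsUnitGeodesicAt ε γ t)
    (hγ : γ' =ᶠ[𝓝 t] γ) : S.IsUnitGeodesicAt ε γ' t :=
  ⟨IsGeodesicAt.congr S h.1 hγ, by rw [vel_congr hγ, h.2]⟩

theorem eventually_eq_of_isUnitGeodesicAt {ε t : ℝ} (hε : ε ≠ 0) {γ γ' : ℝ → M}
    (h : ∀ᶠ s in 𝓝 t, S.IsUnitGeodesicAt ε γ s) (h' : ∀ᶠ s in 𝓝 t, S.IsUnitGeodesicAt ε γ' s)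
    (h0 : γ t = γ' t) (h1 : S.vel γ t = S.vel γ' t) : γ =ᶠ[𝓝 t] γ' := by
  obtain ⟨W, O, G, r, n, hs⟩ := S.exists_slice (γ t)
  have hW : ∀ᶠ s in 𝓝 t, γ s ∈ W :=
    h.self_of_nhds.1.1.continuousAt.eventually (hs.isOpen_W.mem_nhds hs.mem_W)
  have hW' : ∀ᶠ s in 𝓝 t, γ' s ∈ W :=
    h'.self_of_nhds.1.1.continuousAt.eventually (hs.isOpen_W.mem_nhds (h0 ▸ hs.mem_W))
  have key := eventually_eq_of_flatGeodesicAt hs.smooth_G hε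
    (X := fun s => S.lift (γ t) (γ s)) (P := S.vel γ)
    (X' := fun s => S.lift (γ t) (γ' s)) (P' := S.vel γ') (t := t)
    (by filter_upwards [h, hW] with s h1 h2 using hs.flatGeodesicAt hε h2 h1.1 h1.2)
    (by filter_upwards [h', hW'] with s h1 h2 using hs.flatGeodesicAt hε h2 h1.1 h1.2)
    (hs.gradient_ne_zero hs.mem_W) (by simp only [h0]) h1
  filter_upwards [key, hW, hW'] with s h1 h2 h3
  rw [← hs.r_lift _ h2, ← hs.r_lift _ h3, h1]

theorem vel_comp_affine {γ : ℝ → M} {a b t : ℝ}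
    (hγ : MDifferentiableAt 𝓘(ℝ, ℝ) (𝓡 2) γ (a * t + b)) :
    S.vel (fun s => γ (a * s + b)) t = a • S.vel γ (a * t + b) := by
  obtain ⟨W, O, G, r, n, hs⟩ := S.exists_slice (γ (a * t + b))
  have hd : HasDerivAt (fun s : ℝ => a * s + b) a t := by
    simpa using ((hasDerivAt_id t).const_mul a).add_const b
  have hm : MDifferentiableAt 𝓘(ℝ, ℝ) (𝓡 2) (fun s => γ (a * s + b)) t :=
    MDifferentiableAt.comp (g := γ) t hγ hd.differentiableAt.mdifferentiableAt
  have h1 := hs.hasDerivAt_lift_comp (γ := fun s => γ (a * s + b)) hs.mem_W hm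
  have h2 := (hs.hasDerivAt_lift_comp hs.mem_W hγ).scomp t hd
  exact h1.unique h2

/-- Needed for the translations that concatenate geodesics (a = 1) and for time reversal (a = -1).
-/
theorem IsGeodesicAt.comp_affine {ε a b t : ℝ} {γ : ℝ → M} (h : S.IsGeodesicAt ε γ (a * t + b)) :
    S.IsGeodesicAt ε (fun s => γ (a * s + b)) t := by
  obtain ⟨W, O, G, r, n, hs⟩ := S.exists_slice (γ (a * t + b))
  obtain ⟨hd, A, hA⟩ := hs.exists_hasDerivAt_vel hs.mem_W h.1
  have hf : ∀ s : ℝ, HasDerivAt (fun s : ℝ => a * s + b) a s := fun s => by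
    simpa using ((hasDerivAt_id s).const_mul a).add_const b
  have hc : ContMDiff 𝓘(ℝ, ℝ) 𝓘(ℝ, ℝ) 2 (fun s : ℝ => a * s + b) := by
    rw [contMDiff_iff_contDiff]; fun_prop
  refine ⟨ContMDiffAt.comp (g := γ) t h.1 hc.contMDiffAt, fun w => ?_⟩
  set F := S.lift (γ (a * t + b))
  have h1 : iteratedDeriv 2 (fun s => flatten ε (F (γ s))) (a * t + b) = flattenL ε A :=
    iteratedDeriv_two_eq (f' := fun s => flattenL ε (S.vel γ s)) (hd.mono fun s hs =>
      (flattenL ε).hasFDerivAt.comp_hasDerivAt s hs.2)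
      ((flattenL ε).hasFDerivAt.comp_hasDerivAt _ hA)
  have h2 : iteratedDeriv 2 (fun s => flatten ε (F (γ (a * s + b)))) t =
      flattenL ε (a • a • A) := by
    refine iteratedDeriv_two_eq (f' := fun s => flattenL ε (a • S.vel γ (a * s + b))) ?_ ?_
    · have hd' := (hf t).continuousAt.eventually hd
      filter_upwards [hd'] with s hs'
      have e1 : HasDerivAt (fun s => F (γ (a * s + b))) (a • S.vel γ (a * s + b)) s :=
        HasDerivAt.scomp (g₁ := fun s => F (γ s)) s hs'.2 (hf s)
      exact (flattenL ε).hasFDerivAt.comp_hasDerivAt s e1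
    · have e1 : HasDerivAt (fun s => S.vel γ (a * s + b)) (a • A) t :=
        HasDerivAt.scomp (g₁ := S.vel γ) t hA (hf t)
      exact (flattenL ε).hasFDerivAt.comp_hasDerivAt t (e1.const_smul a)
  have h3 := h.2 w
  change ⟪iteratedDeriv 2 (fun s => flatten ε (F (γ (a * s + b)))) t, _⟫_ℝ = 0
  rw [h2, map_smul, map_smul, real_inner_smul_left, real_inner_smul_left, ← h1]
  change a * (a * ⟪iteratedDeriv 2 (fun s => flatten ε (F (γ s))) (a * t + b),
    flatten ε (S.diff (γ (a * t + b)) w)⟫_ℝ) = 0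
  rw [h3, mul_zero, mul_zero]

theorem IsUnitGeodesicAt.comp_affine {ε a b t : ℝ} {γ : ℝ → M} (ha : |a| = 1)
    (h : S.IsUnitGeodesicAt ε γ (a * t + b)) :
    S.IsUnitGeodesicAt ε (fun s => γ (a * s + b)) t := by
  refine ⟨h.1.comp_affine, ?_⟩
  rw [vel_comp_affine (h.1.1.mdifferentiableAt (by simp)), ← flattenL_apply, map_smul,
    norm_smul, Real.norm_eq_abs, ha, one_mul, flattenL_apply, h.2]

end ImmersedSurface

end

/-! ### Completeness of the unit speed geodesics -/

section

variable {M : Type*} [TopologicalSpace M] [ChartedSpace Plane M] [IsManifold (𝓡 2) ∞ M]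
variable {Λ : AddSubgroup Plane} [DiscreteTopology Λ]

theorem isCompact_norm_flatten {ε : ℝ} (hε : ε ≠ 0) : IsCompact {P : Space | ‖flatten ε P‖ = 1} := by
  have : ProperSpace Space := FiniteDimensional.proper ℝ Space
  refine Metric.isCompact_of_isClosed_isBounded
    (isClosed_eq (flattenL ε).continuous.norm continuous_const) ?_
  refine (Metric.isBounded_closedBall (x := (0 : Space)) (r := 1 + 1 / |ε|)).subset
    fun P (hP : ‖flatten ε P‖ = 1) => ?_
  rw [mem_closedBall_zero_iff]
  have h1 := Space.norm_fst_le (flatten ε P)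
  have h2 := Space.abs_snd_le (flatten ε P)
  rw [flatten_fst, hP] at h1
  rw [flatten_snd, hP, abs_mul] at h2
  have h3 : |P.snd| ≤ 1 / |ε| := by
    rw [le_div_iff₀ (abs_pos.mpr hε)]; linarith
  linarith [Space.norm_le P]

namespace ImmersedSurface

variable (S : ImmersedSurface M Λ)

/-- The local existence time can be chosen uniformly because the surface and, for fixed ε ≠ 0, the
vectors of flattened norm 1 form compact sets. -/
theorem exists_uniform_geodesic [CompactSpace M] {ε : ℝ} (hε : ε ≠ 0) :
    ∃ δ > 0, ∀ y : M × Space, y.2 ∈ S.tangentPlane y.1 → ‖flatten ε y.2‖ = 1 →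
      ∃ γ : ℝ → M, γ 0 = y.1 ∧ S.vel γ 0 = y.2 ∧ ∀ t ∈ Ioo (-δ) δ, S.IsUnitGeodesicAt ε γ t := by
  have key : ∃ δ > 0, ∀ y ∈ (univ : Set M) ×ˢ {P : Space | ‖flatten ε P‖ = 1},
      y.2 ∈ S.tangentPlane y.1 → ∃ γ : ℝ → M, γ 0 = y.1 ∧ S.vel γ 0 = y.2 ∧
        ∀ t ∈ Ioo (-δ) δ, S.IsGeodesicAt ε γ t := by
    refine (isCompact_univ.prod (isCompact_norm_flatten hε)).induction_on
      (p := fun s => ∃ δ > 0, ∀ y ∈ s,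
      y.2 ∈ S.tangentPlane y.1 → ∃ γ : ℝ → M, γ 0 = y.1 ∧ S.vel γ 0 = y.2 ∧
        ∀ t ∈ Ioo (-δ) δ, S.IsGeodesicAt ε γ t) ⟨1, one_pos, by simp⟩ ?_ ?_ ?_
    · rintro s t hst ⟨δ, hδ, h⟩
      exact ⟨δ, hδ, fun y hy => h y (hst hy)⟩
    · rintro s t ⟨δ, hδ, h⟩ ⟨δ', hδ', h'⟩
      refine ⟨min δ δ', by positivity, fun y hy hy' => ?_⟩
      rcases hy with hy | hy
      · obtain ⟨γ, h0, h1, h2⟩ := h y hy hy'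
        exact ⟨γ, h0, h1, fun t ht => h2 t (Ioo_subset_Ioo (neg_le_neg (min_le_left _ _))
          (min_le_left _ _) ht)⟩
      · obtain ⟨γ, h0, h1, h2⟩ := h' y hy hy'
        exact ⟨γ, h0, h1, fun t ht => h2 t (Ioo_subset_Ioo (neg_le_neg (min_le_right _ _))
          (min_le_right _ _) ht)⟩
    · rintro ⟨q, P⟩ -
      obtain ⟨N, hN, δ, hδ, h⟩ := S.exists_local_geodesic hε q P
      exact ⟨N, mem_nhdsWithin_of_mem_nhds hN, δ, hδ, h⟩
  obtain ⟨δ, hδ, H⟩ := key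
  refine ⟨δ, hδ, fun y hy hy' => ?_⟩
  obtain ⟨γ, h0, h1, h2⟩ := H y ⟨mem_univ _, hy'⟩ hy
  exact ⟨γ, h0, h1, fun t ht => ⟨h2 t ht, by rw [norm_vel_eq hε h2 ht, h1, hy']⟩⟩

variable {S}

/-- Restart the geodesic at every multiple of h = δ / 2. Each piece lives for a time 2h on both
sides of its start, so consecutive pieces overlap around the switching time and agree there by
uniqueness. -/
theorem exists_forward_geodesic {ε δ : ℝ} (hε : ε ≠ 0) (hδ : 0 < δ)
    (H : ∀ y : M × Space, y.2 ∈ S.tangentPlane y.1 → ‖flatten ε y.2‖ = 1 →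
      ∃ γ : ℝ → M, γ 0 = y.1 ∧ S.vel γ 0 = y.2 ∧ ∀ t ∈ Ioo (-δ) δ, S.IsUnitGeodesicAt ε γ t)
    {q : M} {P : Space} (hP : P ∈ S.tangentPlane q) (hP1 : ‖flatten ε P‖ = 1) :
    ∃ γ : ℝ → M, γ 0 = q ∧ S.vel γ 0 = P ∧ ∀ t, -δ < t → S.IsUnitGeodesicAt ε γ t := by
  set Z := {y : M × Space // y.2 ∈ S.tangentPlane y.1 ∧ ‖flatten ε y.2‖ = 1} with hZ
  choose c hc0 hcv hc using fun z : Z => H z.1 z.2.1 z.2.2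
  obtain ⟨h, rfl⟩ : ∃ h, δ = 2 * h := ⟨δ / 2, by ring⟩
  have hh : 0 < h := by linarith
  set next : Z → Z := fun z => ⟨(c z h, S.vel (c z) h), Slice.vel_mem_tangentPlane _ _,
    (hc z h ⟨by linarith, by linarith⟩).2⟩ with hnext
  set s : ℕ → Z := fun k => next^[k] ⟨(q, P), hP, hP1⟩ with hs
  have hs1 : ∀ k, s (k + 1) = next (s k) := fun k => Function.iterate_succ_apply' _ _ _
  set κ : ℕ → ℝ → M := fun k t => c (s k) (1 * t + -(k * h)) with hκ
  have hκu : ∀ (k : ℕ) (t : ℝ), |t - k * h| < 2 * h → S.IsUnitGeodesicAt ε (κ k) t := fun k t ht => by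
    refine IsUnitGeodesicAt.comp_affine (by simp) (hc (s k) _ ?_)
    rw [abs_lt] at ht
    constructor <;> linarith
  have hκv : ∀ (k : ℕ) (t : ℝ), |t - k * h| < 2 * h → S.vel (κ k) t = S.vel (c (s k)) (1 * t + -(k * h)) := by
    intro k t ht
    rw [hκ, vel_comp_affine, one_smul]
    rw [abs_lt] at ht
    exact (hc (s k) _ ⟨by linarith, by linarith⟩).1.1.mdifferentiableAt (by simp)
  have hev : ∀ (k : ℕ) (t : ℝ), |t - k * h| < 2 * h → ∀ᶠ τ in 𝓝 t, S.IsUnitGeodesicAt ε (κ k) τ := by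
    intro k t ht
    have : ContinuousAt (fun τ => |τ - k * h|) t := by fun_prop
    exact (this.eventually_lt_const ht).mono fun τ hτ => hκu k τ hτ
  have hov : ∀ k : ℕ, κ k =ᶠ[𝓝 ((k + 1 : ℕ) * h)] κ (k + 1) := fun k => by
    have e1 : |((k + 1 : ℕ) * h) - k * h| < 2 * h := by
      push_cast
      rw [show ((k : ℝ) + 1) * h - k * h = h by ring, abs_of_pos hh]; linarith
    have e2 : |((k + 1 : ℕ) * h) - (k + 1 : ℕ) * h| < 2 * h := by
      rw [sub_self, abs_zero]; linarith
    have e3 : 1 * (((k + 1 : ℕ) : ℝ) * h) + -(k * h) = h := by push_cast; ring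
    have e4 : 1 * (((k + 1 : ℕ) : ℝ) * h) + -(((k + 1 : ℕ) : ℝ) * h) = 0 := by ring
    refine eventually_eq_of_isUnitGeodesicAt hε (hev k _ e1) (hev (k + 1) _ e2) ?_ ?_
    · simp only [hκ]
      rw [e3, e4, hc0, hs1]
    · rw [hκv k _ e1, hκv (k + 1) _ e2, e3, e4, hcv, hs1]
  have hfl : ∀ (k : ℕ) (τ : ℝ), k * h ≤ τ → τ < (k + 1) * h → ⌊τ / h⌋₊ = k := fun k τ h1 h2 => by
    rw [Nat.floor_eq_iff (div_nonneg (le_trans (by positivity) h1) hh.le), le_div_iff₀ hh,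
      div_lt_iff₀ hh]
    exact ⟨h1, h2⟩
  have hfl0 : ∀ τ : ℝ, τ < h → ⌊τ / h⌋₊ = 0 := fun τ h1 => by
    rw [Nat.floor_eq_zero, div_lt_one hh]; exact h1
  -- The natural floor is 0 at negative times, so the initial piece also covers the times between -δ
  -- and 0.
  set γ : ℝ → M := fun t => κ ⌊t / h⌋₊ t with hγ
  have hγκ : ∀ t, γ =ᶠ[𝓝 t] κ ⌊t / h⌋₊ := fun t => by
    rcases lt_or_ge t h with ht | ht
    · rw [hfl0 t ht]
      filter_upwards [eventually_lt_nhds ht] with τ hτ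
      simp only [hγ, hfl0 τ hτ]
    · obtain ⟨k, hk⟩ : ∃ k, ⌊t / h⌋₊ = k + 1 := Nat.exists_eq_succ_of_ne_zero (by
        rw [Ne, Nat.floor_eq_zero, div_lt_one hh]; linarith)
      have hk1 : ((k + 1 : ℕ) : ℝ) * h ≤ t := by
        rw [← le_div_iff₀ hh, ← hk]; exact Nat.floor_le (div_nonneg (hh.le.trans ht) hh.le)
      have hk2 : t < ((k + 1 : ℕ) + 1 : ℝ) * h := by
        rw [← div_lt_iff₀ hh, ← hk]; exact Nat.lt_floor_add_one _
      rw [hk]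
      rcases hk1.eq_or_lt with he | hlt
      · have hk3 : (k : ℝ) * h < t := by rw [← he]; push_cast; nlinarith
        have h3 := hov k
        rw [he] at h3
        filter_upwards [h3, eventually_lt_nhds hk2, eventually_gt_nhds hk3] with τ h4 h5 h6
        rcases lt_or_ge τ t with h7 | h7
        · simp only [hγ]
          rw [hfl k τ h6.le (by rw [← he] at h7; push_cast at h7; exact h7), h4]
        · simp only [hγ]
          rw [hfl (k + 1) τ (he.le.trans h7) h5]
      · filter_upwards [eventually_lt_nhds hk2, eventually_gt_nhds hlt] with τ h5 h6
        simp only [hγ]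
        rw [hfl (k + 1) τ h6.le h5]
  have h00 : ⌊(0 : ℝ) / h⌋₊ = 0 := by simp
  have e0 : |(0 : ℝ) - (0 : ℕ) * h| < 2 * h := by
    rw [Nat.cast_zero, zero_mul, sub_zero, abs_zero]; linarith
  refine ⟨γ, ?_, ?_, fun t ht => ?_⟩
  · simp only [hγ, h00, hκ]
    simp [hc0, hs]
  · rw [vel_congr (hγκ 0), h00, hκv 0 0 e0, Nat.cast_zero, zero_mul, neg_zero, mul_zero, add_zero,
      hcv]
    rfl
  · refine (hκu _ t ?_).congr (hγκ t)
    rcases lt_or_ge t 0 with h1 | h1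
    · rw [hfl0 t (by linarith)]
      simp only [Nat.cast_zero, zero_mul, sub_zero, abs_of_neg h1]; linarith
    · have h2 := Nat.floor_le (div_nonneg h1 hh.le)
      have h3 := Nat.lt_floor_add_one (t / h)
      rw [le_div_iff₀ hh] at h2
      rw [div_lt_iff₀ hh] at h3
      rw [abs_lt]
      constructor <;> linarith

variable (S)

/-- Unit speed geodesics on a compact surface exist for all times. -/
theorem exists_unit_geodesic [CompactSpace M] {ε : ℝ} (hε : ε ≠ 0) {q : M} {P : Space}
    (hP : P ∈ S.tangentPlane q) (hP1 : ‖flatten ε P‖ = 1) :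
    ∃ γ : ℝ → M, γ 0 = q ∧ S.vel γ 0 = P ∧ ∀ t, S.IsUnitGeodesicAt ε γ t := by
  obtain ⟨δ, hδ, H⟩ := S.exists_uniform_geodesic hε
  obtain ⟨γ, h0, hv, hγ⟩ := exists_forward_geodesic hε hδ H hP hP1
  have hP' : ‖flatten ε (-P)‖ = 1 := by
    rw [← flattenL_apply, map_neg, norm_neg, flattenL_apply, hP1]
  obtain ⟨γ', h0', hv', hγ'⟩ := exists_forward_geodesic hε hδ H (neg_mem hP) hP'
  set β : ℝ → M := fun t => γ' (-1 * t + 0) with hβ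
  have hβu : ∀ t, t < δ → S.IsUnitGeodesicAt ε β t := fun t ht =>
    IsUnitGeodesicAt.comp_affine (by simp) (hγ' _ (by linarith))
  have hβ0 : β 0 = q := by simp [hβ, h0']
  have hβv : S.vel β 0 = P := by
    rw [hβ, vel_comp_affine ((hγ' _ (by linarith)).1.1.mdifferentiableAt (by simp))]
    simp [hv']
  have heq : γ =ᶠ[𝓝 0] β := eventually_eq_of_isUnitGeodesicAt hε
    ((eventually_gt_nhds (show -δ < 0 by linarith)).mono fun t ht => hγ t ht)
    ((eventually_lt_nhds hδ).mono fun t ht => hβu t ht) (h0.trans hβ0.symm) (hv.trans hβv.symm)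
  -- The geodesic in the direction -P, run backwards, supplies the past; by uniqueness it coincides
  -- with γ near 0, so the glued curve is a geodesic there too.
  set α : ℝ → M := fun t => if t < 0 then β t else γ t with hα
  have h1 : ∀ t, 0 ≤ t → α =ᶠ[𝓝 t] γ := fun t ht => by
    rcases ht.eq_or_lt with rfl | ht
    · filter_upwards [heq] with τ hτ
      simp only [hα]; split_ifs; exacts [hτ.symm, rfl]
    · filter_upwards [eventually_gt_nhds ht] with τ hτ
      simp only [hα, if_neg hτ.not_gt]
  refine ⟨α, by simp [hα, h0], by rw [vel_congr (h1 0 le_rfl), hv], fun t => ?_⟩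
  rcases lt_or_ge t 0 with ht | ht
  · refine (hβu t (ht.trans hδ)).congr ?_
    filter_upwards [eventually_lt_nhds ht] with τ hτ
    simp only [hα, if_pos hτ]
  · exact (hγ t (by linarith)).congr (h1 t ht)

theorem injective_diff (q : M) : Function.Injective (S.diff q) :=
  S.immersion q _ (S.exists_lift q).choose_spec

theorem vel_eq (γ : ℝ → M) (t : ℝ) :
    S.vel γ t = S.diff (velocity γ t).proj (velocity γ t).snd := rfl

theorem tangentBundle_ext {u v : TangentBundle (𝓡 2) M} (h : u.proj = v.proj)
    (h' : S.diff u.proj u.snd = S.diff v.proj v.snd) : u = v := by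
  obtain ⟨q, w⟩ := u
  obtain ⟨q', w'⟩ := v
  obtain rfl : q = q' := h
  exact congrArg (Bundle.TotalSpace.mk q) (S.injective_diff q h')

theorem diff_normalize (ε : ℝ) (u : TangentBundle (𝓡 2) M) :
    S.diff (S.normalize ε u).proj (S.normalize ε u).snd =
      (S.gnorm ε u)⁻¹ • S.diff u.proj u.snd := map_smul _ _ _

/-- The geodesic flow moves the vectors along unit speed geodesics. -/
theorem exists_geodesicFlow_eq [CompactSpace M] {ε : ℝ} (hε : ε ≠ 0) {u : TangentBundle (𝓡 2) M}
    (hu : S.gnorm ε u ≠ 0) : ∃ γ : ℝ → M, γ 0 = u.proj ∧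
      S.vel γ 0 = (S.gnorm ε u)⁻¹ • S.diff u.proj u.snd ∧ (∀ t, S.IsUnitGeodesicAt ε γ t) ∧
      ∀ t, S.geodesicFlow ε t u = velocity γ t := by
  have hunit : ‖flatten ε ((S.gnorm ε u)⁻¹ • S.diff u.proj u.snd)‖ = 1 := by
    rw [← flattenL_apply, map_smul, norm_smul, flattenL_apply, norm_inv, gnorm, norm_norm]
    exact inv_mul_cancel₀ hu
  have hex : ∃ γ : ℝ → M, S.IsGeodesic ε γ ∧ velocity γ 0 = S.normalize ε u := by
    obtain ⟨γ, h0, hv, hγ⟩ := S.exists_unit_geodesic hε (q := u.proj)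
      (P := (S.gnorm ε u)⁻¹ • S.diff u.proj u.snd) (Submodule.smul_mem _ _ ⟨_, rfl⟩) hunit
    refine ⟨γ, (S.isGeodesic_iff ε γ).mpr fun t => (hγ t).1, S.tangentBundle_ext h0 ?_⟩
    rw [diff_normalize, ← vel_eq, hv]
  -- Whichever geodesic the choice selects, conservation of energy gives it unit speed, so global
  -- uniqueness is not needed.
  have h2 := hex.choose_spec
  set γ := hex.choose with hγ
  have hv : S.vel γ 0 = (S.gnorm ε u)⁻¹ • S.diff u.proj u.snd := by
    rw [vel_eq, h2.2, diff_normalize]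
  have hg := (S.isGeodesic_iff ε γ).mp h2.1
  refine ⟨γ, congrArg Bundle.TotalSpace.proj h2.2, hv, fun t => ⟨hg t, ?_⟩, fun t => ?_⟩
  · rw [norm_vel_eq (δ := |t| + 1) hε (fun s _ => hg s)
      ⟨by linarith [neg_abs_le t], by linarith [le_abs_self t]⟩, hv, hunit]
  · rw [geodesicFlow, dif_pos hex]

end ImmersedSurface

end

section

/-! ### The base -/

section Base

variable {Λ : AddSubgroup Plane}

theorem continuous_toBase : Continuous (toBase Λ) := QuotientAddGroup.continuous_mk

theorem isOpenMap_toBase : IsOpenMap (toBase Λ) := QuotientAddGroup.isOpenMap_coe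

theorem toBase_add (x y : Plane) : toBase Λ (x + y) = toBase Λ x + toBase Λ y := rfl

theorem toBase_sub (x y : Plane) : toBase Λ (x - y) = toBase Λ x - toBase Λ y := rfl

theorem toBase_zero : toBase Λ 0 = 0 := rfl

theorem toBase_surjective : Function.Surjective (toBase Λ) := QuotientAddGroup.mk_surjective

/-- As Λ is discrete, the covering map is injective on small balls, of a radius that does not depend
on the centre. -/
theorem exists_eq_of_toBase_eq (Λ : AddSubgroup Plane) [DiscreteTopology Λ] :
    ∃ ρ > 0, ∀ x y : Plane, ‖x - y‖ < ρ → toBase Λ x = toBase Λ y → x = y := by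
  have : {(0 : Λ)} ∈ 𝓝 (0 : Λ) := by simp
  rw [nhds_subtype_eq_comap, Filter.mem_comap] at this
  obtain ⟨W, hW, h⟩ := this
  obtain ⟨ρ, hρ, hρW⟩ := Metric.mem_nhds_iff.mp hW
  refine ⟨ρ, hρ, fun x y hxy he => ?_⟩
  have h1 : x - y ∈ Λ := by
    have := QuotientAddGroup.eq.mp he.symm
    rwa [neg_add_eq_sub] at this
  have h2 := h (show (⟨x - y, h1⟩ : Λ) ∈ Subtype.val ⁻¹' W from hρW (by simpa using hxy))
  exact sub_eq_zero.mp (congrArg Subtype.val h2)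

end Base

theorem eventually_eq_of_hasDerivAt_zero {E : Type*} [NormedAddCommGroup E] [NormedSpace ℝ E]
    {f : ℝ → E} {t : ℝ} (h : ∀ᶠ s in 𝓝 t, HasDerivAt f 0 s) : ∀ᶠ s in 𝓝 t, f s = f t := by
  obtain ⟨δ, hδ, H⟩ := Metric.eventually_nhds_iff_ball.mp h
  filter_upwards [Metric.ball_mem_nhds t hδ] with s hs
  refine Metric.isOpen_ball.is_const_of_deriv_eq_zero (convex_ball t δ).isPreconnected
    (fun x hx => (H x hx).differentiableAt.differentiableWithinAt) (fun x hx => (H x hx).deriv) hs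
    (Metric.mem_ball_self hδ)

/-! ### Projected geodesics and trapping near isolated points of the fibres -/

variable {M : Type*} [TopologicalSpace M] [ChartedSpace Plane M] [IsManifold (𝓡 2) ∞ M]
variable {Λ : AddSubgroup Plane} [DiscreteTopology Λ]

namespace ImmersedSurface

section

variable {S : ImmersedSurface M Λ} {q : M} {W : Set M} {O : Set Space} {G : Space → ℝ}
  {r : Space → M} {n : Space}

theorem Slice.proj_eq (h : S.Slice q W O G r n) {q' : M} (hq' : q' ∈ W) :
    S.proj q' = toBase Λ (S.lift q q').fst := by
  rw [proj, ← h.cover_lift q' hq', cover]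

theorem Slice.continuousAt_lift (h : S.Slice q W O G r n) {q' : M} (hq' : q' ∈ W) :
    ContinuousAt (S.lift q) q' :=
  h.smooth_lift.continuousOn.continuousAt (h.isOpen_W.mem_nhds hq')

end

variable (S : ImmersedSurface M Λ)

theorem continuous_proj : Continuous S.proj := by
  rw [continuous_iff_continuousAt]
  intro q
  obtain ⟨W, O, G, r, n, h⟩ := S.exists_slice q
  have h1 : ContinuousAt (fun q' => toBase Λ (S.lift q q').fst) q :=
    (continuous_toBase.comp fstL.continuous).continuousAt.comp (h.continuousAt_lift h.mem_W)
  refine h1.congr ?_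
  filter_upwards [h.isOpen_W.mem_nhds h.mem_W] with q' hq' using (h.proj_eq hq').symm

variable {S}

theorem IsUnitGeodesicAt.norm_fst_le {ε t : ℝ} {γ : ℝ → M} (h : S.IsUnitGeodesicAt ε γ t) :
    ‖(S.vel γ t).fst‖ ≤ 1 := by
  have := Space.norm_fst_le (flatten ε (S.vel γ t))
  rwa [flatten_fst, h.2] at this

theorem IsUnitGeodesicAt.continuousAt_vel {ε t : ℝ} {γ : ℝ → M} (h : S.IsUnitGeodesicAt ε γ t) :
    ContinuousAt (S.vel γ) t := by
  obtain ⟨W, O, G, r, n, hs⟩ := S.exists_slice (γ t)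
  obtain ⟨a, ha⟩ := (hs.exists_hasDerivAt_vel hs.mem_W h.1.1).2
  exact ha.continuousAt

/-- The projection of a geodesic to the base has a lift to the plane. -/
theorem exists_plane_lift {ε : ℝ} {γ : ℝ → M} (hγ : ∀ t, S.IsUnitGeodesicAt ε γ t) :
    ∃ x : ℝ → Plane, (∀ t, HasDerivAt x (S.vel γ t).fst t) ∧
      ∀ t, toBase Λ (x t) = S.proj (γ t) := by
  obtain ⟨x₀, hx₀⟩ := toBase_surjective (S.proj (γ 0))
  have hf : Continuous fun t => (S.vel γ t).fst :=
    fstL.continuous.comp (continuous_iff_continuousAt.mpr fun t => (hγ t).continuousAt_vel)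
  -- Integrating the horizontal velocity avoids path lifting: the difference between the projected
  -- geodesic and the image of this primitive is locally constant, and zero at time 0.
  set x : ℝ → Plane := fun t => x₀ + ∫ s in (0 : ℝ)..t, (S.vel γ s).fst with hx
  have hxd : ∀ t, HasDerivAt x (S.vel γ t).fst t := fun t =>
    (hf.integral_hasStrictDerivAt 0 t).hasDerivAt.const_add x₀
  refine ⟨x, hxd, ?_⟩
  have hloc : IsLocallyConstant fun t => S.proj (γ t) - toBase Λ (x t) := by
    rw [IsLocallyConstant.iff_eventually_eq]
    intro t
    obtain ⟨W, O, G, r, n, hs⟩ := S.exists_slice (γ t)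
    have h1 := (hs.exists_hasDerivAt_vel hs.mem_W (hγ t).1.1).1
    have h2 : ∀ᶠ s in 𝓝 t, HasDerivAt (fun s => (S.lift (γ t) (γ s)).fst - x s) 0 s := by
      filter_upwards [h1] with s hs
      exact ((HasDerivAt.fst' hs.2).sub (hxd s)).congr_deriv (sub_self _)
    filter_upwards [eventually_eq_of_hasDerivAt_zero h2, h1] with s h3 h4
    rw [hs.proj_eq h4.1, hs.proj_eq hs.mem_W, ← toBase_sub, ← toBase_sub, h3]
  intro t
  have h1 := hloc.apply_eq_of_preconnectedSpace t 0
  simp only [hx, intervalIntegral.integral_same, add_zero, hx₀, sub_self] at h1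
  exact (sub_eq_zero.mp h1).symm

theorem norm_sub_le_of_plane_lift {ε : ℝ} {γ : ℝ → M} (hγ : ∀ t, S.IsUnitGeodesicAt ε γ t)
    {x : ℝ → Plane} (hx : ∀ t, HasDerivAt x (S.vel γ t).fst t) (s t : ℝ) :
    ‖x s - x t‖ ≤ |s - t| := by
  have := convex_univ.norm_image_sub_le_of_norm_hasDerivWithin_le (C := 1)
    (fun t _ => (hx t).hasDerivWithinAt) (fun t _ => (hγ t).norm_fst_le) (mem_univ t) (mem_univ s)
  rwa [one_mul, Real.norm_eq_abs] at this

/-- The 1-Lipschitz property of projected geodesics, expressed by a displacement vector in the plane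
rather than by a distance on B. -/
theorem exists_displacement {ε : ℝ} {γ : ℝ → M} (hγ : ∀ t, S.IsUnitGeodesicAt ε γ t) (s t : ℝ) :
    ∃ y : Plane, ‖y‖ ≤ |s - t| ∧ S.proj (γ s) = S.proj (γ t) + toBase Λ y := by
  obtain ⟨x, hx, hxγ⟩ := exists_plane_lift hγ
  refine ⟨x s - x t, norm_sub_le_of_plane_lift hγ hx s t, ?_⟩
  rw [← hxγ, ← hxγ, ← toBase_add, add_sub_cancel]

theorem IsUnitGeodesicAt.continuous {ε : ℝ} {γ : ℝ → M} (hγ : ∀ t, S.IsUnitGeodesicAt ε γ t) :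
    Continuous γ :=
  continuous_iff_continuousAt.mpr fun t => (hγ t).1.1.continuousAt

/-- Near a point that is isolated in its fibre, geodesics stay for a uniform time. -/
theorem exists_trap [T2Space M] [CompactSpace M] {q : M} {W W' : Set M} (hW : W ∈ 𝓝 q)
    (hW' : W' ∈ 𝓝 q) (hiso : ∀ q' ∈ W', S.proj q' = S.proj q → q' = q) :
    ∃ δ > 0, ∃ V ∈ 𝓝 q, ∀ (ε : ℝ) (γ : ℝ → M) (t₀ : ℝ), (∀ t, S.IsUnitGeodesicAt ε γ t) →
      γ t₀ ∈ V → ∀ t, |t - t₀| < δ → γ t ∈ W := by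
  obtain ⟨C, hC, hCc, hCW⟩ := exists_mem_nhds_isClosed_subset (inter_mem hW hW')
  set B := interior C with hB
  have hqB : q ∈ B := mem_interior_iff_mem_nhds.mpr hC
  have hBC : closure B ⊆ C := closure_minimal interior_subset hCc
  have hfr : IsCompact (frontier B) := isClosed_frontier.isCompact
  -- A curve that leaves B crosses its frontier. The projection of the frontier is compact and
  -- misses π(q), so a displacement of length at least ρ from π(q) is required; half of ρ is spent
  -- on the starting point and half on the elapsed time.
  have hqf : S.proj q ∉ S.proj '' frontier B := by
    rintro ⟨q', hq', he⟩
    have h1 := hiso q' (hCW (hBC (frontier_subset_closure hq'))).2 he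
    rw [h1, isOpen_interior.frontier_eq] at hq'
    exact hq'.2 hqB
  have hopen : IsOpen (S.proj '' frontier B)ᶜ :=
    (hfr.image S.continuous_proj).isClosed.isOpen_compl
  have h1 : ContinuousAt (fun y : Plane => S.proj q + toBase Λ y) 0 :=
    (continuous_const.add continuous_toBase).continuousAt
  have h2 : {y : Plane | S.proj q + toBase Λ y ∈ (S.proj '' frontier B)ᶜ} ∈ 𝓝 (0 : Plane) :=
    h1 (hopen.mem_nhds (by
      change S.proj q + toBase Λ 0 ∈ _
      rw [toBase_zero, add_zero]; exact hqf))
  obtain ⟨ρ, hρ, hρ'⟩ := Metric.mem_nhds_iff.mp h2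
  have h3 : (fun y : Plane => S.proj q + toBase Λ y) '' Metric.ball 0 (ρ / 2) ∈ 𝓝 (S.proj q) := by
    have h4 := ((isOpenMap_add_left (S.proj q)).comp isOpenMap_toBase).image_mem_nhds
      (Metric.ball_mem_nhds (0 : Plane) (half_pos hρ))
    simpa only [Function.comp, toBase_zero, add_zero] using h4
  refine ⟨ρ / 2, by positivity, _, inter_mem (isOpen_interior.mem_nhds hqB)
    (S.continuous_proj.continuousAt h3), ?_⟩
  rintro ε γ t₀ hγ ⟨hB0, y₀, hy₀, hb⟩ t ht
  by_contra htW
  have hcon : IsPreconnected (γ '' uIcc t₀ t) :=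
    isPreconnected_uIcc.image _ (IsUnitGeodesicAt.continuous hγ).continuousOn
  have hsub : ¬ γ '' uIcc t₀ t ⊆ B := fun h =>
    htW (hCW (interior_subset (h ⟨t, right_mem_uIcc, rfl⟩))).1
  have hex : ∃ s ∈ uIcc t₀ t, γ s ∈ frontier B := by
    by_contra! hno
    refine hsub (hcon.subset_left_of_subset_union isOpen_interior isClosed_closure.isOpen_compl
      (disjoint_compl_right.mono_left subset_closure) ?_ ⟨γ t₀, ⟨t₀, left_mem_uIcc, rfl⟩, hB0⟩)
    rintro _ ⟨s, hs, rfl⟩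
    by_cases h3 : γ s ∈ closure B
    · left
      by_contra h4
      exact hno s hs (by rw [isOpen_interior.frontier_eq]; exact ⟨h3, h4⟩)
    · exact Or.inr h3
  obtain ⟨s, hs, hsf⟩ := hex
  obtain ⟨y, hy, hys⟩ := exists_displacement hγ s t₀
  simp only at hb
  have h3 : |s - t₀| ≤ |t - t₀| := abs_sub_left_of_mem_uIcc hs
  have h4 : y₀ + y ∈ Metric.ball (0 : Plane) ρ := by
    rw [mem_ball_zero_iff] at hy₀ ⊢
    linarith [norm_add_le y₀ y]
  refine hρ' h4 ⟨γ s, hsf, ?_⟩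
  rw [hys, ← hb, toBase_add, add_assoc]

end ImmersedSurface

end

/-! ### Regular points and folds -/

theorem inner_ez (x : Space) : ⟪x, ez⟫_ℝ = x.snd := by
  rw [Space.inner_eq]; simp [ez]

theorem ez_snd : ez.snd = 1 := rfl
theorem ez_fst : ez.fst = 0 := rfl

theorem hasStrictFDerivAt_of_smooth {G : Space → ℝ} (hG : ContDiff ℝ ∞ G) (X : Space) :
    HasStrictFDerivAt G (fderiv ℝ G X) X :=
  (hG.contDiffAt (x := X)).hasStrictFDerivAt (by simp)

/-- Near a point where it is not vertical, a level set is a graph over the plane. -/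
theorem eventually_exists_zero {G : Space → ℝ} (hG : ContDiff ℝ ∞ G) {X₀ : Space} (h0 : G X₀ = 0)
    (h₀ : (gradient G X₀).snd ≠ 0) {O : Set Space} (hO : O ∈ 𝓝 X₀) :
    ∀ᶠ x in 𝓝 X₀.fst, ∃ X ∈ O, G X = 0 ∧ X.fst = x := by
  have h1 : HasStrictFDerivAt (fun X : Space => (X.fst, G X)) (fstL.prod (fderiv ℝ G X₀)) X₀ :=
    fstL.hasStrictFDerivAt.prodMk (hasStrictFDerivAt_of_smooth hG X₀)
  have h2 : (fstL.prod (fderiv ℝ G X₀)).range = ⊤ := by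
    rw [eq_top_iff]
    rintro ⟨w, a⟩ -
    refine ⟨WithLp.toLp 2 (w, (a - ⟪(gradient G X₀).fst, w⟫_ℝ) / (gradient G X₀).snd), ?_⟩
    refine Prod.ext rfl ?_
    change fderiv ℝ G X₀ _ = a
    rw [fderiv_eq_inner_gradient, Space.inner_eq]
    change ⟪(gradient G X₀).fst, w⟫_ℝ + (gradient G X₀).snd *
      ((a - ⟪(gradient G X₀).fst, w⟫_ℝ) / (gradient G X₀).snd) = a
    rw [mul_div_cancel₀ _ h₀]
    ring
  have h3 := h1.map_nhds_eq_of_surj h2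
  have h4 : (fun X : Space => (X.fst, G X)) '' O ∈ 𝓝 (X₀.fst, G X₀) := by
    rw [← h3]; exact image_mem_map hO
  have h5 : ContinuousAt (fun x : Plane => (x, (0 : ℝ))) X₀.fst := by fun_prop
  rw [h0] at h4
  filter_upwards [h5 h4] with x hx
  obtain ⟨X, hX, he⟩ := hx
  exact ⟨X, hX, congrArg Prod.snd he, congrArg Prod.fst he⟩

/-- The points of a level set over a given point of the plane are isolated, at regular points
and at folds. -/
theorem eventually_eq_of_fst_eq {G : Space → ℝ} (hG : ContDiff ℝ ∞ G) {X₀ : Space}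
    (h₀ : (gradient G X₀).snd ≠ 0 ∨ IsFold G X₀) :
    ∀ᶠ X in 𝓝 X₀, G X = 0 → X.fst = X₀.fst → X = X₀ := by
  rcases h₀ with h₀ | h₀
  · have h1 : HasDerivAt (fun z : ℝ => X₀ + (z - X₀.snd) • ez) ez X₀.snd := by
      simpa using (((hasDerivAt_id X₀.snd).sub_const X₀.snd).smul_const ez).const_add X₀
    have h2 : HasDerivAt (fun z : ℝ => G (X₀ + (z - X₀.snd) • ez)) (gradient G X₀).snd X₀.snd := by
      have h3 : HasFDerivAt G (fderiv ℝ G X₀) (X₀ + (X₀.snd - X₀.snd) • ez) := by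
        simpa using (hasStrictFDerivAt_of_smooth hG X₀).hasFDerivAt
      refine (h3.comp_hasDerivAt X₀.snd h1).congr_deriv ?_
      rw [fderiv_eq_inner_gradient, inner_ez]
    have h3 := eventually_nhdsWithin_iff.mp (h2.eventually_ne (c := 0) h₀)
    have h4 : ContinuousAt (fun X : Space => X.snd) X₀ := sndL.continuous.continuousAt
    filter_upwards [h4.eventually h3] with X hX hG0 hf
    have h5 : X₀ + (X.snd - X₀.snd) • ez = X := by
      apply Space.ext
      · simp [ez_fst, hf]
      · simp [ez_snd]
    by_contra hne
    refine hX (fun hs => hne (Space.ext hf hs)) ?_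
    rw [h5, hG0]
  · obtain ⟨κ, hκ, H⟩ := h₀.exists_shape hG
    obtain ⟨ρ, hρ, H⟩ := H 1 one_pos
    filter_upwards [Metric.ball_mem_nhds X₀ hρ] with X hX hG0 hf
    rw [Metric.mem_ball, dist_eq_norm] at hX
    have h1 := (H X hX hG0).1
    rw [hf, sub_self, inner_zero_left, norm_zero, mul_zero, add_zero] at h1
    have h2 : (X.snd - X₀.snd) ^ 2 = 0 := by
      have := sq_nonneg (X.snd - X₀.snd)
      nlinarith only [this, hκ, h1]
    exact Space.ext hf (sub_eq_zero.mp (by simpa using h2))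

/-- A local diffeomorphism lifts straight lines. -/
theorem exists_curve_of_hasStrictFDerivAt {E F : Type*} [NormedAddCommGroup E] [NormedSpace ℝ E]
    [NormedAddCommGroup F] [NormedSpace ℝ F] [FiniteDimensional ℝ E] [FiniteDimensional ℝ F]
    {f : E → F} {L : E →L[ℝ] F} {a : E} (hf : HasStrictFDerivAt f L a)
    (hL : Function.Injective L.toLinearMap) (hfr : Module.finrank ℝ E = Module.finrank ℝ F)
    (v : F) : ∃ (c : ℝ → E) (w : E), HasDerivAt c w 0 ∧ c 0 = a ∧ L w = v ∧
      ∀ᶠ s in 𝓝 (0 : ℝ), f (c s) = f a + s • v := by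
  have : CompleteSpace E := FiniteDimensional.complete ℝ E
  set e : E ≃L[ℝ] F :=
    (LinearEquiv.ofInjectiveOfFinrankEq L.toLinearMap hL hfr).toContinuousLinearEquiv with he
  have heL : (e : E →L[ℝ] F) = L := by
    ext x; rfl
  rw [← heL] at hf ⊢
  have hp : HasDerivAt (fun s : ℝ => f a + s • v) v 0 := by
    simpa using ((hasDerivAt_id (0 : ℝ)).smul_const v).const_add (f a)
  have hp0 : f a + (0 : ℝ) • v = f a := by simp
  have hinv := hf.to_localInverse.hasFDerivAt
  have hr := hf.eventually_right_inverse
  refine ⟨fun s => hf.localInverse f e a (f a + s • v), e.symm v, ?_, ?_, e.apply_symm_apply v, ?_⟩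
  · rw [← hp0] at hinv
    exact HasFDerivAt.comp_hasDerivAt (0 : ℝ) hinv hp
  · simp only [hp0]
    exact hf.localInverse_apply_image
  · have h1 := hp.continuousAt
    rw [ContinuousAt, hp0] at h1
    exact h1.eventually hr

/-- A smooth curve in the fold, transversal to the normal. -/
theorem IsFold.exists_curve {G : Space → ℝ} (hG : ContDiff ℝ ∞ G) {X₀ : Space} (h₀ : IsFold G X₀)
    {τ : Plane} (hdec : ∀ p : Plane, ‖p‖ ^ 2 =
      ⟪p, (gradient G X₀).fst⟫_ℝ ^ 2 / ‖(gradient G X₀).fst‖ ^ 2 + ⟪p, τ⟫_ℝ ^ 2) :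
    ∃ (c : ℝ → Space) (w : Space), HasDerivAt c w 0 ∧ c 0 = X₀ ∧ ⟪w.fst, τ⟫_ℝ = 1 ∧
      ⟪(gradient G X₀).fst, w.fst⟫_ℝ = 0 ∧
      ∀ᶠ s in 𝓝 (0 : ℝ), G (c s) = 0 ∧ (gradient G (c s)).snd = 0 := by
  set N := (gradient G X₀).fst with hN
  -- A local diffeomorphism at a fold: the first and third differentials vanish together only on
  -- vertical vectors, on which the second is the nonzero second z-derivative. The fold curve is the
  -- preimage of the line (0, 0, s).
  set f : Space → ℝ × ℝ × ℝ := fun X => (G X, (gradient G X).snd, ⟪X.fst - X₀.fst, τ⟫_ℝ) with hf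
  have hgs : HasStrictFDerivAt (fun X => (gradient G X).snd) (sndL.comp (hess G X₀)) X₀ :=
    sndL.hasStrictFDerivAt.comp X₀
      (((contDiff_gradient hG).contDiffAt (x := X₀)).hasStrictFDerivAt (by simp))
  have hts : HasStrictFDerivAt (fun X : Space => ⟪X.fst - X₀.fst, τ⟫_ℝ)
      ((innerSL ℝ τ).comp fstL) X₀ := by
    have h1 := ((innerSL ℝ τ).comp fstL).hasStrictFDerivAt (x := X₀)
    have h2 := h1.sub_const (⟪τ, X₀.fst⟫_ℝ)
    refine h2.congr_of_eventuallyEq (Eventually.of_forall fun X => ?_)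
    change ⟪τ, X.fst⟫_ℝ - ⟪τ, X₀.fst⟫_ℝ = ⟪X.fst - X₀.fst, τ⟫_ℝ
    rw [← inner_sub_right, real_inner_comm]
  set L : Space →L[ℝ] ℝ × ℝ × ℝ :=
    (fderiv ℝ G X₀).prod ((sndL.comp (hess G X₀)).prod ((innerSL ℝ τ).comp fstL)) with hL
  have hfs : HasStrictFDerivAt f L X₀ :=
    (hasStrictFDerivAt_of_smooth hG X₀).prodMk (hgs.prodMk hts)
  have hLinj : Function.Injective L.toLinearMap := by
    rw [← LinearMap.ker_eq_bot, LinearMap.ker_eq_bot']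
    intro w hw
    have h1 : fderiv ℝ G X₀ w = 0 := congrArg Prod.fst hw
    have h2 : (hess G X₀ w).snd = 0 := congrArg (fun x : ℝ × ℝ × ℝ => x.2.1) hw
    have h3 : ⟪τ, w.fst⟫_ℝ = 0 := congrArg (fun x : ℝ × ℝ × ℝ => x.2.2) hw
    rw [fderiv_eq_inner_gradient, Space.inner_eq, h₀.vert, zero_mul, add_zero] at h1
    have hwf : w.fst = 0 := by
      have e1 := hdec w.fst
      rw [real_inner_comm, h1, real_inner_comm, h3] at e1
      simpa using e1
    have hwe : w = w.snd • ez := by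
      apply Space.ext
      · simp [ez_fst, hwf]
      · simp [ez_snd]
    have hc := h₀.curved
    rw [inner_ez] at hc
    rw [hwe, map_smul, WithLp.smul_snd, smul_eq_mul] at h2
    rcases mul_eq_zero.mp h2 with h | h
    · rw [hwe, h, zero_smul]
    · exact absurd h hc.ne
  have hfr : Module.finrank ℝ Space = Module.finrank ℝ (ℝ × ℝ × ℝ) := by
    rw [finrank_space, Module.finrank_prod, Module.finrank_prod]; simp
  obtain ⟨c, w, hc, hc0, hLw, hfc⟩ := exists_curve_of_hasStrictFDerivAt hfs hLinj hfr (0, 0, 1)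
  have hf0 : f X₀ = (0, 0, 0) := by
    simp only [hf, h₀.zero, h₀.vert, sub_self, inner_zero_left]
  refine ⟨c, w, hc, hc0, ?_, ?_, hfc.mono fun s hs => ?_⟩
  · rw [real_inner_comm]
    exact congrArg (fun x : ℝ × ℝ × ℝ => x.2.2) hLw
  · have h1 : fderiv ℝ G X₀ w = 0 := congrArg Prod.fst hLw
    rwa [fderiv_eq_inner_gradient, Space.inner_eq, h₀.vert, zero_mul, add_zero] at h1
  · have h1 : f (c s) = (0, 0, s) := by
      rw [hs, hf0]; simp
    exact ⟨congrArg Prod.fst h1, congrArg (fun x : ℝ × ℝ × ℝ => x.2.1) h1⟩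

section

/-! ### The surface over the billiard table -/

variable {M : Type*} [TopologicalSpace M] [ChartedSpace Plane M] [IsManifold (𝓡 2) ∞ M]
variable {Λ : AddSubgroup Plane} [DiscreteTopology Λ]

namespace ImmersedSurface

variable {S : ImmersedSurface M Λ} {q : M} {W : Set M} {O : Set Space} {G : Space → ℝ}
  {r : Space → M} {n : Space} {D : Set (Base Λ)}

namespace Slice

/-- The sign of the equation is free, which is how the second z-derivative is made negative at
folds. -/
theorem neg (h : S.Slice q W O G r n) : S.Slice q W O (fun X => -G X) r (-n) where
  isOpen_W := h.isOpen_W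
  mem_W := h.mem_W
  isOpen_O := h.isOpen_O
  smooth_G := h.smooth_G.neg
  smooth_lift := h.smooth_lift
  cover_lift := h.cover_lift
  lift_mem := h.lift_mem
  G_lift q' hq' := by rw [h.G_lift q' hq', neg_zero]
  r_lift := h.r_lift
  smooth_r := h.smooth_r
  r_mem X hX hG := h.r_mem X hX (by simpa using hG)
  lift_r X hX := by rw [h.lift_r X hX, neg_smul_neg]

theorem ez_mem_iff (h : S.Slice q W O G r n) {q' : M} (hq' : q' ∈ W) :
    ez ∈ S.tangentPlane q' ↔ (gradient G (S.lift q q')).snd = 0 := by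
  rw [h.mem_tangentPlane hq', inner_ez]

theorem proj_r (h : S.Slice q W O G r n) {X : Space} (hX : X ∈ O) (hG : G X = 0) :
    S.proj (r X) = toBase Λ X.fst ∧ r X ∈ W ∧ S.lift q (r X) = X := by
  have h1 := h.r_mem X hX hG
  have h2 : S.lift q (r X) = X := by rw [h.lift_r X hX, hG, zero_smul, sub_zero]
  exact ⟨by rw [h.proj_eq h1, h2], h1, h2⟩

/-- Where its tangent plane is not vertical the surface is a graph and covers a neighbourhood of the
projected point. -/
theorem mem_interior_shadow (h : S.Slice q W O G r n) {q' : M} (hq' : q' ∈ W)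
    (h0 : (gradient G (S.lift q q')).snd ≠ 0) : S.proj q' ∈ interior S.shadow := by
  rw [mem_interior_iff_mem_nhds, h.proj_eq hq']
  have h1 := eventually_exists_zero h.smooth_G (h.G_lift q' hq') h0
    (h.isOpen_O.mem_nhds (h.lift_mem q' hq'))
  refine mem_of_superset (isOpenMap_toBase.image_mem_nhds h1) ?_
  rintro _ ⟨x, ⟨X, hX, hG, rfl⟩, rfl⟩
  exact ⟨r X, (h.proj_r hX hG).1⟩

theorem mem_frontier_iff (h : S.Slice q W O G r n) (hD : IsClosed D) (hSD : S.shadow = D)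
    (h_interior : ∀ q : M, S.proj q ∈ interior D → ez ∉ S.tangentPlane q) {q' : M} (hq' : q' ∈ W) :
    S.proj q' ∈ frontier D ↔ (gradient G (S.lift q q')).snd = 0 := by
  have hmem : S.proj q' ∈ D := hSD ▸ mem_range_self q'
  rw [hD.frontier_eq]
  constructor
  · rintro ⟨-, h1⟩
    by_contra h2
    exact h1 (hSD ▸ h.mem_interior_shadow hq' h2)
  · exact fun h1 => ⟨hmem, fun h2 => h_interior q' h2 ((h.ez_mem_iff hq').mpr h1)⟩

/-- A curved vertical section at a point with a vertical tangent plane makes a fold. -/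
theorem hess_ne_zero (h : S.Slice q W O G r n) (h0 : (gradient G (S.lift q q)).snd = 0)
    (hc : S.HasCurvedVerticalSection q) : ⟪hess G (S.lift q q) ez, ez⟫_ℝ ≠ 0 := by
  intro hzero
  obtain ⟨c, hcs, hc0, hcP, hreg, hcurv⟩ := hc
  set C : ℝ → Space := fun s => S.lift q (c s) with hC
  set N := gradient G (S.lift q q) with hN
  have hcW : ∀ᶠ s in 𝓝 (0 : ℝ), c s ∈ W :=
    hcs.continuous.continuousAt.eventually (h.isOpen_W.mem_nhds (by rw [hc0]; exact h.mem_W))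
  have hCs : ContDiffAt ℝ 2 C 0 := by
    rw [← contMDiffAt_iff_contDiffAt]
    refine ContMDiffAt.comp (g := S.lift q) (0 : ℝ) ?_ (hcs.contMDiffAt.of_le (by norm_cast))
    rw [hc0]
    exact (h.smooth_lift.contMDiffAt (h.isOpen_W.mem_nhds h.mem_W)).of_le (by norm_cast)
  have hC1 : ∀ᶠ s in 𝓝 (0 : ℝ), HasDerivAt C (deriv C s) s := by
    filter_upwards [hCs.eventually (by simp)] with s hs
    exact (hs.differentiableAt (by simp)).hasDerivAt
  have hC2 : HasDerivAt (deriv C) (iteratedDeriv 2 C 0) 0 := by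
    have h3 : DifferentiableAt ℝ (deriv C) 0 := ((hCs.fderiv_right (m := 1) (by norm_num)).clm_apply
      (contDiffAt_const (c := (1 : ℝ)))).differentiableAt (by simp)
    rw [iteratedDeriv_succ, iteratedDeriv_one]
    exact h3.hasDerivAt
  have hC0 : C 0 = S.lift q q := by rw [hC]; simp only [hc0]
  have hT : ∀ X : Space, X ∈ S.tangentPlane q ↔ ⟪N, X⟫_ℝ = 0 := h.mem_tangentPlane h.mem_W
  -- Since e_z is tangent, the cutting plane meets the tangent plane only in the vertical line.
  have hdec : ∀ X : Space, (∀ w ∈ (Submodule.span ℝ {ez} ⊔ (S.tangentPlane q)ᗮ)ᗮ, ⟪w, X⟫_ℝ = 0) →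
      ⟪N, X⟫_ℝ = 0 → ∃ a : ℝ, X = a • ez := fun X hX hNX => by
    have h1 : X ∈ (Submodule.span ℝ {ez} ⊔ (S.tangentPlane q)ᗮ)ᗮᗮ :=
      (Submodule.mem_orthogonal _ _).mpr hX
    rw [Submodule.orthogonal_orthogonal] at h1
    obtain ⟨y, hy, z, hz, rfl⟩ := Submodule.mem_sup.mp h1
    obtain ⟨a, rfl⟩ := Submodule.mem_span_singleton.mp hy
    have h2 : z ∈ S.tangentPlane q := by
      rw [hT]
      rw [inner_add_right, real_inner_smul_right, inner_ez, h0, mul_zero, zero_add] at hNX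
      exact hNX
    have h3 : z = 0 := by
      rw [← inner_self_eq_zero (𝕜 := ℝ)]
      exact (Submodule.mem_orthogonal _ _).mp hz z h2
    exact ⟨a, by rw [h3, add_zero]⟩
  have hw1 : ∀ w ∈ (Submodule.span ℝ {ez} ⊔ (S.tangentPlane q)ᗮ)ᗮ,
      ∀ᶠ s in 𝓝 (0 : ℝ), ⟪w, deriv C s⟫_ℝ = 0 := fun w hw => by
    have h1 : ∀ᶠ s in 𝓝 (0 : ℝ), ⟪w, C s⟫_ℝ = ⟪w, S.lift q q⟫_ℝ := hcP.mono fun s hs => by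
      have := (Submodule.mem_orthogonal' _ _).mp hw _ hs
      rwa [inner_sub_right, sub_eq_zero] at this
    filter_upwards [hC1, h1.eventually_nhds] with s hs hs'
    have h2 : HasDerivAt (fun s => ⟪w, C s⟫_ℝ) (⟪w, deriv C s⟫_ℝ) s :=
      (innerSL ℝ w).hasFDerivAt.comp_hasDerivAt s hs
    exact h2.unique ((hasDerivAt_const s _).congr_of_eventuallyEq hs')
  have hw2 : ∀ w ∈ (Submodule.span ℝ {ez} ⊔ (S.tangentPlane q)ᗮ)ᗮ,
      ⟪w, iteratedDeriv 2 C 0⟫_ℝ = 0 := fun w hw => by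
    have h2 : HasDerivAt (fun s => ⟪w, deriv C s⟫_ℝ) (⟪w, iteratedDeriv 2 C 0⟫_ℝ) 0 :=
      (innerSL ℝ w).hasFDerivAt.comp_hasDerivAt 0 hC2
    exact h2.unique ((hasDerivAt_const _ _).congr_of_eventuallyEq (hw1 w hw))
  have hg1 : ∀ᶠ s in 𝓝 (0 : ℝ), ⟪gradient G (C s), deriv C s⟫_ℝ = 0 := by
    have h1 : ∀ᶠ s in 𝓝 (0 : ℝ), G (C s) = 0 := hcW.mono fun s hs => h.G_lift _ hs
    filter_upwards [hC1, h1.eventually_nhds] with s hs hs'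
    have h2 := (hasStrictFDerivAt_of_smooth h.smooth_G (C s)).hasFDerivAt.comp_hasDerivAt s hs
    rw [fderiv_eq_inner_gradient] at h2
    exact h2.unique ((hasDerivAt_const s _).congr_of_eventuallyEq hs')
  obtain ⟨a, ha⟩ := hdec (deriv C 0) (fun w hw => (hw1 w hw).self_of_nhds) (by
    have := hg1.self_of_nhds
    rwa [hC0] at this)
  -- Differentiating ⟪∇G, C'⟫ = 0 gives ⟪Hess C', C'⟫ + ⟪∇G, C''⟫ = 0. As C' is vertical and the
  -- second z-derivative is assumed zero, C'' is tangent, hence also vertical, and the curvature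
  -- vanishes.
  obtain ⟨b, hb⟩ := hdec (iteratedDeriv 2 C 0) hw2 (by
    have h1 := ((hasFDerivAt_gradient h.smooth_G (C 0)).comp_hasDerivAt (0 : ℝ)
      hC1.self_of_nhds).inner ℝ hC2
    have h2 := h1.unique ((hasDerivAt_const _ _).congr_of_eventuallyEq hg1)
    simp only [Function.comp] at h2
    rw [ha, map_smul, real_inner_smul_left, real_inner_smul_right, hC0, hzero] at h2
    rwa [mul_zero, mul_zero, add_zero] at h2)
  apply hcurv
  rw [curvature, ha, hb, norm_smul, norm_smul, real_inner_smul_left, real_inner_smul_right,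
    real_inner_self_eq_norm_sq, norm_ez, Real.norm_eq_abs, Real.norm_eq_abs]
  have : (|a| * 1) ^ 2 * (|b| * 1) ^ 2 - (a * (b * 1 ^ 2)) ^ 2 = 0 := by
    rw [mul_one, mul_one, sq_abs, sq_abs]; ring
  rw [this]
  simp

end Slice

/-- The surface folds over the boundary of the table. -/
theorem exists_slice_fold (hD : IsClosed D) (hSD : S.shadow = D)
    (h_interior : ∀ q : M, S.proj q ∈ interior D → ez ∉ S.tangentPlane q) (hq : S.proj q ∈ frontier D)
    (hc : S.HasCurvedVerticalSection q) :
    ∃ W O G r n, S.Slice q W O G r n ∧ IsFold G (S.lift q q) := by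
  obtain ⟨W, O, G, r, n, h⟩ := S.exists_slice q
  have h1 := (h.mem_frontier_iff hD hSD h_interior h.mem_W).mp hq
  have h2 := h.hess_ne_zero h1 hc
  have h3 : (gradient G (S.lift q q)).fst ≠ 0 := fun h4 =>
    h.gradient_ne_zero h.mem_W (Space.ext h4 h1)
  rcases lt_or_gt_of_ne h2 with h4 | h4
  · exact ⟨W, O, G, r, n, h, h.G_lift q h.mem_W, h1, h3, h4⟩
  · have hg : gradient (fun X => -G X) = fun X => -gradient G X := by
      funext X
      rw [gradient, gradient, fderiv_fun_neg, map_neg]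
    refine ⟨W, O, _, r, _, h.neg, ?_, ?_, ?_, ?_⟩
    · rw [h.G_lift q h.mem_W, neg_zero]
    · rw [hg]; simpa using h1
    · rw [hg]; simpa using h3
    · rw [hess, hg, fderiv_fun_neg, _root_.neg_apply, inner_neg_left]
      linarith

/-- This reduces to isolation in the level set: two nearby lifts with the same image in B have the
same horizontal part. -/
theorem Slice.isolated (h : S.Slice q W O G r n)
    (h₀ : (gradient G (S.lift q q)).snd ≠ 0 ∨ IsFold G (S.lift q q)) :
    ∃ W' ∈ 𝓝 q, W' ⊆ W ∧ ∀ q' ∈ W', S.proj q' = S.proj q → q' = q := by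
  obtain ⟨ρ, hρ, hρ'⟩ := exists_eq_of_toBase_eq Λ
  have h1 := (h.continuousAt_lift h.mem_W).eventually (eventually_eq_of_fst_eq h.smooth_G h₀)
  have h2 := (h.continuousAt_lift h.mem_W).eventually (Metric.ball_mem_nhds _ hρ)
  refine ⟨_, inter_mem (h.isOpen_W.mem_nhds h.mem_W) (inter_mem h1 h2), inter_subset_left, ?_⟩
  rintro q' ⟨hq', h3, h4⟩ he
  rw [h.proj_eq hq', h.proj_eq h.mem_W] at he
  have h5 : ‖(S.lift q q').fst - (S.lift q q).fst‖ < ρ := by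
    have h6 := Space.norm_fst_le (S.lift q q' - S.lift q q)
    have h7 : dist (S.lift q q') (S.lift q q) < ρ := h4
    rw [dist_eq_norm] at h7
    exact h6.trans_lt h7
  have h6 := h3 (h.G_lift q' hq') (hρ' _ _ h5 he)
  rw [← h.r_lift q' hq', h6, h.r_lift q h.mem_W]

/-- At a fold the boundary of the table is orthogonal to the gradient. -/
theorem Slice.exists_eq_smul_of_isUnitNormal (h : S.Slice q W O G r n) (hf : IsFold G (S.lift q q))
    (hD : IsClosed D) (hSD : S.shadow = D)
    (h_interior : ∀ q : M, S.proj q ∈ interior D → ez ∉ S.tangentPlane q) {m : Plane}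
    (hm : IsUnitNormal D (S.proj q) m) :
    ∃ a : ℝ, m = a • (gradient G (S.lift q q)).fst ∧ a ^ 2 * ‖(gradient G (S.lift q q)).fst‖ ^ 2 = 1
      := by
  set N := (gradient G (S.lift q q)).fst with hN
  obtain ⟨hm1, b, ⟨hb, hb0, hbD⟩, a, ha⟩ := hm
  obtain ⟨τ, hτ, hNτ, hdec⟩ := exists_unit_normal_vector hf.hor
  obtain ⟨c, w, hc, hc0, hwτ, hNw, hcG⟩ := hf.exists_curve h.smooth_G hdec
  have ha0 : a ≠ 0 := fun h0 => hb0 (by ext w; rw [ha w, h0]; simp)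
  have hcO : ∀ᶠ s in 𝓝 (0 : ℝ), c s ∈ O :=
    hc.continuousAt.eventually (h.isOpen_O.mem_nhds (by rw [hc0]; exact h.lift_mem q h.mem_W))
  have hdy : HasDerivAt (fun s => (c s).fst - (S.lift q q).fst) w.fst 0 :=
    (HasDerivAt.fst' hc).sub_const _
  have hy0 : (c 0).fst - (S.lift q q).fst = 0 := by rw [hc0, sub_self]
  -- The fold curve projects into the boundary of the table, so its horizontal velocity, which turns
  -- out to be τ, is orthogonal to m.
  have hz : ∀ᶠ s in 𝓝 (0 : ℝ), b ((c s).fst - (S.lift q q).fst) = 0 := by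
    have h1 := hdy.continuousAt
    rw [ContinuousAt, hy0] at h1
    filter_upwards [hcG, hcO, h1.eventually hbD] with s h2 h3 h4
    rw [← h4]
    obtain ⟨h5, h6, h7⟩ := h.proj_r h3 h2.1
    rw [h.proj_eq h.mem_W, ← toBase_add, add_sub_cancel, ← h5,
      h.mem_frontier_iff hD hSD h_interior h6, h7]
    exact h2.2
  have h1 : HasFDerivAt b (fderiv ℝ b 0) ((c 0).fst - (S.lift q q).fst) := by
    rw [hy0]
    exact (hb.differentiable (by simp) _).hasFDerivAt
  have h2 := (h1.comp_hasDerivAt (0 : ℝ) hdy).unique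
    ((hasDerivAt_const _ (0 : ℝ)).congr_of_eventuallyEq hz)
  rw [ha, mul_eq_zero, or_iff_right ha0] at h2
  have hN0 : ‖N‖ ^ 2 ≠ 0 := by simpa using hf.hor
  have hNτ' : ⟪τ, N⟫_ℝ = 0 := by rw [real_inner_comm]; exact hNτ
  have hdec' : ∀ p : Plane, ⟪p, N⟫_ℝ = 0 → ⟪p, τ⟫_ℝ = 0 → p = 0 := fun p h1 h2 => by
    have := hdec p
    rw [← hN, h1, h2] at this
    simpa using this
  have hwτ' : w.fst = τ := by
    rw [← sub_eq_zero]
    apply hdec'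
    · rw [inner_sub_left, real_inner_comm, hNw, hNτ', sub_self]
    · rw [inner_sub_left, hwτ, real_inner_self_eq_norm_sq, hτ]; norm_num
  rw [hwτ'] at h2
  have h3 : m = (⟪m, N⟫_ℝ / ‖N‖ ^ 2) • N := by
    rw [← sub_eq_zero]
    apply hdec'
    · rw [inner_sub_left, real_inner_smul_left, real_inner_self_eq_norm_sq, div_mul_cancel₀ _ hN0,
        sub_self]
    · rw [inner_sub_left, real_inner_smul_left, h2, hNτ, mul_zero, sub_self]
  refine ⟨_, h3, ?_⟩
  have h4 : ‖m‖ ^ 2 = 1 := by rw [hm1, one_pow]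
  rw [h3, norm_smul, mul_pow, Real.norm_eq_abs, sq_abs] at h4
  exact h4

end ImmersedSurface

end

section

/-! ### Convergence along a billiard trajectory -/

/-- Look at the infimum of the bad times: `lim` makes it a good time, and `step` then keeps bad
times away from it. -/
theorem Icc_induction {T : ℝ} {p : ℝ → Prop} (h0 : p 0)
    (step : ∀ s, 0 ≤ s → s < T → (∀ s', 0 ≤ s' → s' ≤ s → p s') →
      ∃ δ > 0, ∀ s', s < s' → s' < s + δ → s' ≤ T → p s')
    (lim : ∀ s, 0 < s → s ≤ T → (∀ s', 0 ≤ s' → s' < s → p s') → p s) :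
    ∀ s ∈ Icc 0 T, p s := by
  by_contra! hbad
  set B := {s | s ∈ Icc 0 T ∧ ¬ p s} with hB
  have hne : B.Nonempty := hbad
  have hbdd : BddBelow B := ⟨0, fun s hs => hs.1.1⟩
  obtain ⟨s₁, hs₁, hs₁'⟩ := hbad
  set b := sInf B with hb
  have hb0 : 0 ≤ b := le_csInf hne fun s hs => hs.1.1
  have hbs : b ≤ s₁ := csInf_le hbdd ⟨hs₁, hs₁'⟩
  have hlt : ∀ s', 0 ≤ s' → s' < b → p s' := fun s' h1 h2 => by
    by_contra h3
    exact notMem_of_lt_csInf h2 hbdd ⟨⟨h1, (h2.le.trans hbs).trans hs₁.2⟩, h3⟩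
  have hpb : p b := by
    rcases hb0.eq_or_lt with h1 | h1
    · rw [← h1]; exact h0
    · exact lim b h1 (hbs.trans hs₁.2) hlt
  have hbT : b < T := lt_of_lt_of_le (lt_of_le_of_ne hbs fun h => hs₁' (h ▸ hpb)) hs₁.2
  obtain ⟨δ, hδ, hstep⟩ := step b hb0 hbT fun s' h1 h2 => by
    rcases h2.eq_or_lt with rfl | h2
    · exact hpb
    · exact hlt s' h1 h2
  obtain ⟨s, hsB, hs⟩ := exists_lt_of_csInf_lt hne (show sInf B < b + δ by linarith)
  have h1 : b ≤ s := csInf_le hbdd hsB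
  exact hsB.2 (hstep s (lt_of_le_of_ne h1 fun h => hsB.2 (h ▸ hpb)) hs hsB.1.2)

variable {M : Type*} [TopologicalSpace M] [ChartedSpace Plane M] [IsManifold (𝓡 2) ∞ M]
variable {Λ : AddSubgroup Plane} [DiscreteTopology Λ]

section Path

variable {D : Set (Base Λ)} {I : Set ℝ} {c : ℝ → Base Λ} {v : ℝ → Plane}

theorem mem_interior_or_frontier (hD : IsClosed D) {b : Base Λ} (hb : b ∈ D) :
    b ∈ interior D ∨ b ∈ frontier D := by
  rw [hD.frontier_eq]
  by_cases h : b ∈ interior D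
  exacts [Or.inl h, Or.inr ⟨hb, h⟩]

theorem notMem_frontier_of_mem_interior {b : Base Λ} (hb : b ∈ interior D) : b ∉ frontier D :=
  fun h => h.2 hb

theorem IsBilliardPath.exists_left (hc : IsBilliardPath D I c v) (hD : IsClosed D) {s : ℝ}
    (hs : s ∈ I) : ∃ w : Plane, ∃ δ > 0, ∀ s' ∈ I, s - δ < s' → s' < s →
      c s' = c s + toBase Λ ((s' - s) • w) := by
  rcases mem_interior_or_frontier hD (hc.mem s hs) with h | h
  · obtain ⟨-, δ, hδ, H⟩ := hc.free s hs h
    exact ⟨v s, δ, hδ, fun s' hs' h1 h2 =>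
      (H s' hs' (by rw [abs_of_neg (by linarith)]; linarith)).2⟩
  · obtain ⟨_, v₁, _, -, -, -, δ, hδ, H⟩ := hc.reflect s hs h
    exact ⟨v₁, δ, hδ, fun s' hs' h1 h2 => ((H s' hs').1 h1 h2).2⟩

/-- A line that is transversal to the boundary leaves it. -/
theorem eventually_notMem_frontier {b : Base Λ} {m v₁ : Plane} (hm : IsUnitNormal D b m)
    (h : ⟪v₁, m⟫_ℝ ≠ 0) : ∀ᶠ s in 𝓝[≠] (0 : ℝ), b + toBase Λ (s • v₁) ∉ frontier D := by
  obtain ⟨-, g, ⟨hg, hg0, hgD⟩, a, ha⟩ := hm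
  have ha0 : a ≠ 0 := fun h0 => hg0 (by ext w; rw [ha w, h0]; simp)
  have h1 : HasDerivAt (fun s : ℝ => s • v₁) v₁ 0 := by
    simpa using (hasDerivAt_id (0 : ℝ)).smul_const v₁
  have h2 : HasFDerivAt g (fderiv ℝ g 0) ((0 : ℝ) • v₁) := by
    rw [zero_smul]; exact (hg.differentiable (by simp) _).hasFDerivAt
  have h3 := (h2.comp_hasDerivAt (0 : ℝ) h1).eventually_ne (c := 0) (by
    rw [ha, real_inner_comm]; exact mul_ne_zero ha0 h)
  have h4 := h1.continuousAt
  rw [ContinuousAt, zero_smul] at h4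
  filter_upwards [h3, (h4.eventually hgD).filter_mono nhdsWithin_le_nhds] with s h5 h6
  exact fun h7 => h5 (h6.mp h7)

end Path

namespace ImmersedSurface

variable {S : ImmersedSurface M Λ} {D : Set (Base Λ)}

theorem exists_isolated (hD : IsClosed D) (hSD : S.shadow = D)
    (h_interior : ∀ q : M, S.proj q ∈ interior D → ez ∉ S.tangentPlane q)
    (h_boundary : ∀ q : M, S.proj q ∈ frontier D → S.HasCurvedVerticalSection q) (q : M) :
    ∃ W' ∈ 𝓝 q, ∀ q' ∈ W', S.proj q' = S.proj q → q' = q := by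
  rcases mem_interior_or_frontier hD (hSD ▸ mem_range_self q : S.proj q ∈ D) with h | h
  · obtain ⟨W, O, G, r, n, hs⟩ := S.exists_slice q
    obtain ⟨W', hW', -, H⟩ := hs.isolated (Or.inl fun h0 =>
      h_interior q h ((hs.ez_mem_iff hs.mem_W).mpr h0))
    exact ⟨W', hW', H⟩
  · obtain ⟨W, O, G, r, n, hs, hf⟩ := exists_slice_fold hD hSD h_interior h (h_boundary q h)
    obtain ⟨W', hW', -, H⟩ := hs.isolated (Or.inr hf)
    exact ⟨W', hW', H⟩

variable {ι : Type*} {U : Ultrafilter ι} {ε : ι → ℝ} {γ : ι → ℝ → M} [T2Space M] [CompactSpace M]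
  {q : M} {t₀ : ℝ}

/-- Near a limit point, a family of geodesics is an equicontinuous family of geodesics of a level
set. -/
theorem Slice.exists_flatGeodesicAt {W : Set M} {O : Set Space} {G : Space → ℝ}
    {r : Space → M} {n : Space} (h : S.Slice q W O G r n)
    (hiso : ∀ q : M, ∃ W' ∈ 𝓝 q, ∀ q' ∈ W', S.proj q' = S.proj q → q' = q)
    (hε0 : ∀ᶠ i in U, 0 < ε i) (hgeo : ∀ᶠ i in U, ∀ t, S.IsUnitGeodesicAt (ε i) (γ i) t)
    (hq : Tendsto (fun i => γ i t₀) U (𝓝 q)) :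
    ∃ δ > 0, (∀ᶠ i in U, ∀ s, |s - t₀| < δ → γ i s ∈ W ∧
        FlatGeodesicAt G (ε i) (fun s => S.lift q (γ i s)) (S.vel (γ i)) s) ∧
      (∀ t, |t - t₀| < δ → ∀ ρ > 0, ∃ δ' > 0, ∀ᶠ i in U, ∀ s, |s - t| < δ' →
        ‖S.lift q (γ i s) - S.lift q (γ i t)‖ < ρ) ∧
      Tendsto (fun i => S.lift q (γ i t₀)) U (𝓝 (S.lift q q)) := by
  obtain ⟨C, hC, hCc, hCW⟩ := exists_mem_nhds_isClosed_subset (h.isOpen_W.mem_nhds h.mem_W)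
  obtain ⟨W', hW', hi⟩ := hiso q
  obtain ⟨δ, hδ, V, hV, H⟩ := exists_trap hC hW' hi
  have hev : ∀ᶠ i in U, ∀ s, |s - t₀| < δ → γ i s ∈ C := by
    filter_upwards [hgeo, hq hV] with i h1 h2
    exact H (ε i) (γ i) t₀ h1 h2
  refine ⟨δ, hδ, ?_, fun t ht ρ hρ => ?_, (h.continuousAt_lift h.mem_W).tendsto.comp hq⟩
  · filter_upwards [hev, hgeo, hε0] with i h1 h2 h3 s hs
    have h4 := hCW (h1 s hs)
    exact ⟨h4, h.flatGeodesicAt h3.ne' h4 (h2 s).1 (h2 s).2⟩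
  -- At the time t the geodesics accumulate at a single point p, isolated in its fibre, so they are
  -- trapped in any small neighbourhood of p for a common time. This replaces a bound on the
  -- vertical velocity.
  · obtain ⟨p, hpC, hp⟩ := Ultrafilter.exists_tendsto_of_isCompact U hCc.isCompact
      (g := fun i => γ i t) (hev.mono fun i hi => hi t ht)
    obtain ⟨Wp, hWp, hip⟩ := hiso p
    have hN : {q' | dist (S.lift q q') (S.lift q p) < ρ / 2} ∈ 𝓝 p :=
      (h.continuousAt_lift (hCW hpC)) (Metric.ball_mem_nhds _ (half_pos hρ))
    obtain ⟨δ', hδ', V', hV', H'⟩ := exists_trap hN hWp hip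
    refine ⟨δ', hδ', ?_⟩
    filter_upwards [hgeo, hp hV'] with i h1 h2 s hs
    have h3 : dist _ _ < ρ / 2 := H' (ε i) (γ i) t h1 h2 s hs
    have h4 : dist _ _ < ρ / 2 := H' (ε i) (γ i) t h1 h2 t (by simpa using hδ')
    rw [← dist_eq_norm]
    linarith [dist_triangle_right (S.lift q (γ i s)) (S.lift q (γ i t)) (S.lift q p)]

/-- Over the interior of the table, the limits of the geodesics are straight lines. -/
theorem exists_limit_of_mem_interior
    (hiso : ∀ q : M, ∃ W' ∈ 𝓝 q, ∀ q' ∈ W', S.proj q' = S.proj q → q' = q)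
    (hε0 : ∀ᶠ i in U, 0 < ε i) (hε : Tendsto ε U (𝓝 0))
    (hgeo : ∀ᶠ i in U, ∀ t, S.IsUnitGeodesicAt (ε i) (γ i) t)
    (hq : Tendsto (fun i => γ i t₀) U (𝓝 q)) (hreg : ez ∉ S.tangentPlane q) :
    ∃ δ > 0, ∃ V : Plane, ‖V‖ = 1 ∧
      (∃ C, ∀ᶠ i in U, ∀ s, |s - t₀| < δ →
        ‖(S.vel (γ i) s).fst - (S.vel (γ i) t₀).fst‖ ≤ C * ε i ^ 2) ∧
      ∀ s, |s - t₀| < δ → Tendsto (fun i => (S.vel (γ i) s).fst) U (𝓝 V) ∧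
        Tendsto (fun i => S.proj (γ i s)) U (𝓝 (S.proj q + toBase Λ ((s - t₀) • V))) := by
  obtain ⟨W, O, G, r, n, h⟩ := S.exists_slice q
  obtain ⟨δ₀, hδ₀, h1, h2, h3⟩ := h.exists_flatGeodesicAt hiso hε0 hgeo hq
  obtain ⟨δ, hδ, V, hV, hC, hlim⟩ := exists_regular_limit h.smooth_G hε0 hε hδ₀
    (h1.mono fun i hi s hs => (hi s hs).2) (h2 t₀ (by simpa using hδ₀)) h3
    (fun h0 => hreg ((h.ez_mem_iff h.mem_W).mpr h0))
  refine ⟨min δ δ₀, by positivity, V, hV, ?_, fun s hs => ?_⟩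
  · obtain ⟨C, hC⟩ := hC
    exact ⟨C, hC.mono fun i hi s hs => hi s (hs.trans_le (min_le_left _ _))⟩
  · obtain ⟨h4, h5⟩ := hlim s (hs.trans_le (min_le_left _ _))
    refine ⟨h4, ?_⟩
    rw [h.proj_eq h.mem_W, ← toBase_add]
    refine ((continuous_toBase.tendsto _).comp h5).congr' ?_
    filter_upwards [h1] with i hi
    exact (h.proj_eq (hi s (hs.trans_le (min_le_right _ _))).1).symm

/-- The limits of the geodesics bounce at the boundary of the table. -/
theorem exists_limit_of_mem_frontier (hD : IsClosed D) (hSD : S.shadow = D)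
    (h_interior : ∀ q : M, S.proj q ∈ interior D → ez ∉ S.tangentPlane q)
    (h_boundary : ∀ q : M, S.proj q ∈ frontier D → S.HasCurvedVerticalSection q)
    (hε0 : ∀ᶠ i in U, 0 < ε i) (hε : Tendsto ε U (𝓝 0))
    (hgeo : ∀ᶠ i in U, ∀ t, S.IsUnitGeodesicAt (ε i) (γ i) t)
    (hq : Tendsto (fun i => γ i t₀) U (𝓝 q)) (hqD : S.proj q ∈ frontier D) {m v₁ : Plane}
    (hm : IsUnitNormal D (S.proj q) m) (hv₁ : ‖v₁‖ = 1) (hv₁m : ⟪v₁, m⟫_ℝ ≠ 0) {δ₁ : ℝ}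
    (hδ₁ : 0 < δ₁)
    (hin : ∀ t, t₀ - δ₁ < t → t < t₀ → Tendsto (fun i => (S.vel (γ i) t).fst) U (𝓝 v₁)) :
    ∃ δ > 0, ∀ t, t₀ < t → t < t₀ + δ →
      Tendsto (fun i => (S.vel (γ i) t).fst) U (𝓝 (v₁ - (2 * ⟪v₁, m⟫_ℝ) • m)) ∧
      Tendsto (fun i => S.proj (γ i t)) U
        (𝓝 (S.proj q + toBase Λ ((t - t₀) • (v₁ - (2 * ⟪v₁, m⟫_ℝ) • m)))) := by
  have hiso := exists_isolated hD hSD h_interior h_boundary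
  obtain ⟨W, O, G, r, n, h, hf⟩ := exists_slice_fold hD hSD h_interior hqD (h_boundary q hqD)
  obtain ⟨δ₀, hδ₀, h1, h2, h3⟩ := h.exists_flatGeodesicAt hiso hε0 hgeo hq
  obtain ⟨a, rfl, haN⟩ := h.exists_eq_smul_of_isUnitNormal hf hD hSD h_interior hm
  set N := (gradient G (S.lift q q)).fst with hN
  rw [real_inner_smul_right] at hv₁m
  obtain ⟨δ, hδ, hlim⟩ := hf.collision h.smooth_G (δ₀ := min δ₀ δ₁) (by positivity) hε0 hε
    (h1.mono fun i hi s hs => (hi s (hs.trans_le (min_le_left _ _))).2)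
    (fun t ht => h2 t (ht.trans_le (min_le_left _ _))) h3
    (fun t ht ht' => hin t (by linarith [min_le_right δ₀ δ₁]) ht') hv₁ (right_ne_zero_of_mul hv₁m)
  have hw : v₁ - (2 * ⟪v₁, N⟫_ℝ / ‖N‖ ^ 2) • N = v₁ - (2 * ⟪v₁, a • N⟫_ℝ) • a • N := by
    have hN0 : ‖N‖ ^ 2 ≠ 0 := by simpa using hf.hor
    rw [real_inner_smul_right, smul_smul]
    congr 2
    rw [div_eq_iff hN0]
    linear_combination (-2 * ⟪v₁, N⟫_ℝ) * haN
  rw [← hN, hw] at hlim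
  refine ⟨min δ δ₀, by positivity, fun t ht ht' => ?_⟩
  obtain ⟨h4, h5⟩ := hlim t ht (by linarith [min_le_left δ δ₀])
  refine ⟨h4, ?_⟩
  rw [h.proj_eq h.mem_W, ← toBase_add]
  refine ((continuous_toBase.tendsto _).comp h5).congr' ?_
  filter_upwards [h1] with i hi
  refine (h.proj_eq (hi t ?_).1).symm
  rw [abs_of_pos (by linarith)]
  linarith [min_le_right δ δ₀]

/-- Geodesics of the flattened surfaces converge to billiard trajectories. -/
theorem tendsto_of_isBilliardPath (hD : IsClosed D) (hSD : S.shadow = D)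
    (h_interior : ∀ q : M, S.proj q ∈ interior D → ez ∉ S.tangentPlane q)
    (h_boundary : ∀ q : M, S.proj q ∈ frontier D → S.HasCurvedVerticalSection q)
    (hε0 : ∀ᶠ i in U, 0 < ε i) (hε : Tendsto ε U (𝓝 0))
    (hgeo : ∀ᶠ i in U, ∀ t, S.IsUnitGeodesicAt (ε i) (γ i) t) {T : ℝ} {c : ℝ → Base Λ}
    {v : ℝ → Plane} (hc : IsBilliardPath D (Icc 0 T) c v) (hc0 : c 0 ∈ interior D)
    (hpos : Tendsto (fun i => S.proj (γ i 0)) U (𝓝 (c 0)))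
    (hvel : Tendsto (fun i => (S.vel (γ i) 0).fst) U (𝓝 (v 0))) :
    ∀ s ∈ Icc 0 T, Tendsto (fun i => S.proj (γ i s)) U (𝓝 (c s)) ∧
      (c s ∈ interior D → Tendsto (fun i => (S.vel (γ i) s).fst) U (𝓝 (v s))) := by
  have hiso := exists_isolated hD hSD h_interior h_boundary
  have hlimM : ∀ s, ∃ q, Tendsto (fun i => γ i s) U (𝓝 q) := fun s => by
    obtain ⟨q, -, hq⟩ := Ultrafilter.exists_tendsto_of_isCompact U (isCompact_univ (X := M))
      (g := fun i => γ i s) (Eventually.of_forall fun _ => mem_univ _)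
    exact ⟨q, hq⟩
  refine Icc_induction ⟨hpos, fun _ => hvel⟩ (fun s hs0 hsT hgood => ?_) (fun s hs0 hsT hgood => ?_)
  · have hsI : s ∈ Icc 0 T := ⟨hs0, hsT.le⟩
    obtain ⟨q, hq⟩ := hlimM s
    obtain ⟨hg1, hg2⟩ := hgood s hs0 le_rfl
    have hqc : S.proj q = c s :=
      tendsto_nhds_unique ((S.continuous_proj.tendsto q).comp hq) hg1
    rcases mem_interior_or_frontier hD (hc.mem s hsI) with hint | hfr
    · obtain ⟨-, δ', hδ', hfree⟩ := hc.free s hsI hint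
      obtain ⟨δ, hδ, V, -, -, hlim⟩ := exists_limit_of_mem_interior hiso hε0 hε hgeo hq
        (h_interior q (hqc ▸ hint))
      have hV : V = v s := tendsto_nhds_unique (hlim s (by simpa using hδ)).1 (hg2 hint)
      refine ⟨min δ δ', by positivity, fun s' h1 h2 h3 => ?_⟩
      have h4 : |s' - s| = s' - s := abs_of_pos (by linarith)
      obtain ⟨h5, h6⟩ := hfree s' ⟨by linarith, h3⟩ (by rw [h4]; linarith [min_le_right δ δ'])
      obtain ⟨h7, h8⟩ := hlim s' (by rw [h4]; linarith [min_le_left δ δ'])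
      rw [h5, h6]
      rw [hV] at h7 h8
      rw [hqc] at h8
      exact ⟨h8, fun _ => h7⟩
    · have hs0' : 0 < s := by
        rcases hs0.eq_or_lt with h | h
        · rw [← h] at hfr
          exact absurd hfr (notMem_frontier_of_mem_interior hc0)
        · exact h
      obtain ⟨m, v₁, v₂, hm, hv₁m, hv₂, δ', hδ', hrefl⟩ := hc.reflect s hsI hfr
      -- A transversal incoming line is off the boundary just before s. There the path lies over the
      -- interior, so v₁ has norm 1 and the induction hypothesis gives the convergence of the
      -- velocities to v₁.
      have hev := eventually_notMem_frontier hm hv₁m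
      obtain ⟨δ₂, hδ₂, hev⟩ := Metric.eventually_nhds_iff.mp (eventually_nhdsWithin_iff.mp hev)
      set δ₁ := min s (min δ' δ₂) with hδ₁
      have hδ₁0 : 0 < δ₁ := by positivity
      have hδ₁s : δ₁ ≤ s := min_le_left _ _
      have hδ₁' : δ₁ ≤ δ' := (min_le_right _ _).trans (min_le_left _ _)
      have hδ₁₂ : δ₁ ≤ δ₂ := (min_le_right _ _).trans (min_le_right _ _)
      have hbefore : ∀ t, s - δ₁ < t → t < s → v t = v₁ ∧ c t ∈ interior D := by
        intro t h1 h2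
        have htI : t ∈ Icc 0 T := ⟨by linarith, by linarith⟩
        obtain ⟨h3, h4⟩ := (hrefl t htI).1 (by linarith) h2
        refine ⟨h3, (mem_interior_or_frontier hD (hc.mem t htI)).resolve_right ?_⟩
        rw [h4]
        refine hev ?_ (by rw [mem_compl_iff, mem_singleton_iff]; linarith)
        rw [Real.dist_0_eq_abs, abs_of_neg (by linarith)]
        linarith
      have hv₁ : ‖v₁‖ = 1 := by
        obtain ⟨h1, h2⟩ := hbefore (s - δ₁ / 2) (by linarith) (by linarith)
        rw [← h1]
        exact (hc.free _ ⟨by linarith, by linarith⟩ h2).1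
      obtain ⟨δ, hδ, hlim⟩ := exists_limit_of_mem_frontier hD hSD h_interior h_boundary hε0 hε hgeo
        hq (hqc ▸ hfr) (hqc ▸ hm) hv₁ hv₁m hδ₁0 (fun t h1 h2 => by
          obtain ⟨h3, h4⟩ := hbefore t h1 h2
          rw [← h3]
          exact (hgood t (by linarith) h2.le).2 h4)
      rw [← hv₂, hqc] at hlim
      refine ⟨min δ δ', by positivity, fun t h1 h2 h3 => ?_⟩
      obtain ⟨h4, h5⟩ := (hrefl t ⟨by linarith, h3⟩).2 h1 (by linarith [min_le_right δ δ'])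
      obtain ⟨h6, h7⟩ := hlim t h1 (by linarith [min_le_left δ δ'])
      rw [h4, h5]
      exact ⟨h7, fun _ => h6⟩
  · have hsI : s ∈ Icc 0 T := ⟨hs0.le, hsT⟩
    obtain ⟨q, hq⟩ := hlimM s
    have hpq : Tendsto (fun i => S.proj (γ i s)) U (𝓝 (S.proj q)) :=
      (S.continuous_proj.tendsto q).comp hq
    obtain ⟨w, δ, hδ, hleft⟩ := hc.exists_left hD hsI
    -- The limit at s and c s are both O(s - s') away from c s', where convergence is known; letting
    -- s' tend to s identifies them.
    have hk : ∀ s', 0 ≤ s' → s - δ < s' → s' < s → ∃ k : Plane, ‖k‖ ≤ (s - s') * (‖w‖ + 1) ∧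
        S.proj q = c s + toBase Λ k := by
      intro s' h1 h2 h3
      have hd : ∀ i, ∃ y : Plane, (∀ t, S.IsUnitGeodesicAt (ε i) (γ i) t) → ‖y‖ ≤ s - s' ∧
          S.proj (γ i s) = S.proj (γ i s') + toBase Λ y := fun i => by
        by_cases h : ∀ t, S.IsUnitGeodesicAt (ε i) (γ i) t
        · obtain ⟨y, hy, hy'⟩ := exists_displacement h s s'
          rw [abs_of_pos (by linarith)] at hy
          exact ⟨y, fun _ => ⟨hy, hy'⟩⟩
        · exact ⟨0, fun h' => absurd h' h⟩
      choose y hy using hd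
      obtain ⟨y₀, hy₀, hlim⟩ := Ultrafilter.exists_tendsto_of_isCompact U
        (isCompact_closedBall (0 : Plane) (s - s')) (g := y) (by
          filter_upwards [hgeo] with i hi
          simpa using (hy i hi).1)
      have h4 : Tendsto (fun i => S.proj (γ i s)) U (𝓝 (c s' + toBase Λ y₀)) := by
        refine ((hgood s' h1 h3).1.add ((continuous_toBase.tendsto y₀).comp hlim)).congr' ?_
        filter_upwards [hgeo] with i hi
        exact (hy i hi).2.symm
      refine ⟨(s' - s) • w + y₀, ?_, ?_⟩
      · rw [mem_closedBall_zero_iff] at hy₀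
        have h5 := norm_add_le ((s' - s) • w) y₀
        rw [norm_smul, Real.norm_eq_abs, abs_of_neg (by linarith)] at h5
        linarith
      · rw [tendsto_nhds_unique hpq h4, hleft s' ⟨h1, by linarith⟩ h2 h3, toBase_add, add_assoc]
    have hqc : S.proj q = c s := by
      by_contra hne
      have h1 : ContinuousAt (fun k : Plane => c s + toBase Λ k) 0 :=
        (continuous_const.add continuous_toBase).continuousAt
      have h2 : ∀ᶠ k in 𝓝 (0 : Plane), c s + toBase Λ k ≠ S.proj q := by
        refine h1.eventually_ne ?_
        rw [toBase_zero, add_zero]; exact Ne.symm hne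
      obtain ⟨ρ, hρ, H⟩ := Metric.eventually_nhds_iff_ball.mp h2
      set d := min s (min δ (ρ / (‖w‖ + 1))) / 2 with hd
      have hw : 0 < ‖w‖ + 1 := by positivity
      have hm : 0 < min s (min δ (ρ / (‖w‖ + 1))) := by positivity
      have hd1 : min s (min δ (ρ / (‖w‖ + 1))) ≤ s := min_le_left _ _
      have hd2 : min s (min δ (ρ / (‖w‖ + 1))) ≤ δ := (min_le_right _ _).trans (min_le_left _ _)
      have hd3 : min s (min δ (ρ / (‖w‖ + 1))) ≤ ρ / (‖w‖ + 1) :=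
        (min_le_right _ _).trans (min_le_right _ _)
      obtain ⟨k, hk1, hk2⟩ := hk (s - d) (by linarith) (by linarith) (by linarith)
      refine H k ?_ hk2.symm
      rw [mem_ball_zero_iff]
      have h3 : d < ρ / (‖w‖ + 1) := by linarith
      rw [lt_div_iff₀ hw] at h3
      rw [sub_sub_cancel] at hk1
      linarith
    rw [← hqc]
    refine ⟨hpq, fun hint => ?_⟩
    obtain ⟨-, δ', hδ', hfree⟩ := hc.free s hsI (hqc ▸ hint)
    obtain ⟨δ'', hδ'', V, -, -, hlim⟩ := exists_limit_of_mem_interior hiso hε0 hε hgeo hq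
      (h_interior q hint)
    have hnear : ∀ᶠ s' in 𝓝 s, c s + toBase Λ ((s' - s) • v s) ∈ interior D := by
      have h1 : ContinuousAt (fun s' : ℝ => c s + toBase Λ ((s' - s) • v s)) s :=
        (continuous_const.add (continuous_toBase.comp (by fun_prop))).continuousAt
      refine h1 (isOpen_interior.mem_nhds ?_)
      change c s + toBase Λ ((s - s) • v s) ∈ _
      rw [sub_self, zero_smul, toBase_zero, add_zero, ← hqc]
      exact hint
    have hnear' : ∀ᶠ s' in 𝓝[<] s, |s' - s| < min δ' δ'' := by
      refine Filter.Eventually.filter_mono nhdsWithin_le_nhds ?_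
      have h1 : ContinuousAt (fun s' : ℝ => |s' - s|) s := by fun_prop
      exact h1.eventually_lt_const (by simpa using ⟨hδ', hδ''⟩)
    -- Near s the limit velocity of the geodesics and v are both constant, so they can be compared
    -- at a slightly earlier time that is known to be good.
    obtain ⟨s', h1, h2, h3, h4⟩ := ((hnear.filter_mono nhdsWithin_le_nhds).and (hnear'.and
      ((eventually_gt_nhds hs0).filter_mono nhdsWithin_le_nhds |>.and
        self_mem_nhdsWithin))).exists
    have h4' : s' < s := h4
    obtain ⟨h5, h6⟩ := hfree s' ⟨h3.le, by linarith⟩ (h2.trans_le (min_le_left _ _))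
    rw [← h6] at h1
    have h7 := (hgood s' h3.le h4').2 h1
    rw [h5] at h7
    rw [tendsto_nhds_unique h7 (hlim s' (h2.trans_le (min_le_right _ _))).1]
    exact (hlim s (by simpa using hδ'')).1

end ImmersedSurface

end

section

/-! ### Convergence of the geodesic flows -/

/-- Continuous convergence on a compact set is uniform. -/
theorem tendstoUniformlyOn_of_forall_tendsto {α β ι : Type*} [TopologicalSpace α] [UniformSpace β]
    {l : Filter ι} [l.NeBot] {f : ι → α → β} {F : α → β} {K : Set α} (hK : IsCompact K)
    (h : ∀ a ∈ K, Tendsto (fun x : ι × α => f x.1 x.2) (l ×ˢ 𝓝 a) (𝓝 (F a))) :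
    TendstoUniformlyOn f F l K := by
  intro E hE
  obtain ⟨V, hV, hVs, hVE⟩ := comp_symm_mem_uniformity_sets hE
  obtain ⟨C, hC, hCc, hCV⟩ := mem_uniformity_isClosed hV
  have hpt : ∀ a ∈ K, Tendsto (fun i => f i a) l (𝓝 (F a)) := fun a ha =>
    (h a ha).comp (tendsto_id.prodMk tendsto_const_nhds)
  refine hK.induction_on (p := fun s => ∀ᶠ i in l, ∀ a ∈ s, (F a, f i a) ∈ E)
    (by simp) (fun s t hst ht => ht.mono fun i hi a ha => hi a (hst ha))
    (fun s t hs ht => ?_) (fun a ha => ?_)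
  · filter_upwards [hs, ht] with i h1 h2 a ha
    exact ha.elim (h1 a) (h2 a)
  · have h1 : ∀ᶠ x in l ×ˢ 𝓝 a, (F a, f x.1 x.2) ∈ C :=
      h a ha (UniformSpace.ball_mem_nhds _ hC)
    obtain ⟨p, hp, s, hs, hps⟩ := eventually_prod_iff.mp h1
    refine ⟨{x | s x} ∩ K, inter_mem (mem_nhdsWithin_of_mem_nhds hs) self_mem_nhdsWithin, ?_⟩
    filter_upwards [hp] with i hi b hb
    -- No continuity of F is assumed: F b is a limit of values f j b, all C-close to F a, and C is
    -- closed.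
    have h2 : (F a, F b) ∈ C := by
      refine hCc.mem_of_tendsto (tendsto_const_nhds.prodMk_nhds (hpt b hb.2)) ?_
      filter_upwards [hp] with j hj
      exact hps hj hb.1
    exact hVE ⟨F a, hVs.symm _ _ (hCV h2), hCV (hps hi hb.1)⟩

theorem eventually_forall_of_isCompact {α ι : Type*} [TopologicalSpace α] {l : Filter ι} {K : Set α}
    (hK : IsCompact K) {p : ι → α → Prop} (h : ∀ a ∈ K, ∀ᶠ x in l ×ˢ 𝓝 a, p x.1 x.2) :
    ∀ᶠ i in l, ∀ a ∈ K, p i a := by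
  refine hK.induction_on (p := fun s => ∀ᶠ i in l, ∀ a ∈ s, p i a)
    (by simp) (fun s t hst ht => ht.mono fun i hi a ha => hi a (hst ha))
    (fun s t hs ht => ?_) (fun a ha => ?_)
  · filter_upwards [hs, ht] with i h1 h2 a ha
    exact ha.elim (h1 a) (h2 a)
  · obtain ⟨r, hr, s, hs, hrs⟩ := eventually_prod_iff.mp (h a ha)
    exact ⟨{x | s x}, mem_nhdsWithin_of_mem_nhds hs, hr.mono fun i hi b hb => hrs hi hb⟩

theorem discreteTopology_of_eq {Λ : AddSubgroup Plane} (hΛ : Λ = ⊥ ∨ Λ = integerLattice) :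
    DiscreteTopology Λ := by
  rcases hΛ with rfl | rfl
  · infer_instance
  · refine discreteTopology_of_isOpen_singleton_zero ?_
    have h : ({0} : Set integerLattice) = Subtype.val ⁻¹' Metric.ball (0 : Plane) 1 := by
      ext ⟨x, hx⟩
      constructor
      · intro h
        rw [mem_singleton_iff] at h
        rw [h]
        simp
      · intro h
        rw [mem_preimage, mem_ball_zero_iff] at h
        rw [mem_singleton_iff, AddSubgroup.mk_eq_zero]
        ext j
        obtain ⟨n, hn⟩ := hx j
        have h1 : |x j| < 1 := by
          have := PiLp.norm_apply_le x j
          rw [Real.norm_eq_abs] at this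
          change ‖x‖ < 1 at h
          linarith
        rw [hn, ← Int.cast_abs] at h1
        have h2 : n = 0 := Int.abs_lt_one_iff.mp (Int.cast_lt (R := ℝ).mp (by rwa [Int.cast_one]))
        rw [hn, h2]; simp
    rw [h]
    exact Metric.isOpen_ball.preimage continuous_subtype_val

/-- Reflections are involutions, so a reversed collision comes in with -v₂ and goes out with -v₁.
This reduces negative times to positive ones. -/
theorem IsBilliardPath.neg {Λ : AddSubgroup Plane} {D : Set (Base Λ)} {I I' : Set ℝ}
    {c : ℝ → Base Λ} {v : ℝ → Plane} (h : IsBilliardPath D I c v) (hI : ∀ s ∈ I', -s ∈ I) :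
    IsBilliardPath D I' (fun s => c (-s)) (fun s => -v (-s)) where
  mem s hs := h.mem _ (hI s hs)
  free s hs hint := by
    obtain ⟨h1, δ, hδ, H⟩ := h.free _ (hI s hs) hint
    refine ⟨by rw [norm_neg, h1], δ, hδ, fun s' hs' hd => ?_⟩
    obtain ⟨h2, h3⟩ := H _ (hI s' hs') (by rwa [neg_sub_neg, abs_sub_comm])
    rw [h2, h3, smul_neg, ← neg_smul, neg_sub, neg_sub_neg]
    exact ⟨rfl, rfl⟩
  reflect s hs hfr := by
    obtain ⟨m, v₁, v₂, hm, hne, hv, δ, hδ, H⟩ := h.reflect _ (hI s hs) hfr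
    have h1 : ⟪v₂, m⟫_ℝ = -⟪v₁, m⟫_ℝ := by
      rw [hv, inner_sub_left, real_inner_smul_left, real_inner_self_eq_norm_sq, hm.1]
      ring
    refine ⟨m, -v₂, -v₁, hm, ?_, ?_, δ, hδ, fun s' hs' => ⟨fun h2 h3 => ?_, fun h2 h3 => ?_⟩⟩
    · rw [inner_neg_left, h1, neg_neg]; exact hne
    · rw [inner_neg_left, h1, neg_neg, hv]; abel
    · obtain ⟨h4, h5⟩ := (H _ (hI s' hs')).2 (by linarith) (by linarith)
      rw [h4, h5, smul_neg, ← neg_smul, neg_sub, neg_sub_neg]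
      exact ⟨rfl, rfl⟩
    · obtain ⟨h4, h5⟩ := (H _ (hI s' hs')).1 (by linarith) (by linarith)
      rw [h4, h5, smul_neg, ← neg_smul, neg_sub, neg_sub_neg]
      exact ⟨rfl, rfl⟩

/-! ### Joint convergence in the flattening, the time and the initial vector -/

variable {M : Type*} [TopologicalSpace M] [ChartedSpace Plane M] [IsManifold (𝓡 2) ∞ M]
variable {Λ : AddSubgroup Plane} [DiscreteTopology Λ]

namespace ImmersedSurface

variable {S : ImmersedSurface M Λ} {D : Set (Base Λ)}

theorem Slice.tangentMap_snd {q : M} {W : Set M} {O : Set Space} {G : Space → ℝ}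
    {r : Space → M} {n : Space} (h : S.Slice q W O G r n) {u : TangentBundle (𝓡 2) M}
    (hu : u.proj ∈ W) :
    (tangentMapWithin (𝓡 2) 𝓘(ℝ, Space) (S.lift q) W u).2 = S.diff u.proj u.snd := by
  rw [h.diff_eq hu, tangentMapWithin, mfderivWithin_of_isOpen h.isOpen_W hu]
  rfl

theorem continuous_diff (S : ImmersedSurface M Λ) :
    Continuous fun u : TangentBundle (𝓡 2) M => S.diff u.proj u.snd := by
  have : IsManifold (𝓡 2) 1 M := IsManifold.of_le (n := ∞) (by norm_cast)
  rw [continuous_iff_continuousAt]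
  intro u
  obtain ⟨W, O, G, r, n, h⟩ := S.exists_slice u.proj
  have hpre : Bundle.TotalSpace.proj ⁻¹' W ∈ 𝓝 u :=
    (FiberBundle.continuous_proj Plane (TangentSpace (𝓡 2) (M := M))).continuousAt
      (h.isOpen_W.mem_nhds h.mem_W)
  have h1 : ContinuousAt (tangentMapWithin (𝓡 2) 𝓘(ℝ, Space) (S.lift u.proj) W) u :=
    (h.smooth_lift.continuousOn_tangentMapWithin (by simp)
      h.isOpen_W.uniqueMDiffOn).continuousAt hpre
  have h2 : Continuous fun p : TangentBundle 𝓘(ℝ, Space) Space => p.2 :=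
    (contMDiff_snd_tangentBundle_modelSpace (n := 0) Space 𝓘(ℝ, Space)).continuous
  refine (h2.continuousAt.comp h1).congr ?_
  filter_upwards [hpre] with u' hu'
  exact h.tangentMap_snd hu'

variable {ι : Type*} {U : Ultrafilter ι} {ε : ι → ℝ} {u : ι → TangentBundle (𝓡 2) M}
  {u₀ : TangentBundle (𝓡 2) M}

/-- Normalizing for g_ε becomes, in the limit, normalizing the horizontal projection; this matches
the initial velocities of geodesics and billiard. -/
theorem tendsto_gnorm (hε : Tendsto ε U (𝓝 0)) (hu : Tendsto u U (𝓝 u₀)) :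
    Tendsto (fun i => S.gnorm (ε i) (u i)) U (𝓝 ‖(S.diff u₀.proj u₀.snd).fst‖) := by
  have h1 := (S.continuous_diff.tendsto u₀).comp hu
  have h2 : Tendsto (fun i => (S.diff (u i).proj (u i).snd).fst) U
      (𝓝 (S.diff u₀.proj u₀.snd).fst) := (fstL.continuous.tendsto _).comp h1
  have h3 : Tendsto (fun i => (S.diff (u i).proj (u i).snd).snd) U
      (𝓝 (S.diff u₀.proj u₀.snd).snd) := (sndL.continuous.tendsto _).comp h1
  have h4 := (((h2.norm.pow 2).add ((hε.pow 2).mul (h3.pow 2))).sqrt)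
  have h5 : √(‖(S.diff u₀.proj u₀.snd).fst‖ ^ 2 + 0 ^ 2 * (S.diff u₀.proj u₀.snd).snd ^ 2) =
      ‖(S.diff u₀.proj u₀.snd).fst‖ := by
    rw [zero_pow two_ne_zero, zero_mul, add_zero, Real.sqrt_sq (norm_nonneg _)]
  rw [h5] at h4
  refine h4.congr fun i => ?_
  rw [← norm_flatten_sq, Real.sqrt_sq (norm_nonneg _), gnorm]

theorem fst_diff_ne_zero (hu : u₀ ∈ S.unitTangent) (h : ez ∉ S.tangentPlane u₀.proj) :
    (S.diff u₀.proj u₀.snd).fst ≠ 0 := by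
  intro h0
  set P := S.diff u₀.proj u₀.snd with hP
  have h1 : P = P.snd • ez := by
    apply Space.ext
    · simp [ez_fst, h0]
    · simp [ez_snd]
  have h2 : P.snd ≠ 0 := by
    intro h2
    have h3 : ‖flatten 1 P‖ = 1 := hu
    have h4 := norm_flatten_sq 1 P
    rw [h3, h0, h2] at h4
    norm_num at h4
  refine h ?_
  have h3 : P.snd⁻¹ • P ∈ S.tangentPlane u₀.proj := Submodule.smul_mem _ _ ⟨_, rfl⟩
  rwa [h1, WithLp.smul_snd, ez_snd, smul_eq_mul, mul_one, smul_smul, inv_mul_cancel₀ h2,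
    one_smul] at h3

variable [T2Space M] [CompactSpace M]

/-- The trajectories of the geodesic flows converge to the non-tangential billiard trajectories. -/
theorem tendsto_of_billiardReaches (hD : IsClosed D) (hSD : S.shadow = D)
    (h_interior : ∀ q : M, S.proj q ∈ interior D → ez ∉ S.tangentPlane q)
    (h_boundary : ∀ q : M, S.proj q ∈ frontier D → S.HasCurvedVerticalSection q)
    (hε0 : ∀ᶠ i in U, 0 < ε i) (hε : Tendsto ε U (𝓝 0)) (hu : Tendsto u U (𝓝 u₀))
    {τ : ι → ℝ} {t : ℝ} (hτ : Tendsto τ U (𝓝 t)) (hu₀ : u₀ ∈ S.unitTangent)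
    (hint : (S.projUnit u₀).1 ∈ interior D) {y : Base Λ × Plane}
    (hy : BilliardReaches D t (S.projUnit u₀) y) :
    Tendsto (fun i => S.proj (S.geodesicFlow (ε i) (τ i) (u i)).proj) U (𝓝 y.1) ∧
      (y.1 ∈ interior D →
        Tendsto (fun i => S.projUnit (S.geodesicFlow (ε i) (τ i) (u i))) U (𝓝 y)) := by
  have hiso := exists_isolated hD hSD h_interior h_boundary
  obtain ⟨c, v, hpath, h0, rfl⟩ := hy
  have hc0 : c 0 = S.proj u₀.proj := congrArg Prod.fst h0
  have hv0 : v 0 = ‖(S.diff u₀.proj u₀.snd).fst‖⁻¹ • (S.diff u₀.proj u₀.snd).fst :=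
    congrArg Prod.snd h0
  have hP0 := fst_diff_ne_zero hu₀ (h_interior _ hint)
  have hgn := tendsto_gnorm (S := S) hε hu
  have hgn0 : ∀ᶠ i in U, S.gnorm (ε i) (u i) ≠ 0 := hgn.eventually_ne (by simpa using hP0)
  have hex : ∀ i, ∃ γ : ℝ → M, 0 < ε i → S.gnorm (ε i) (u i) ≠ 0 → γ 0 = (u i).proj ∧
      S.vel γ 0 = (S.gnorm (ε i) (u i))⁻¹ • S.diff (u i).proj (u i).snd ∧
      (∀ t, S.IsUnitGeodesicAt (ε i) γ t) ∧ ∀ t, S.geodesicFlow (ε i) t (u i) = velocity γ t := by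
    intro i
    by_cases h : 0 < ε i ∧ S.gnorm (ε i) (u i) ≠ 0
    · obtain ⟨γ, hγ⟩ := S.exists_geodesicFlow_eq h.1.ne' h.2
      exact ⟨γ, fun _ _ => hγ⟩
    · exact ⟨fun _ => u₀.proj, fun h1 h2 => absurd ⟨h1, h2⟩ h⟩
  choose γ hγ using hex
  have hgeo : ∀ᶠ i in U, ∀ t, S.IsUnitGeodesicAt (ε i) (γ i) t := by
    filter_upwards [hε0, hgn0] with i h1 h2 using (hγ i h1 h2).2.2.1
  have hpos : Tendsto (fun i => S.proj (γ i 0)) U (𝓝 (c 0)) := by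
    have h1 : Continuous fun u : TangentBundle (𝓡 2) M => S.proj u.proj :=
      S.continuous_proj.comp (FiberBundle.continuous_proj Plane (TangentSpace (𝓡 2) (M := M)))
    rw [hc0]
    refine ((h1.tendsto u₀).comp hu).congr' ?_
    filter_upwards [hε0, hgn0] with i h2 h3
    rw [(hγ i h2 h3).1]; rfl
  have hvel : Tendsto (fun i => (S.vel (γ i) 0).fst) U (𝓝 (v 0)) := by
    have h1 : Tendsto (fun i => (S.diff (u i).proj (u i).snd).fst) U
        (𝓝 (S.diff u₀.proj u₀.snd).fst) :=
      (fstL.continuous.tendsto _).comp ((S.continuous_diff.tendsto u₀).comp hu)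
    rw [hv0]
    refine ((hgn.inv₀ (by simpa using hP0)).smul h1).congr' ?_
    filter_upwards [hε0, hgn0] with i h2 h3
    rw [(hγ i h2 h3).2.1]; rfl
  have hend : Tendsto (fun i => S.proj (γ i t)) U (𝓝 (c t)) ∧
      (c t ∈ interior D → Tendsto (fun i => (S.vel (γ i) t).fst) U (𝓝 (v t))) := by
    have hcint : c 0 ∈ interior D := hc0 ▸ hint
    -- For negative t both the billiard path and the geodesics are run backwards, and all velocities
    -- change sign.
    rcases le_total 0 t with ht | ht
    · rw [uIcc_of_le ht] at hpath
      exact tendsto_of_isBilliardPath hD hSD h_interior h_boundary hε0 hε hgeo hpath hcint hpos hvel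
        t ⟨ht, le_rfl⟩
    · rw [uIcc_of_ge ht] at hpath
      have hpath' := hpath.neg (I' := Icc 0 (-t)) fun s hs => ⟨by linarith [hs.2], by linarith [hs.1]⟩
      have hneg : ∀ᶠ i in U, ∀ s, S.IsUnitGeodesicAt (ε i) (fun s => γ i (-1 * s + 0)) s ∧
          S.vel (fun s => γ i (-1 * s + 0)) s = -S.vel (γ i) (-s) := by
        filter_upwards [hgeo] with i hi s
        refine ⟨IsUnitGeodesicAt.comp_affine (by simp) (hi _), ?_⟩
        rw [vel_comp_affine ((hi _).1.1.mdifferentiableAt (by simp)), neg_one_smul, neg_one_mul,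
          add_zero]
      have hvneg : ∀ s w, Tendsto (fun i => (S.vel (γ i) (-s)).fst) U (𝓝 w) ↔
          Tendsto (fun i => (S.vel (fun s => γ i (-1 * s + 0)) s).fst) U (𝓝 (-w)) := fun s w => by
        have h1 : (fun i => (S.vel (fun s => γ i (-1 * s + 0)) s).fst) =ᶠ[U]
            fun i => -(S.vel (γ i) (-s)).fst := by
          filter_upwards [hneg] with i hi
          rw [(hi s).2]; rfl
        rw [tendsto_congr' h1]
        exact ⟨fun h => h.neg, fun h => by simpa using h.neg⟩
      have h1 := tendsto_of_isBilliardPath hD hSD h_interior h_boundary hε0 hε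
        (hneg.mono fun i hi s => (hi s).1) hpath' (by simpa using hcint) (by simpa using hpos)
        ((hvneg 0 _).mp (by simpa using hvel)) (-t) ⟨by linarith, le_rfl⟩
      rw [← hvneg] at h1
      simpa using h1
  obtain ⟨hend1, hend2⟩ := hend
  -- Passing from the fixed time t to τ i costs at most |τ i - t| in position. For the velocity, the
  -- O(ε²) oscillation on an interval around t serves the same purpose.
  have hproj : Tendsto (fun i => S.proj (γ i (τ i))) U (𝓝 (c t)) := by
    have hd : ∀ i, ∃ y : Plane, (∀ t, S.IsUnitGeodesicAt (ε i) (γ i) t) → ‖y‖ ≤ |τ i - t| ∧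
        S.proj (γ i (τ i)) = S.proj (γ i t) + toBase Λ y := fun i => by
      by_cases h : ∀ t, S.IsUnitGeodesicAt (ε i) (γ i) t
      · obtain ⟨y, hy⟩ := exists_displacement h (τ i) t
        exact ⟨y, fun _ => hy⟩
      · exact ⟨0, fun h' => absurd h' h⟩
    choose y hy using hd
    have h1 : Tendsto (fun i => |τ i - t|) U (𝓝 0) := by
      simpa using (hτ.sub_const t).abs
    have h2 : Tendsto y U (𝓝 0) := squeeze_zero_norm' (hgeo.mono fun i hi => (hy i hi).1) h1
    have h3 := hend1.add ((continuous_toBase.tendsto 0).comp h2)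
    rw [toBase_zero, add_zero] at h3
    exact h3.congr' (hgeo.mono fun i hi => (hy i hi).2.symm)
  have hflow : ∀ᶠ i in U, S.geodesicFlow (ε i) (τ i) (u i) = velocity (γ i) (τ i) := by
    filter_upwards [hε0, hgn0] with i h1 h2 using (hγ i h1 h2).2.2.2 _
  refine ⟨hproj.congr' (hflow.mono fun i hi => by simp only [hi]; rfl), fun hct => ?_⟩
  obtain ⟨q, -, hq⟩ := Ultrafilter.exists_tendsto_of_isCompact U (isCompact_univ (X := M))
    (g := fun i => γ i t) (Eventually.of_forall fun _ => mem_univ _)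
  have hqc : S.proj q = c t := tendsto_nhds_unique ((S.continuous_proj.tendsto q).comp hq) hend1
  obtain ⟨δ, hδ, V, hV, ⟨C, hC⟩, hlim⟩ := exists_limit_of_mem_interior hiso hε0 hε hgeo hq
    (h_interior q (hqc ▸ hct))
  have hVv : v t = V := tendsto_nhds_unique (hend2 hct) (hlim t (by simpa using hδ)).1
  have hvτ : Tendsto (fun i => (S.vel (γ i) (τ i)).fst) U (𝓝 (v t)) := by
    have h1 : Tendsto (fun i => C * ε i ^ 2) U (𝓝 0) := by simpa using (hε.pow 2).const_mul C
    have h2 : ∀ᶠ i in U, |τ i - t| < δ := by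
      have h3 : Tendsto (fun i => |τ i - t|) U (𝓝 0) := by simpa using (hτ.sub_const t).abs
      exact h3.eventually_lt_const hδ
    have h3 : Tendsto (fun i => (S.vel (γ i) (τ i)).fst - (S.vel (γ i) t).fst) U (𝓝 0) := by
      refine squeeze_zero_norm' ?_ h1
      filter_upwards [hC, h2] with i h3 h4 using h3 _ h4
    simpa using h3.add (hend2 hct)
  have h1 : ‖v t‖ = 1 := by rw [hVv, hV]
  have h2 := (hvτ.norm.inv₀ (by rw [h1]; exact one_ne_zero)).smul hvτ
  rw [h1, inv_one, one_smul] at h2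
  exact (hproj.prodMk_nhds h2).congr' (hflow.mono fun i hi => by simp only [hi]; rfl)

/-- Convergence of the geodesic flows at a non-tangential point. -/
theorem tendsto_geodesicFlow (hD : IsClosed D) (hSD : S.shadow = D)
    (h_interior : ∀ q : M, S.proj q ∈ interior D → ez ∉ S.tangentPlane q)
    (h_boundary : ∀ q : M, S.proj q ∈ frontier D → S.HasCurvedVerticalSection q)
    {a : ℝ × TangentBundle (𝓡 2) M} (ha : a ∈ S.nonTangentialSet D) :
    Tendsto (fun x : ℝ × ℝ × TangentBundle (𝓡 2) M =>
        S.projUnit (S.geodesicFlow x.1 x.2.1 x.2.2)) (𝓝[>] 0 ×ˢ 𝓝 a)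
        (𝓝 (billiardFlow D a.1 (S.projUnit a.2))) ∧
      (billiardFlow D a.1 (S.projUnit a.2)).1 ∈ interior D := by
  obtain ⟨ha1, ha2, y, hy, hyD⟩ := ha
  have key : ∀ (V : Ultrafilter (ℝ × ℝ × TangentBundle (𝓡 2) M)), (V : Filter _) ≤ 𝓝[>] (0 : ℝ) ×ˢ 𝓝 a →
      ∀ y, BilliardReaches D a.1 (S.projUnit a.2) y →
      Tendsto (fun x : ℝ × ℝ × TangentBundle (𝓡 2) M =>
        S.proj (S.geodesicFlow x.1 x.2.1 x.2.2).proj) V (𝓝 y.1) ∧ (y.1 ∈ interior D →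
      Tendsto (fun x : ℝ × ℝ × TangentBundle (𝓡 2) M =>
        S.projUnit (S.geodesicFlow x.1 x.2.1 x.2.2)) V (𝓝 y)) := fun V hV y hy => by
    have h1 : Tendsto (fun x : ℝ × ℝ × TangentBundle (𝓡 2) M => x.1) V (𝓝[>] 0) :=
      tendsto_fst.mono_left hV
    have h2 : Tendsto (fun x : ℝ × ℝ × TangentBundle (𝓡 2) M => x.2) V (𝓝 a) :=
      tendsto_snd.mono_left hV
    exact tendsto_of_billiardReaches (U := V) hD hSD h_interior h_boundary
      (h1 self_mem_nhdsWithin) (h1.mono_right nhdsWithin_le_nhds)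
      ((continuous_snd.tendsto a).comp h2) ((continuous_fst.tendsto a).comp h2) ha1 ha2 hy
  -- Uniqueness of the billiard state follows from the convergence: every state that can be reached
  -- is a limit of the same geodesics, first in position and then, over the interior, in velocity.
  have hflow : billiardFlow D a.1 (S.projUnit a.2) = y := by
    have hex : ∃ y, BilliardReaches D a.1 (S.projUnit a.2) y := ⟨y, hy⟩
    rw [billiardFlow, dif_pos hex]
    have hV := Ultrafilter.of_le (𝓝[>] (0 : ℝ) ×ˢ 𝓝 a)
    obtain ⟨h1, h2⟩ := key _ hV _ hex.choose_spec
    obtain ⟨h3, h4⟩ := key _ hV y hy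
    have h5 := tendsto_nhds_unique h1 h3
    exact tendsto_nhds_unique (h2 (h5 ▸ hyD)) (h4 hyD)
  rw [hflow]
  refine ⟨?_, hyD⟩
  rw [tendsto_iff_ultrafilter]
  exact fun V hV => (key V hV y hy).2 hyD

end ImmersedSurface

end

end FlatBilliard

end

/-! ### Uniform convergence on compact subsets of A -/

theorem mainTheorem1
    (Λ : AddSubgroup FlatBilliard.Plane)
    (hΛ : Λ = ⊥ ∨ Λ = FlatBilliard.integerLattice)
    {M : Type*} [TopologicalSpace M] [T2Space M] [CompactSpace M]
    [ChartedSpace FlatBilliard.Plane M] [IsManifold (𝓡 2) ∞ M]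
    (S : FlatBilliard.ImmersedSurface M Λ)
    (D : Set (FlatBilliard.Base Λ))
    (hD : FlatBilliard.IsSmoothTable D)
    (hSD : S.shadow = D)
    (h_interior : ∀ q : M, S.proj q ∈ interior D → FlatBilliard.ez ∉ S.tangentPlane q)
    (h_boundary : ∀ q : M, S.proj q ∈ frontier D → S.HasCurvedVerticalSection q)
    (K : Set (ℝ × TangentBundle (𝓡 2) M))
    (hK : IsCompact K) (hKA : K ⊆ S.nonTangentialSet D) :
    (∀ᶠ ε in 𝓝[>] (0 : ℝ), ∀ a ∈ K,
      S.proj (S.geodesicFlow ε a.1 a.2).proj ∈ interior D) ∧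
    TendstoUniformlyOn
      (fun (ε : ℝ) (a : ℝ × TangentBundle (𝓡 2) M) => S.projUnit (S.geodesicFlow ε a.1 a.2))
      (fun a => FlatBilliard.billiardFlow D a.1 (S.projUnit a.2))
      (𝓝[>] (0 : ℝ)) K := by
  have := FlatBilliard.discreteTopology_of_eq hΛ
  have hDc : IsClosed D := by
    obtain ⟨⟨U, -, rfl⟩, -⟩ := hD
    exact isClosed_closure
  have key := fun a ha => FlatBilliard.ImmersedSurface.tendsto_geodesicFlow hDc hSD h_interior
    h_boundary (hKA (a := a) ha)
  refine ⟨FlatBilliard.eventually_forall_of_isCompact hK fun a ha => ?_,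
    FlatBilliard.tendstoUniformlyOn_of_forall_tendsto hK fun a ha => (key a ha).1⟩
  have h1 := (continuous_fst.tendsto _).comp (key a ha).1
  exact h1 (isOpen_interior.mem_nhds (key a ha).2)
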